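/- **Proposition 3.1.** Let $p\ge 1$, $n=2p$, and let $(M,g)$ be a connected, oriented, smooth $n$-dimensional Lorentzian manifold (a spacetime) with Levi-Civita connection $\nabla$ and volume form $\epsilon$. Let $F$ be a smooth $p$-form on $M$, and let $K\in\{0,1,2,\dots\}\cup\{\infty\}$. *Definitions.* A tensor field is *constructed polynomially* from $F$ and its first $K$ covariant derivatives (from $F$ and all its covariant derivatives if $K=\infty$) if it is a finite linear combination with constant coefficients of contractions of tensor products of the tensors $F,\nabla F,\dots,\nabla^jF$ ($j\le K$), $g$ and $\epsilon$, each product having at least one factor $\nabla^jF$; in particular the Hodge dual $*F$ and its derivatives of order $\le K$ may be used. The scalars so obtained are called the *invariants*. $\tilde F$ denotes any $p$-form that is a finite sum of tensors constructed in this way, with coefficients that may be arbitrary smooth functions of finitely many invariants. $F$ is *$K$-universal* (*universal* for $K=\infty$) if $\mathrm dF=0$ and $\mathrm d{*}\tilde F=0$ for all such $\tilde F$. $F$ is $\mathrm{CSI}_K$ (*CSI* for $K=\infty$) if all the invariants are constant on $M$. A $p$-form $\omega$ is *null at $x\in M$, aligned with* a nonzero null vector $\ell\in T_xM$, if $\ell^a\omega_{ab_1\dots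 b_{p-1}}=0$ and $\ell_{[a}\omega_{b_1\dots b_p]}=0$ at $x$. *Statement.* If $F$ is $K$-universal, then either (i) $F$ is $\mathrm{CSI}_K$, or (ii) $F$ and all the forms $\tilde F$ are null with a common aligned null direction, along which all invariants are constant. That is, at every $x\in M$ there is a nonzero null vector $k\in T_xM$ such that $F$ and every $\tilde F$ are null at $x$ and aligned with $k$, and $k^a I_{,a}=0$ for every invariant $I$. Moreover, there is an invariant whose gradient does not vanish identically; and whenever $I$ is an invariant and $x\in M$ is a point with $I_{,a}(x)\ne0$, the gradient $\ell_a=I_{,a}$ spans such a direction: $\ell$ is null, $F$ and every $\tilde F$ are null at $x$ and aligned with $\ell$, the direction of $\ell$ is geodesic at $x$ ($\ell^b\nabla_b\ell_a\propto\ell_a$) and twist-free at $x$ ($v^aw^b(\nabla_b\ell_a-\nabla_a\ell_b)=0$ for all $v,w$ orthogonal to $\ell$), and for every invariant $J$ one has $\ell^aJ_{,a}=0$ and $J_{,a}(x)$ is a multiple of $I_{,a}(x)$. -/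

import Mathlib

open scoped Manifold ContDiff

noncomputable section

namespace UnivForm

/-! ### Tensor fields on a manifold and their components in charts -/

/-- (Not necessarily smooth) covariant tensor fields of rank `k` on an `n`-dimensional manifold. -/
abbrev TensorField (n : ℕ) (M : Type*) [TopologicalSpace M]
    [ChartedSpace (EuclideanSpace ℝ (Fin n)) M] (k : ℕ) : Type _ :=
  ∀ x : M, MultilinearMap ℝ (fun _ : Fin k => TangentSpace (𝓡 n) x) ℝ

section Fields

variable {n : ℕ} {M : Type*} [TopologicalSpace M] [ChartedSpace (EuclideanSpace ℝ (Fin n)) M]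

/-- The smooth local charts of `M`. -/
abbrev IsChart (e : OpenPartialHomeomorph M (EuclideanSpace ℝ (Fin n))) : Prop :=
  e ∈ IsManifold.maximalAtlas (𝓡 n) ∞ M

/-- The `i`-th coordinate vector `∂ᵢ` of the chart `e`, at the point with coordinates `y`. -/
def coordVec (e : OpenPartialHomeomorph M (EuclideanSpace ℝ (Fin n)))
    (y : EuclideanSpace ℝ (Fin n)) (i : Fin n) : TangentSpace (𝓡 n) (e.symm y) :=
  mfderiv (𝓡 n) (𝓡 n) e.symm y (EuclideanSpace.single i (1 : ℝ) : EuclideanSpace ℝ (Fin n))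

/-- The components `T_{a₁ … a_k}` of `T` in the chart `e`, as functions of the coordinates `y`. -/
def comp {k : ℕ} (T : TensorField n M k) (e : OpenPartialHomeomorph M (EuclideanSpace ℝ (Fin n)))
    (y : EuclideanSpace ℝ (Fin n)) (a : Fin k → Fin n) : ℝ :=
  T (e.symm y) (fun j => coordVec e y (a j))

/-- Partial derivative with respect to the `b`-th coordinate. -/
def pderiv (f : EuclideanSpace ℝ (Fin n) → ℝ) (y : EuclideanSpace ℝ (Fin n)) (b : Fin n) : ℝ :=
  fderiv ℝ f y (EuclideanSpace.single b (1 : ℝ))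

/-- Smooth tensor fields: all components in all charts are smooth. -/
def IsSmooth {k : ℕ} (T : TensorField n M k) : Prop :=
  ∀ e : OpenPartialHomeomorph M (EuclideanSpace ℝ (Fin n)), IsChart e → ∀ a : Fin k → Fin n,
    ContDiffOn ℝ ∞ (fun y => comp T e y a) e.target

/-- Totally antisymmetric tensor fields. -/
def IsAlternating {k : ℕ} (T : TensorField n M k) : Prop :=
  ∀ (x : M) (v : Fin k → TangentSpace (𝓡 n) x) (i j : Fin k), i ≠ j → v i = v j → T x v = 0

/-- `dW = 0`, where `(dW)_{a₀ … a_k} = ∑ⱼ (-1)ʲ ∂_{aⱼ} W_{a₀ … âⱼ … a_k}` in every chart. -/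
def IsClosedForm {k : ℕ} (W : TensorField n M k) : Prop :=
  ∀ e : OpenPartialHomeomorph M (EuclideanSpace ℝ (Fin n)), IsChart e →
    ∀ y ∈ e.target, ∀ a : Fin (k + 1) → Fin n,
      ∑ j : Fin (k + 1), (-1 : ℝ) ^ (j : ℕ) *
        pderiv (fun z => comp W e z (fun i => a (j.succAbove i))) y (a j) = 0

/-- The differential `dI` of a scalar function at `x`. -/
def diff (I : M → ℝ) (x : M) : TangentSpace (𝓡 n) x →L[ℝ] ℝ :=
  mfderiv (𝓡 n) 𝓘(ℝ, ℝ) I x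

/-- The differential `dI` of a scalar function as a tensor field of rank one, `ℓ_a = I_{,a}`. -/
def diffField (I : M → ℝ) : TensorField n M 1 :=
  fun x => MultilinearMap.ofSubsingleton ℝ (TangentSpace (𝓡 n) x) ℝ (0 : Fin 1)
    (diff (n := n) I x).toLinearMap

/-! ### Lorentzian metrics and volume forms -/

/-- The value `g(v, w)`. -/
def inn (g : TensorField n M 2) (x : M) (v w : TangentSpace (𝓡 n) x) : ℝ := g x ![v, w]

/-- `b` is a `g`-orthonormal basis at `x` with exactly one timelike vector,
in the signature `(-, +, …, +)`. -/
def IsOrthonormalFrame (g : TensorField n M 2) (x : M)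
    (b : Module.Basis (Fin n) ℝ (TangentSpace (𝓡 n) x)) : Prop :=
  ∃ t : Fin n, ∀ i j : Fin n,
    inn g x (b i) (b j) = if i = j then (if i = t then -1 else 1) else 0

/-- Smooth Lorentzian metrics. -/
structure IsLorentzianMetric (g : TensorField n M 2) : Prop where
  smooth : IsSmooth g
  symm : ∀ (x : M) (v w : TangentSpace (𝓡 n) x), inn g x v w = inn g x w v
  lorentz : ∀ x : M, ∃ b : Module.Basis (Fin n) ℝ (TangentSpace (𝓡 n) x), IsOrthonormalFrame g x b

/-- `ε` is the volume form of `g` for one of the orientations of the manifold. -/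
structure IsVolumeForm (g : TensorField n M 2) (ε : TensorField n M n) : Prop where
  smooth : IsSmooth ε
  alternating : IsAlternating ε
  unit : ∀ (x : M) (b : Module.Basis (Fin n) ℝ (TangentSpace (𝓡 n) x)),
    IsOrthonormalFrame g x b → |ε x b| = 1

/-- The standard basis of `T_x M`, through the identification of `T_x M` with `ℝⁿ` given by the
preferred chart at `x`. The contractions below do not depend on the basis used. -/
def stdVec (x : M) (i : Fin n) : TangentSpace (𝓡 n) x :=
  (EuclideanSpace.single i (1 : ℝ) : EuclideanSpace ℝ (Fin n))

/-- The components `g^{ab}` at `x` of the inverse metric, in the basis `stdVec x`. -/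
def ginv (g : TensorField n M 2) (x : M) : Matrix (Fin n) (Fin n) ℝ :=
  (Matrix.of fun a b => inn g x (stdVec x a) (stdVec x b))⁻¹

/-- Raising the index of a covector: `α^b = g^{ab} α_a`. -/
def sharp (g : TensorField n M 2) (x : M) (α : TangentSpace (𝓡 n) x →L[ℝ] ℝ) :
    TangentSpace (𝓡 n) x :=
  ∑ a : Fin n, ∑ b : Fin n, (ginv g x a b * α (stdVec x a)) • stdVec x b

/-! ### Algebraic operations on tensor fields -/

/-- Tensor product of tensor fields. -/
def tensorProd {k l : ℕ} (S : TensorField n M k) (T : TensorField n M l) : TensorField n M (k + l) :=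
  fun x => ((LinearMap.mul' ℝ ℝ).compMultilinearMap ((S x).domCoprod (T x))).domDomCongr
    finSumFinEquiv

/-- Permutation of the indices of a tensor field. (The bijection between two index sets `Fin k`
and `Fin l` forces `k = l`; this form also identifies ranks such as `0 + k` and `k`.) -/
def reindex {k l : ℕ} (σ : Fin k ≃ Fin l) (T : TensorField n M k) : TensorField n M l :=
  fun x => (T x).domDomCongr σ

/-- Contraction of the first two indices: `g^{ab} T_{a b c₁ … c_k}`. -/
def contract {k : ℕ} (g : TensorField n M 2) (T : TensorField n M (k + 2)) : TensorField n M k :=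
  fun x => ∑ a : Fin n, ∑ b : Fin n,
    ginv g x a b • (((T x).curryLeft (stdVec x a)).curryLeft (stdVec x b))

/-- The Hodge dual `(*T)_{b₁ … b_q} = (1 / p!) ε^{a₁ … a_p}_{b₁ … b_q} T_{a₁ … a_p}`. -/
def hodge {p q : ℕ} (g : TensorField n M 2) (ε : TensorField n M (p + q)) (T : TensorField n M p) :
    TensorField n M q :=
  fun x => (1 / (p.factorial : ℝ)) • ∑ a : Fin p → Fin n, ∑ c : Fin p → Fin n,
    ((∏ i, ginv g x (a i) (c i)) * T x (fun i => stdVec x (c i))) •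
      (((ε x).domDomCongr finSumFinEquiv.symm).currySum (fun i => stdVec x (a i)))

/-! ### The Levi-Civita connection -/

/-- The components `g^{ab}` of the inverse metric in the chart `e`. -/
def ginvChart (g : TensorField n M 2) (e : OpenPartialHomeomorph M (EuclideanSpace ℝ (Fin n)))
    (y : EuclideanSpace ℝ (Fin n)) : Matrix (Fin n) (Fin n) ℝ :=
  (Matrix.of fun a b => comp g e y ![a, b])⁻¹

/-- The Christoffel symbols
`Γ^c_{ab} = ½ g^{cd} (∂_a g_{db} + ∂_b g_{da} - ∂_d g_{ab})` in the chart `e`. -/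
def christoffel (g : TensorField n M 2) (e : OpenPartialHomeomorph M (EuclideanSpace ℝ (Fin n)))
    (y : EuclideanSpace ℝ (Fin n)) (c a b : Fin n) : ℝ :=
  (1 / 2) * ∑ d : Fin n, ginvChart g e y c d *
    (pderiv (fun z => comp g e z ![d, b]) y a + pderiv (fun z => comp g e z ![d, a]) y b
      - pderiv (fun z => comp g e z ![a, b]) y d)

/-- The components `∇_b T_{a₁ … a_k}
  = ∂_b T_{a₁ … a_k} - ∑ⱼ Γ^c_{b aⱼ} T_{a₁ … c … a_k}` in the chart `e`. -/
def covDerivComp {k : ℕ} (g : TensorField n M 2) (T : TensorField n M k)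
    (e : OpenPartialHomeomorph M (EuclideanSpace ℝ (Fin n)))
    (y : EuclideanSpace ℝ (Fin n)) (b : Fin n) (a : Fin k → Fin n) : ℝ :=
  pderiv (fun z => comp T e z a) y b
    - ∑ j : Fin k, ∑ c : Fin n,
        christoffel g e y c b (a j) * comp T e y (Function.update a j c)

/-- `T' = ∇T`: the components of `T'` in every chart are `∇_b T_{a₁ … a_k}`, with the index `b` of
the derivative put first. (For smooth `g` and `T` there is exactly one such `T'`.) -/
def IsCovDeriv {k : ℕ} (g : TensorField n M 2) (T : TensorField n M k)
    (T' : TensorField n M (k + 1)) : Prop :=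
  ∀ e : OpenPartialHomeomorph M (EuclideanSpace ℝ (Fin n)), IsChart e →
    ∀ y ∈ e.target, ∀ (b : Fin n) (a : Fin k → Fin n),
      comp T' e y (Fin.cons b a : Fin (k + 1) → Fin n) = covDerivComp g T e y b a

/-- `IsIterCovDeriv g F j T` says that `T` is the `j`-th covariant derivative `∇…∇F` of `F`. -/
inductive IsIterCovDeriv {p : ℕ} (g : TensorField n M 2) (F : TensorField n M p) :
    ∀ j : ℕ, TensorField n M (p + j) → Prop
  | zero : IsIterCovDeriv g F 0 F
  | succ {j : ℕ} {T : TensorField n M (p + j)} {T' : TensorField n M (p + j + 1)} :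
      IsIterCovDeriv g F j T → IsCovDeriv g T T' → IsIterCovDeriv g F (j + 1) T'

/-! ### Null directions -/

/-- Nonzero null vectors. -/
def IsNullVector (g : TensorField n M 2) (x : M) (k : TangentSpace (𝓡 n) x) : Prop :=
  k ≠ 0 ∧ inn g x k k = 0

/-- At the point `x`, the form `T` is null (type N), aligned with the null vector `k`:
`k^a T_{a b₁ … b_{p-1}} = 0` and `k_{[a} T_{b₁ … b_p]} = 0`. -/
def IsNullAligned {p : ℕ} (g : TensorField n M 2) (x : M) (k : TangentSpace (𝓡 n) x)
    (T : TensorField n M p) : Prop :=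
  IsNullVector g x k ∧
  (∀ v : Fin p → TangentSpace (𝓡 n) x, (∃ i, v i = k) → T x v = 0) ∧
  (∀ v : Fin (p + 1) → TangentSpace (𝓡 n) x,
    ∑ j : Fin (p + 1), (-1 : ℝ) ^ (j : ℕ) * inn g x k (v j) * T x (fun i => v (j.succAbove i)) = 0)

/-- The direction field spanned by the covector field `ℓ` is geodesic at `x`:
`ℓ^b ∇_b ℓ_a` is proportional to `ℓ_a`. -/
def IsGeodesicAt (g : TensorField n M 2) (ℓ : TensorField n M 1) (x : M) : Prop :=
  ∀ e : OpenPartialHomeomorph M (EuclideanSpace ℝ (Fin n)), IsChart e → x ∈ e.source →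
    ∃ κ : ℝ, ∀ a : Fin n,
      ∑ b : Fin n, ∑ c : Fin n,
        ginvChart g e (e x) b c * comp ℓ e (e x) ![c] * covDerivComp g ℓ e (e x) b ![a]
          = κ * comp ℓ e (e x) ![a]

/-- The direction field spanned by the covector field `ℓ` is twist-free at `x`: the restriction of
`∇_b ℓ_a` to the vectors `v` with `ℓ(v) = 0` is symmetric. -/
def IsTwistFreeAt (g : TensorField n M 2) (ℓ : TensorField n M 1) (x : M) : Prop :=
  ∀ e : OpenPartialHomeomorph M (EuclideanSpace ℝ (Fin n)), IsChart e → x ∈ e.source →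
    ∀ v w : Fin n → ℝ,
      ∑ a, v a * comp ℓ e (e x) ![a] = 0 → ∑ a, w a * comp ℓ e (e x) ![a] = 0 →
      ∑ a, ∑ b, v a * w b * covDerivComp g ℓ e (e x) b ![a]
        = ∑ a, ∑ b, v a * w b * covDerivComp g ℓ e (e x) a ![b]

end Fields

/-! ### Tensors and forms built from `F`, universality, constant invariants -/

section Universal

variable {p q : ℕ} {M : Type*} [TopologicalSpace M]
  [ChartedSpace (EuclideanSpace ℝ (Fin (p + q))) M]

/-- `IsPolynomialIn g ε F K T`: the tensor field `T` is constructed polynomially from the `p`-form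
`F` and its covariant derivatives of order at most `K` (all of them if `K = ⊤`), with the help of
the metric `g` and the volume form `ε` (so that also the Hodge dual and its derivatives can be
used): `T` is a linear combination with constant coefficients of contractions, with indices in any
order, of tensor products of such derivatives with each other and with `g` and `ε`.
Every monomial has at least one factor `∇…∇F`; thus constants are not counted as scalar invariants.
The rule `dual` is a special case of products with `ε` and contractions. -/
inductive IsPolynomialIn (g : TensorField (p + q) M 2) (ε : TensorField (p + q) M (p + q))
    (F : TensorField (p + q) M p) (K : ℕ∞) : ∀ {k : ℕ}, TensorField (p + q) M k → Prop
  | base {j : ℕ} {T : TensorField (p + q) M (p + j)} :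
      (j : ℕ∞) ≤ K → IsIterCovDeriv g F j T → IsPolynomialIn g ε F K T
  | add {k : ℕ} {S T : TensorField (p + q) M k} :
      IsPolynomialIn g ε F K S → IsPolynomialIn g ε F K T → IsPolynomialIn g ε F K (S + T)
  | smul {k : ℕ} (c : ℝ) {T : TensorField (p + q) M k} :
      IsPolynomialIn g ε F K T → IsPolynomialIn g ε F K (c • T)
  | prod {k l : ℕ} {S : TensorField (p + q) M k} {T : TensorField (p + q) M l} :
      IsPolynomialIn g ε F K S → IsPolynomialIn g ε F K T → IsPolynomialIn g ε F K (tensorProd S T)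
  | prodMetric {k : ℕ} {T : TensorField (p + q) M k} :
      IsPolynomialIn g ε F K T → IsPolynomialIn g ε F K (tensorProd g T)
  | prodVolume {k : ℕ} {T : TensorField (p + q) M k} :
      IsPolynomialIn g ε F K T → IsPolynomialIn g ε F K (tensorProd ε T)
  | reindex {k l : ℕ} (σ : Fin k ≃ Fin l) {T : TensorField (p + q) M k} :
      IsPolynomialIn g ε F K T → IsPolynomialIn g ε F K (UnivForm.reindex σ T)
  | contract {k : ℕ} {T : TensorField (p + q) M (k + 2)} :
      IsPolynomialIn g ε F K T → IsPolynomialIn g ε F K (UnivForm.contract g T)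
  | dual {T : TensorField (p + q) M p} :
      IsPolynomialIn g ε F K T → IsPolynomialIn g ε F K (hodge g ε T)

/-- `I` is a scalar polynomial invariant of `F` and its covariant derivatives of order `≤ K`. -/
def IsScalarInvariant (g : TensorField (p + q) M 2) (ε : TensorField (p + q) M (p + q))
    (F : TensorField (p + q) M p) (K : ℕ∞) (I : M → ℝ) : Prop :=
  ∃ T : TensorField (p + q) M 0, IsPolynomialIn g ε F K T ∧ ∀ x, I x = T x (fun i => i.elim0)

/-- `c` is a smooth function of finitely many scalar polynomial invariants. -/
def IsCoefficient (g : TensorField (p + q) M 2) (ε : TensorField (p + q) M (p + q))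
    (F : TensorField (p + q) M p) (K : ℕ∞) (c : M → ℝ) : Prop :=
  ∃ (r : ℕ) (I : Fin r → M → ℝ) (O : Set (Fin r → ℝ)) (φ : (Fin r → ℝ) → ℝ),
    (∀ i, IsScalarInvariant g ε F K (I i)) ∧ IsOpen O ∧ ContDiffOn ℝ ∞ φ O ∧
    ∀ x, (fun i => I i x) ∈ O ∧ c x = φ (fun i => I i x)

/-- `T` is one of the `p`-forms `F̃` constructed polynomially from `F` and its covariant derivatives
of order `≤ K`; the scalar coefficients of the polynomial may be arbitrary smooth functions of
the scalar invariants. -/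
def IsBuiltForm (g : TensorField (p + q) M 2) (ε : TensorField (p + q) M (p + q))
    (F : TensorField (p + q) M p) (K : ℕ∞) (T : TensorField (p + q) M p) : Prop :=
  IsAlternating T ∧
  ∃ (m : ℕ) (c : Fin m → M → ℝ) (P : Fin m → TensorField (p + q) M p),
    (∀ i, IsCoefficient g ε F K (c i)) ∧ (∀ i, IsPolynomialIn g ε F K (P i)) ∧
    ∀ x, T x = ∑ i, c i x • P i x

/-- `F` is `K`-universal: `dF = 0`, and `d*F̃ = 0` for all `p`-forms `F̃` constructed from `F` and
its first `K` covariant derivatives. For `K = ⊤`, `F` is universal. -/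
def IsUniversal (g : TensorField (p + q) M 2) (ε : TensorField (p + q) M (p + q))
    (F : TensorField (p + q) M p) (K : ℕ∞) : Prop :=
  IsClosedForm F ∧ ∀ T : TensorField (p + q) M p, IsBuiltForm g ε F K T →
    IsClosedForm (hodge g ε T)

/-- `F` is CSI_K: all scalar polynomial invariants of `F` and its covariant derivatives of order
`≤ K` are constant. For `K = ⊤`, `F` is CSI. -/
def IsCSI (g : TensorField (p + q) M 2) (ε : TensorField (p + q) M (p + q))
    (F : TensorField (p + q) M p) (K : ℕ∞) : Prop :=
  ∀ I : M → ℝ, IsScalarInvariant g ε F K I → ∃ c : ℝ, ∀ x, I x = c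

end Universal

end UnivForm

end

open UnivForm

/-! The first half uses universality at a single point. If `I` is an invariant and `T` a built form,
then `I T` is a built form too, so `d*T = 0` and `d*(I T) = 0` together give `dI ∧ *T = 0`
(`IsUniversal.wedge_diff_hodge`). Write `ℓ` for the gradient vector of `I`. Hodge duality turns this
into `ℓ ⌟ T = 0`. Because `n = 2p`, the dual `*T` is itself a built `p`-form, and the same argument
for `*T` gives `ℓ ∧ T = 0`.

Contracting `ℓ ∧ F = 0` with the gradient of a second invariant `J` gives `g(dI, dJ) F = 0`. Where
the scalar product is nonzero, `F` vanishes on an open set, hence so do all invariants, which forces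
`dI = 0`, a contradiction. So all gradients are null and mutually orthogonal
(`IsUniversal.diff_sharp_eq_zero`), and in Lorentzian signature such vectors are proportional. Every
built form is aligned with any nonzero gradient. A gradient has a symmetric Hessian, hence no twist,
and `ℓ^b ∇_b ℓ_a = ½ ∂_a (ℓ_b ℓ^b) = 0`, hence it is geodesic.

The harder half concerns points where all gradients vanish while some invariant is nonconstant
elsewhere. Fix such an `x` and finitely many polynomial forms `A_i` whose values at `x` span the
values of all alternating polynomial forms. Let `L` be the operator of the energy form `∑ (A_i)_{a
c…} (A_i)_b{}^{c…}`. The traces of the powers of `L` are invariants. Wherever some gradient is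
nonzero, alignment gives `L² = 0`, so these traces vanish there. Thus each trace `τ` satisfies `τ dτ
= 0`, so `τ²` is constant on the connected manifold, and it is zero because it is zero at a point
where some gradient is nonzero. Hence `L` is nilpotent at `x` as well
(`IsUniversal.isNilpotent_energy`).

A self-adjoint nilpotent `L ≠ 0` has a null vector `k` in its kernel and image; positivity of the
energy on the transverse components gives `k ⌟ A_i = 0`. If `L = 0`, a timelike vector annihilates
all `A_i` (`IsFrame.exists_interior_eq_zero`). The span is closed under the Hodge dual, so `k ∧ A_i
= 0` follows too: in the null case this is alignment, in the timelike case all forms vanish at `x`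
and any null vector serves. -/

noncomputable section

namespace UnivForm

/-! ### Contractions in different bases -/

section LinearAlgebra

variable {n : ℕ} {W : Type*} [AddCommGroup W] [Module ℝ W]

/-- The inverse of the Gram matrix of a family of vectors. -/
def gramInv (G : W →ₗ[ℝ] W →ₗ[ℝ] ℝ) (v : Fin n → W) : Matrix (Fin n) (Fin n) ℝ :=
  (Matrix.of fun a b => G (v a) (v b))⁻¹

theorem exists_change_of_basis (b b' : Module.Basis (Fin n) ℝ W) :
    ∃ P : Matrix (Fin n) (Fin n) ℝ, IsUnit P ∧ ∀ i, b' i = ∑ j, P i j • b j := by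
  refine ⟨(b.toMatrix b').transpose, ?_, fun i => ?_⟩
  · let _ := b.invertibleToMatrix b'
    exact (Matrix.isUnit_transpose _).2 (isUnit_of_invertible (b.toMatrix b'))
  · simp only [Matrix.transpose_apply, Module.Basis.toMatrix_apply]
    exact (b.sum_repr (b' i)).symm

/-- The Gram matrix transforms as `P G Pᵀ`; inverting and multiplying by `Pᵀ` and `P` cancels both
factors. -/
theorem gramInv_change (G : W →ₗ[ℝ] W →ₗ[ℝ] ℝ) {v v' : Fin n → W}
    {P : Matrix (Fin n) (Fin n) ℝ} (hP : IsUnit P) (hv : ∀ i, v' i = ∑ j, P i j • v j) :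
    P.transpose * gramInv G v' * P = gramInv G v := by
  have hG : (Matrix.of fun a b => G (v' a) (v' b))
      = P * (Matrix.of fun a b => G (v a) (v b)) * P.transpose := by
    ext a b
    simp only [Matrix.of_apply, hv, map_sum, map_smul, LinearMap.sum_apply, LinearMap.smul_apply,
      smul_eq_mul, Matrix.mul_apply, Matrix.transpose_apply, Finset.sum_mul, Finset.mul_sum]
    refine Finset.sum_congr rfl fun i _ => Finset.sum_congr rfl fun j _ => ?_
    ring
  have hP1 : IsUnit P.det := (Matrix.isUnit_iff_isUnit_det P).1 hP
  have hP2 : IsUnit P.transpose.det := by rwa [Matrix.det_transpose]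
  unfold gramInv
  rw [hG, Matrix.mul_inv_rev, Matrix.mul_inv_rev]
  rw [← Matrix.mul_assoc, ← Matrix.mul_assoc, Matrix.mul_nonsing_inv _ hP2, Matrix.one_mul,
    Matrix.mul_assoc, Matrix.nonsing_inv_mul _ hP1, Matrix.mul_one]

/-- This allows contractions defined with `stdVec` to be computed in an orthonormal frame or in a
coordinate basis. -/
theorem contraction_change (G B : W →ₗ[ℝ] W →ₗ[ℝ] ℝ) (b b' : Module.Basis (Fin n) ℝ W) :
    ∑ a, ∑ c, gramInv G b' a c * B (b' a) (b' c) = ∑ a, ∑ c, gramInv G b a c * B (b a) (b c) := by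
  obtain ⟨P, hP, hb⟩ := exists_change_of_basis b b'
  rw [← gramInv_change G hP hb]
  simp only [hb, map_sum, map_smul, LinearMap.sum_apply, LinearMap.smul_apply,
      smul_eq_mul, Matrix.mul_apply, Matrix.transpose_apply, Finset.sum_mul, Finset.mul_sum]
  have h1 : ∀ f : Fin n → Fin n → Fin n → Fin n → ℝ,
      ∑ a, ∑ c, ∑ i, ∑ j, f a c i j = ∑ i, ∑ j, ∑ a, ∑ c, f a c i j := by
    intro f
    calc ∑ a, ∑ c, ∑ i, ∑ j, f a c i j = ∑ a, ∑ i, ∑ c, ∑ j, f a c i j :=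
          Finset.sum_congr rfl fun a _ => Finset.sum_comm
      _ = ∑ i, ∑ a, ∑ c, ∑ j, f a c i j := Finset.sum_comm
      _ = ∑ i, ∑ a, ∑ j, ∑ c, f a c i j :=
          Finset.sum_congr rfl fun i _ => Finset.sum_congr rfl fun a _ => Finset.sum_comm
      _ = _ := Finset.sum_congr rfl fun i _ => Finset.sum_comm
  rw [h1]
  rw [Finset.sum_comm]
  refine Finset.sum_congr rfl fun i _ => Finset.sum_congr rfl fun j _ => ?_
  rw [Finset.sum_comm]
  refine Finset.sum_congr rfl fun a _ => Finset.sum_congr rfl fun c _ => ?_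
  ring

theorem multilinear_change {p : ℕ} (T : MultilinearMap ℝ (fun _ : Fin p => W) ℝ) {v v' : Fin n → W}
    {P : Matrix (Fin n) (Fin n) ℝ} (hv : ∀ i, v' i = ∑ j, P i j • v j) (c : Fin p → Fin n) :
    T (fun i => v' (c i)) = ∑ d : Fin p → Fin n, (∏ i, P (c i) (d i)) * T (fun i => v (d i)) := by
  simp only [hv]
  rw [MultilinearMap.map_sum]
  refine Finset.sum_congr rfl fun d _ => ?_
  rw [MultilinearMap.map_smul_univ, smul_eq_mul]

/-- The contraction of all the indices of `S` with those of `T`, by means of the matrix `Q`. -/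
def pairing {p : ℕ} (Q : Matrix (Fin n) (Fin n) ℝ) (v : Fin n → W) (S T : (Fin p → W) → ℝ) : ℝ :=
  ∑ a : Fin p → Fin n, ∑ c : Fin p → Fin n,
    (∏ i, Q (a i) (c i)) * (S (fun i => v (c i)) * T (fun i => v (a i)))

theorem pairing_change {p : ℕ} (G : W →ₗ[ℝ] W →ₗ[ℝ] ℝ)
    (S T : MultilinearMap ℝ (fun _ : Fin p => W) ℝ) (b b' : Module.Basis (Fin n) ℝ W) :
    pairing (gramInv G b') b' S T = pairing (gramInv G b) b S T := by
  obtain ⟨P, hP, hb⟩ := exists_change_of_basis b b'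
  rw [← gramInv_change G hP hb]
  set Q := gramInv G b'
  have key : ∀ a c : Fin p → Fin n, ∏ i, (P.transpose * Q * P) (a i) (c i)
      = ∑ a' : Fin p → Fin n, ∑ c' : Fin p → Fin n,
        (∏ i, Q (a' i) (c' i)) * ((∏ i, P (c' i) (c i)) * ∏ i, P (a' i) (a i)) := by
    intro a c
    simp only [Matrix.mul_apply, Matrix.transpose_apply, Finset.sum_mul]
    rw [Finset.prod_univ_sum, Fintype.piFinset_univ, Finset.sum_comm]
    simp only [Finset.prod_univ_sum, Fintype.piFinset_univ]
    refine Finset.sum_congr rfl fun a' _ => Finset.sum_congr rfl fun c' _ => ?_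
    rw [← Finset.prod_mul_distrib, ← Finset.prod_mul_distrib]
    exact Finset.prod_congr rfl fun i _ => by ring
  unfold pairing
  simp only [key, multilinear_change S hb, multilinear_change T hb, Finset.sum_mul, Finset.mul_sum]
  have h1 : ∀ f : (Fin p → Fin n) → (Fin p → Fin n) → (Fin p → Fin n) → (Fin p → Fin n) → ℝ,
      ∑ a, ∑ c, ∑ i, ∑ j, f a c i j = ∑ j, ∑ i, ∑ a, ∑ c, f a c i j := by
    intro f
    calc ∑ a, ∑ c, ∑ i, ∑ j, f a c i j = ∑ a, ∑ i, ∑ c, ∑ j, f a c i j :=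
          Finset.sum_congr rfl fun a _ => Finset.sum_comm
      _ = ∑ i, ∑ a, ∑ c, ∑ j, f a c i j := Finset.sum_comm
      _ = ∑ i, ∑ a, ∑ j, ∑ c, f a c i j :=
          Finset.sum_congr rfl fun i _ => Finset.sum_congr rfl fun a _ => Finset.sum_comm
      _ = ∑ i, ∑ j, ∑ a, ∑ c, f a c i j := Finset.sum_congr rfl fun i _ => Finset.sum_comm
      _ = _ := Finset.sum_comm
  rw [h1]
  rw [Finset.sum_comm]
  refine Finset.sum_congr rfl fun i _ => Finset.sum_congr rfl fun j _ => ?_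
  refine Finset.sum_congr rfl fun a _ => Finset.sum_congr rfl fun c _ => ?_
  ring

/-! ### Lorentzian orthonormal frames -/

/-- The sign of the square of the `i`-th vector of an orthonormal frame with timelike index `t`. -/
def frameSign (t i : Fin n) : ℝ := if i = t then -1 else 1

@[simp] theorem frameSign_self (t : Fin n) : frameSign t t = -1 := by simp [frameSign]

theorem frameSign_of_ne {t i : Fin n} (h : i ≠ t) : frameSign t i = 1 := by simp [frameSign, h]

theorem frameSign_mul_self (t i : Fin n) : frameSign t i * frameSign t i = 1 := by
  unfold frameSign; split_ifs <;> norm_num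

theorem frameSign_ne_zero (t i : Fin n) : frameSign t i ≠ 0 := by
  unfold frameSign; split_ifs <;> norm_num

/-- `b` is an orthonormal frame with timelike vector `b t`. -/
def IsFrame (G : W →ₗ[ℝ] W →ₗ[ℝ] ℝ) (b : Module.Basis (Fin n) ℝ W) (t : Fin n) : Prop :=
  ∀ i j, G (b i) (b j) = if i = j then frameSign t i else 0

variable {G : W →ₗ[ℝ] W →ₗ[ℝ] ℝ} {b : Module.Basis (Fin n) ℝ W} {t : Fin n}

theorem IsFrame.gramInv_eq (hb : IsFrame G b t) : gramInv G b = Matrix.diagonal (frameSign t) := by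
  have h : (Matrix.of fun i j => G (b i) (b j)) = Matrix.diagonal (frameSign t) := by
    ext i j
    simp [Matrix.diagonal_apply, hb i j]
  unfold gramInv
  rw [h]
  apply Matrix.inv_eq_left_inv
  rw [Matrix.diagonal_mul_diagonal]
  simp [frameSign_mul_self]

theorem IsFrame.apply_left (hb : IsFrame G b t) (v : W) (i : Fin n) :
    G v (b i) = frameSign t i * b.repr v i := by
  conv_lhs => rw [← b.sum_repr v]
  simp only [map_sum, map_smul, LinearMap.sum_apply, LinearMap.smul_apply, hb _ _, smul_eq_mul,
    mul_ite, mul_zero]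
  rw [Finset.sum_ite_eq' Finset.univ i]
  simp [mul_comm]

theorem IsFrame.apply (hb : IsFrame G b t) (v w : W) :
    G v w = ∑ i, frameSign t i * b.repr v i * b.repr w i := by
  conv_lhs => rw [← b.sum_repr w]
  simp only [map_sum, map_smul, smul_eq_mul, hb.apply_left]
  exact Finset.sum_congr rfl fun i _ => by ring

theorem IsFrame.symm (hb : IsFrame G b t) (v w : W) : G v w = G w v := by
  rw [hb.apply, hb.apply]
  exact Finset.sum_congr rfl fun i _ => by ring

theorem IsFrame.repr_eq (hb : IsFrame G b t) (v : W) (i : Fin n) :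
    b.repr v i = frameSign t i * G v (b i) := by
  rw [hb.apply_left, ← mul_assoc, frameSign_mul_self, one_mul]

theorem IsFrame.sum_eq (hb : IsFrame G b t) (v : W) :
    v = ∑ i, (frameSign t i * G v (b i)) • b i := by
  conv_lhs => rw [← b.sum_repr v]
  simp only [hb.repr_eq]

theorem IsFrame.nondegenerate (hb : IsFrame G b t) {v : W} (h : ∀ w, G v w = 0) : v = 0 := by
  rw [hb.sum_eq v]
  simp [h]

theorem IsFrame.contraction_eq (hb : IsFrame G b t) (B : W →ₗ[ℝ] W →ₗ[ℝ] ℝ)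
    (b' : Module.Basis (Fin n) ℝ W) :
    ∑ a, ∑ c, gramInv G b' a c * B (b' a) (b' c) = ∑ i, frameSign t i * B (b i) (b i) := by
  rw [contraction_change G B b b', hb.gramInv_eq]
  refine Finset.sum_congr rfl fun i _ => ?_
  rw [Finset.sum_eq_single i]
  · simp
  · intro j _ hj
    simp [Matrix.diagonal_apply_ne' _ hj]
  · simp

theorem IsFrame.pairing_self (hb : IsFrame G b t) {p : ℕ} (S T : (Fin p → W) → ℝ) :
    pairing (gramInv G b) b S T
      = ∑ a : Fin p → Fin n, (∏ i, frameSign t (a i)) *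
        (S (fun i => b (a i)) * T (fun i => b (a i))) := by
  unfold pairing
  rw [hb.gramInv_eq]
  refine Finset.sum_congr rfl fun a _ => ?_
  rw [Finset.sum_eq_single a]
  · simp
  · intro c _ hc
    obtain ⟨i, hi⟩ := Function.ne_iff.1 hc
    rw [Finset.prod_eq_zero (Finset.mem_univ i), zero_mul]
    exact Matrix.diagonal_apply_ne' _ hi
  · simp

theorem IsFrame.pairing_eq (hb : IsFrame G b t) {p : ℕ}
    (S T : MultilinearMap ℝ (fun _ : Fin p => W) ℝ) (b' : Module.Basis (Fin n) ℝ W) :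
    pairing (gramInv G b') b' S T
      = ∑ a : Fin p → Fin n, (∏ i, frameSign t (a i)) *
        (S (fun i => b (a i)) * T (fun i => b (a i))) := by
  rw [pairing_change G S T b b', hb.pairing_self]

end LinearAlgebra

/-! ### The Hodge dual and the exterior product with a covector -/

section Star

variable {n : ℕ} {W : Type*} [AddCommGroup W] [Module ℝ W]

theorem exists_complement {m r : ℕ} (h : m + r = n) {a : Fin m → Fin n}
    (ha : Function.Injective a) : ∃ c : Fin r → Fin n, Function.Bijective (Sum.elim a c) := by
  have hcard : Fintype.card {x // x ∉ Set.range a} = r := by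
    have h1 := Fintype.card_subtype_compl (fun x => x ∈ Set.range a)
    have h2 : Fintype.card {x // x ∈ Set.range a} = m := by
      rw [← Fintype.card_congr (Equiv.ofInjective a ha)]
      simp
    have h3 : Fintype.card {x // x ∉ Set.range a} = Fintype.card (Fin n) - m :=
      h1.trans (congrArg (fun z => Fintype.card (Fin n) - z) h2)
    rw [h3]; simp; omega
  let e := (Fintype.equivFinOfCardEq hcard).symm
  refine ⟨fun i => (e i : Fin n), ?_, ?_⟩
  · refine ha.sumElim (Subtype.val_injective.comp e.injective) fun i j hij => ?_
    exact (e j).2 ⟨i, hij⟩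
  · intro x
    by_cases hx : x ∈ Set.range a
    · obtain ⟨i, rfl⟩ := hx
      exact ⟨Sum.inl i, rfl⟩
    · exact ⟨Sum.inr (e.symm ⟨x, hx⟩), by simp⟩

theorem sum_eq_sum_comp {m : ℕ} {a : Fin m → Fin n} (ha : Function.Injective a) (f : Fin n → ℝ)
    (hf : ∀ i, i ∉ Set.range a → f i = 0) : ∑ i, f i = ∑ j, f (a j) := by
  symm
  refine Finset.sum_of_injOn a ha.injOn (fun _ _ => Finset.mem_univ _) (fun i _ hi => hf i ?_)
    fun _ _ => rfl
  simpa using hi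

theorem elim_comp {α β γ δ : Type*} (b : γ → δ) (f : α → γ) (g : β → γ) :
    (Sum.elim (fun i => b (f i)) fun i => b (g i)) = fun s => b (Sum.elim f g s) := by
  ext s; cases s <;> rfl

/-- `⟨T, E(·, u)⟩`, the contraction of `T` with the first indices of `E`,
with weights `w` for the vectors `b`. -/
def weightedStar {p q : ℕ} (w : Fin n → ℝ) (b : Fin n → W) (E : W [⋀^Fin p ⊕ Fin q]→ₗ[ℝ] ℝ)
    (T : W [⋀^Fin p]→ₗ[ℝ] ℝ) (u : Fin q → W) : ℝ :=
  ∑ a : Fin p → Fin n, (∏ i, w (a i)) *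
    (T (fun i => b (a i)) * E (Sum.elim (fun i => b (a i)) u))

/-- Only rearrangements of `J` contribute: a repeated index kills `T`, and an index outside `J`
occurs in `J'` and kills `E`. A permutation changes the signs of `T` and `E` together, so the `p!`
surviving terms are equal. -/
theorem weightedStar_basis {p q : ℕ} (w : Fin n → ℝ) (b : Fin n → W)
    (E : W [⋀^Fin p ⊕ Fin q]→ₗ[ℝ] ℝ) (T : W [⋀^Fin p]→ₗ[ℝ] ℝ) {J : Fin p → Fin n}
    {J' : Fin q → Fin n} (hJ : Function.Bijective (Sum.elim J J')) :
    weightedStar w b E T (fun i => b (J' i))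
      = (p.factorial : ℝ) * ((∏ i, w (J i)) * (T (fun i => b (J i)) *
          E (fun s => b (Sum.elim J J' s)))) := by
  have hJi : Function.Injective J := hJ.1.comp Sum.inl_injective
  unfold weightedStar
  rw [← Finset.sum_of_injOn (s := (Finset.univ : Finset (Equiv.Perm (Fin p))))
    (f := fun _ => (∏ i, w (J i)) * (T (fun i => b (J i)) * E (fun s => b (Sum.elim J J' s))))
    (fun σ i => J (σ i))]
  · simp [Fintype.card_perm]
  · intro σ _ τ _ h
    ext i
    exact congrArg _ (hJi (congrFun h i))
  · intro _ _; simp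
  · intro a _ ha
    rw [mul_eq_zero]; right
    by_cases hai : Function.Injective a
    · rw [mul_eq_zero]; right
      by_cases hr : ∀ i, a i ∈ Set.range J
      · exfalso
        choose σ hσ using hr
        have hσi : Function.Injective σ := fun i j h => hai (by rw [← hσ i, ← hσ j, h])
        exact ha ⟨Equiv.ofBijective σ (Finite.injective_iff_bijective.1 hσi), by simp, by
          ext i; simp [hσ i]⟩
      · push Not at hr
        obtain ⟨i, hi⟩ := hr
        obtain ⟨s, hs⟩ := hJ.2 (a i)
        cases s with
        | inl j => exact absurd ⟨j, hs⟩ hi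
        | inr j =>
          refine E.map_eq_zero_of_eq _ (i := Sum.inl i) (j := Sum.inr j) ?_ (by simp)
          simp only [Sum.elim_inl, Sum.elim_inr] at hs ⊢
          rw [hs]
    · rw [mul_eq_zero]; left
      simp only [Function.Injective, not_forall] at hai
      obtain ⟨i, j, hij, hne⟩ := hai
      exact T.map_eq_zero_of_eq _ (i := i) (j := j) (by rw [hij]) hne
  · intro σ _
    have h1 : T (fun i => b (J (σ i))) = (Equiv.Perm.sign σ) • T (fun i => b (J i)) :=
      T.map_perm (fun i => b (J i)) σ
    have h2 : E (Sum.elim (fun i => b (J (σ i))) (fun i => b (J' i)))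
        = (Equiv.Perm.sign σ) • E (fun s => b (Sum.elim J J' s)) := by
      have := E.map_perm (fun s => b (Sum.elim J J' s)) (Equiv.Perm.sumCongr σ 1)
      rw [Equiv.Perm.sign_sumCongr] at this
      simp only [Equiv.Perm.sign_one, mul_one] at this
      rw [← this]
      congr 1
      ext s; cases s <;> rfl
    rw [h1, h2, Equiv.prod_comp σ (fun i => w (J i))]
    rcases Int.units_eq_one_or (Equiv.Perm.sign σ) with h | h <;> simp [h]

/-- The exterior product of the covector `α` with `T`. -/
def wedge {p : ℕ} (α : W →ₗ[ℝ] ℝ) (T : W [⋀^Fin p]→ₗ[ℝ] ℝ) : W [⋀^Fin (p + 1)]→ₗ[ℝ] ℝ :=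
  AlternatingMap.alternatizeUncurryFin (α.smulRight T)

theorem wedge_apply {p : ℕ} (α : W →ₗ[ℝ] ℝ) (T : W [⋀^Fin p]→ₗ[ℝ] ℝ) (v : Fin (p + 1) → W) :
    wedge α T v = ∑ j : Fin (p + 1), (-1 : ℝ) ^ (j : ℕ) * α (v j) * T (fun i => v (j.succAbove i)) := by
  unfold wedge
  rw [AlternatingMap.alternatizeUncurryFin_apply]
  refine Finset.sum_congr rfl fun j _ => ?_
  simp only [LinearMap.smulRight_apply, AlternatingMap.smul_apply, smul_eq_mul, zsmul_eq_mul]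
  push_cast
  rw [mul_assoc]
  rfl

theorem map_elim_perm {κ : Type*} [Fintype κ] [DecidableEq κ] {m : ℕ}
    (D : W [⋀^Fin m ⊕ κ]→ₗ[ℝ] ℝ) (v : Fin m → W) (u : κ → W) (σ : Equiv.Perm (Fin m)) :
    D (Sum.elim (fun i => v (σ i)) u) = Equiv.Perm.sign σ • D (Sum.elim v u) := by
  have := D.map_perm (Sum.elim v u) (Equiv.Perm.sumCongr σ 1)
  rw [Equiv.Perm.sign_sumCongr] at this
  simp only [Equiv.Perm.sign_one, mul_one] at this
  rw [← this]
  congr 1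
  ext s; cases s <;> rfl

/-- Bringing the `j`-th vector to the front is a cycle of sign `(-1)^j`. This produces the
alternating signs of an exterior product from a permutation of the arguments of the volume form. -/
theorem map_elim_cons_succAbove {κ : Type*} [Fintype κ] [DecidableEq κ] {m : ℕ}
    (D : W [⋀^Fin (m + 1) ⊕ κ]→ₗ[ℝ] ℝ) (v : Fin (m + 1) → W) (u : κ → W) (j : Fin (m + 1)) :
    D (Sum.elim (Fin.cons (v j) fun i => v (j.succAbove i)) u)
      = (-1 : ℝ) ^ (j : ℕ) * D (Sum.elim v u) := by
  have h := map_elim_perm D v u j.cycleRange.symm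
  have h1 : (fun i => v (j.cycleRange.symm i))
      = (Fin.cons (v j) fun i => v (j.succAbove i) : Fin (m + 1) → W) := by
    ext i
    refine Fin.cases ?_ (fun i => ?_) i
    · simp
    · simp
  rw [h1] at h
  rw [h, Equiv.Perm.sign_symm, Fin.sign_cycleRange, Units.smul_def, zsmul_eq_mul]
  push_cast
  rfl

variable {G : W →ₗ[ℝ] W →ₗ[ℝ] ℝ} {b : Module.Basis (Fin n) ℝ W} {t : Fin n}

/-- The bijection that moves the first index of the second block in front of the first block. -/
def moveFront (p r : ℕ) : Fin p ⊕ Fin (r + 1) ≃ Fin (p + 1) ⊕ Fin r where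
  toFun := Sum.elim (fun i => Sum.inl i.succ) (Fin.cons (Sum.inl 0) Sum.inr)
  invFun := Sum.elim (Fin.cons (Sum.inr 0) Sum.inl) (fun i => Sum.inr i.succ)
  left_inv s := by
    rcases s with i | i
    · simp
    · refine Fin.cases ?_ (fun i => ?_) i <;> simp
  right_inv s := by
    rcases s with i | i
    · refine Fin.cases ?_ (fun i => ?_) i <;> simp
    · simp

/-- The bijection that moves the first index of the first block in front of the second block. -/
def moveSecond (r q : ℕ) : Fin (r + 1) ⊕ Fin q ≃ Fin (q + 1) ⊕ Fin r :=
  (Equiv.sumComm _ _).trans (moveFront q r)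

theorem elim_moveFront {α : Type*} {p r : ℕ} (v : Fin (p + 1) → α) (u : Fin r → α) :
    (fun s => (Sum.elim v u : _ → α) (moveFront p r s))
      = Sum.elim (fun i => v i.succ) (Fin.cons (v 0) u) := by
  ext s
  rcases s with i | i
  · rfl
  · refine Fin.cases ?_ (fun i => ?_) i <;> simp [moveFront]

theorem elim_moveSecond {α : Type*} {r q : ℕ} (v : Fin (q + 1) → α) (u : Fin r → α) :
    (fun s => (Sum.elim v u : _ → α) (moveSecond r q s))
      = Sum.elim (Fin.cons (v 0) u) (fun i => v i.succ) := by
  ext s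
  rcases s with i | i
  · refine Fin.cases ?_ (fun i => ?_) i <;> simp [moveFront, moveSecond]
  · rfl

theorem cons_comp {α β : Type*} {m : ℕ} (b : α → β) (x : α) (c : Fin m → α) :
    (Fin.cons (b x) fun i => b (c i) : Fin (m + 1) → β) = fun i => b ((Fin.cons x c : Fin (m + 1) → α) i) := by
  ext i; refine Fin.cases ?_ (fun i => ?_) i <;> simp

theorem injective_cons_succAbove {α : Type*} {m : ℕ} (a : Fin (m + 1) → α) (j : Fin (m + 1)) :
    (Fin.cons (a j) fun i => a (j.succAbove i) : Fin (m + 1) → α)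
      = fun i => a (j.cycleRange.symm i) := by
  ext i; refine Fin.cases ?_ (fun i => ?_) i <;> simp

theorem bijective_elim_perm {m r : ℕ} {a : Fin m → Fin n} {c : Fin r → Fin n}
    (h : Function.Bijective (Sum.elim a c)) (σ : Equiv.Perm (Fin m)) :
    Function.Bijective (Sum.elim (fun i => a (σ i)) c) := by
  have := h.comp (Equiv.Perm.sumCongr σ (1 : Equiv.Perm (Fin r))).bijective
  convert this using 1
  ext s; cases s <;> rfl

theorem IsFrame.map_eq_sum (hb : IsFrame G b t) (f : W →ₗ[ℝ] ℝ) (k : W) :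
    f k = ∑ i, frameSign t i * G k (b i) * f (b i) := by
  conv_lhs => rw [hb.sum_eq k]
  simp [map_sum]

/-- If `k ∧ *T = 0`, then `k ⌟ T = 0`. -/
theorem IsFrame.interior_eq_zero (hb : IsFrame G b t) {r q : ℕ} (hn : r + 1 + q = n)
    (E : W [⋀^Fin (r + 1) ⊕ Fin q]→ₗ[ℝ] ℝ)
    (hE : ∀ f : Fin (r + 1) ⊕ Fin q → Fin n, Function.Bijective f → E (fun s => b (f s)) ≠ 0)
    (T : W [⋀^Fin (r + 1)]→ₗ[ℝ] ℝ) (k : W)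
    (h : ∀ v : Fin (q + 1) → W, ∑ j : Fin (q + 1), (-1 : ℝ) ^ (j : ℕ) * G k (v j) *
      weightedStar (frameSign t) b E T (fun i => v (j.succAbove i)) = 0) (v : Fin r → W) :
    T (Fin.cons k v) = 0 := by
  suffices hs : T.curryLeft k = 0 by
    have := congrArg (fun f => f v) hs
    exact this
  refine Module.Basis.ext_alternating b fun c hc => ?_
  change T (Fin.cons k fun i => b (c i)) = 0
  -- It suffices to test on distinct frame vectors `c`. Evaluating `k ∧ *T` on the complementary
  -- vectors `a` picks out exactly the components of `T` that occur in `T(k, c)`.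
  obtain ⟨a, ha⟩ := exists_complement (n := n) (m := r) (r := q + 1) (by omega) hc
  have hac : Function.Bijective (Sum.elim a c) := by
    convert ha.comp (Equiv.sumComm _ _).bijective using 1
    ext s; cases s <;> rfl
  have hai : Function.Injective a := hac.1.comp Sum.inl_injective
  have h1 : T (Fin.cons k fun i => b (c i))
      = ∑ i, frameSign t i * G k (b i) * T (Fin.cons (b i) fun i => b (c i)) := by
    let f : W →ₗ[ℝ] ℝ :=
      { toFun := fun y => T.curryLeft y fun i => b (c i)
        map_add' := fun y z => by rw [map_add]; rfl
        map_smul' := fun m y => by rw [map_smul]; rfl }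
    exact hb.map_eq_sum f k
  rw [h1, sum_eq_sum_comp hai]
  swap
  · intro i hi
    obtain ⟨s, rfl⟩ := hac.2 i
    cases s with
    | inl j => exact absurd ⟨j, rfl⟩ hi
    | inr j =>
      rw [T.map_eq_zero_of_eq _ (i := 0) (j := j.succ) (by simp) (Fin.succ_ne_zero j).symm, mul_zero]
  -- With the index moved across the blocks, all the volume-form factors become the same value of
  -- `D` up to the sign `(-1)^j`, and can be taken out of the sum.
  let D : W [⋀^Fin (q + 1) ⊕ Fin r]→ₗ[ℝ] ℝ := E.domDomCongr (moveSecond r q)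
  have hD : ∀ x, D x = E (fun s => x (moveSecond r q s)) := fun _ => rfl
  have h0 := h (fun i => b (a i))
  have hterm : ∀ j : Fin (q + 1), (-1 : ℝ) ^ (j : ℕ) * G k (b (a j)) *
      weightedStar (frameSign t) b E T (fun i => b (a (j.succAbove i)))
      = (((r + 1).factorial : ℝ) * (∏ i, frameSign t (c i)) * D (Sum.elim (fun i => b (a i)) fun i => b (c i)))
        * (frameSign t (a j) * G k (b (a j)) * T (Fin.cons (b (a j)) fun i => b (c i))) := by
    intro j
    have hbij : Function.Bijective (Sum.elim (Fin.cons (a j) c) fun i => a (j.succAbove i)) := by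
      have := (bijective_elim_perm hac j.cycleRange.symm).comp (moveSecond r q).bijective
      convert this using 1
      rw [← injective_cons_succAbove]
      exact (elim_moveSecond (Fin.cons (a j) fun i => a (j.succAbove i)) c).symm
    rw [weightedStar_basis _ _ _ _ hbij]
    have hDj := map_elim_cons_succAbove D (fun i => b (a i)) (fun i => b (c i)) j
    rw [hD, elim_moveSecond] at hDj
    simp only [Fin.cons_zero, Fin.cons_succ] at hDj
    rw [← elim_comp, ← cons_comp (b := fun i => b i), hDj, Fin.prod_univ_succ]
    simp only [Fin.cons_zero, Fin.cons_succ]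
    have hsq : (-1 : ℝ) ^ (j : ℕ) * (-1 : ℝ) ^ (j : ℕ) = 1 := by
      rw [← mul_pow]; norm_num
    linear_combination (G k (b (a j)) * ((r + 1).factorial : ℝ) * frameSign t (a j) *
      (∏ i, frameSign t (c i)) * T (Fin.cons (b (a j)) fun i => b (c i)) *
      D (Sum.elim (fun i => b (a i)) fun i => b (c i))) * hsq
  rw [Finset.sum_congr rfl fun j _ => hterm j, ← Finset.mul_sum] at h0
  refine (mul_eq_zero.1 h0).resolve_left ?_
  refine mul_ne_zero (mul_ne_zero (by positivity)
    (Finset.prod_ne_zero_iff.2 fun i _ => frameSign_ne_zero _ _)) ?_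
  rw [elim_comp]
  exact hE _ (hac.comp (moveSecond r q).bijective)

/-- If `k ⌟ *T = 0`, then `k ∧ T = 0`. -/
theorem IsFrame.wedge_eq_zero (hb : IsFrame G b t) {p r : ℕ} (hn : p + (r + 1) = n)
    (E : W [⋀^Fin p ⊕ Fin (r + 1)]→ₗ[ℝ] ℝ)
    (hE : ∀ f : Fin p ⊕ Fin (r + 1) → Fin n, Function.Bijective f → E (fun s => b (f s)) ≠ 0)
    (T : W [⋀^Fin p]→ₗ[ℝ] ℝ) (k : W)
    (h : ∀ v : Fin r → W, weightedStar (frameSign t) b E T (Fin.cons k v) = 0) :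
    wedge (G k) T = 0 := by
  refine Module.Basis.ext_alternating b fun a hai => ?_
  rw [wedge_apply]
  -- Dual to the previous argument: the components of `k ∧ T` on `a` are read off from `*T(k, c)`
  -- with `c` complementary to `a`.
  obtain ⟨c, hac⟩ := exists_complement (n := n) (m := p + 1) (r := r) (by omega) hai
  let D : W [⋀^Fin (p + 1) ⊕ Fin r]→ₗ[ℝ] ℝ := E.domDomCongr (moveFront p r)
  have hD : ∀ x, D x = E (fun s => x (moveFront p r s)) := fun _ => rfl
  have h0 := h (fun i => b (c i))
  have h1 : weightedStar (frameSign t) b E T (Fin.cons k fun i => b (c i))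
      = ∑ i, frameSign t i * G k (b i) *
        weightedStar (frameSign t) b E T (Fin.cons (b i) fun i => b (c i)) := by
    have hDk : ∀ (x : Fin p → W), E (Sum.elim x (Fin.cons k fun i => b (c i)))
        = ∑ i, frameSign t i * G k (b i) * E (Sum.elim x (Fin.cons (b i) fun i => b (c i))) := by
      intro x
      let f : W →ₗ[ℝ] ℝ :=
        { toFun := fun y => E (Sum.elim x (Fin.cons y fun i => b (c i)))
          map_add' := fun y z => by
            have := E.map_update_add (Sum.elim x (Fin.cons k fun i => b (c i))) (Sum.inr 0) y z
            simpa [← Sum.elim_update_right, Fin.update_cons_zero] using this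
          map_smul' := fun m y => by
            have := E.map_update_smul (Sum.elim x (Fin.cons k fun i => b (c i))) (Sum.inr 0) m y
            simpa [← Sum.elim_update_right, Fin.update_cons_zero] using this }
      exact hb.map_eq_sum f k
    unfold weightedStar
    simp only [hDk, Finset.mul_sum]
    rw [Finset.sum_comm]
    refine Finset.sum_congr rfl fun i _ => Finset.sum_congr rfl fun d _ => ?_
    ring
  rw [h1, sum_eq_sum_comp hai] at h0
  swap
  · intro i hi
    obtain ⟨s, rfl⟩ := hac.2 i
    cases s with
    | inl j => exact absurd ⟨j, rfl⟩ hi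
    | inr j =>
      refine mul_eq_zero_of_right _ (Finset.sum_eq_zero fun d _ => ?_)
      rw [E.map_eq_zero_of_eq _ (i := Sum.inr 0) (j := Sum.inr j.succ) (by simp)
        (by simpa using (Fin.succ_ne_zero j).symm)]
      simp
  have hterm : ∀ j : Fin (p + 1), frameSign t (a j) * G k (b (a j)) *
        weightedStar (frameSign t) b E T (Fin.cons (b (a j)) fun i => b (c i))
      = ((p.factorial : ℝ) * (∏ i, frameSign t (a i)) *
          D (Sum.elim (fun i => b (a i)) fun i => b (c i))) *
        ((-1 : ℝ) ^ (j : ℕ) * G k (b (a j)) * T (fun i => b (a (j.succAbove i)))) := by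
    intro j
    have hbij : Function.Bijective (Sum.elim (fun i => a (j.succAbove i)) (Fin.cons (a j) c)) := by
      have := (bijective_elim_perm hac j.cycleRange.symm).comp (moveFront p r).bijective
      convert this using 1
      rw [← injective_cons_succAbove]
      exact (elim_moveFront (Fin.cons (a j) fun i => a (j.succAbove i)) c).symm
    rw [cons_comp, weightedStar_basis _ _ _ _ hbij]
    have hDj := map_elim_cons_succAbove D (fun i => b (a i)) (fun i => b (c i)) j
    rw [hD, elim_moveFront] at hDj
    simp only [Fin.cons_zero, Fin.cons_succ] at hDj
    rw [← elim_comp, ← cons_comp, hDj, Fin.prod_univ_succAbove (fun i => frameSign t (a i)) j]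
    ring
  rw [Finset.sum_congr rfl fun j _ => hterm j, ← Finset.mul_sum] at h0
  refine (mul_eq_zero.1 h0).resolve_left ?_
  refine mul_ne_zero (mul_ne_zero (by positivity)
    (Finset.prod_ne_zero_iff.2 fun i _ => frameSign_ne_zero _ _)) ?_
  rw [elim_comp]
  exact hE _ (hac.comp (moveFront p r).bijective)

end Star

/-! ### Nilpotent operators -/

/-- Write the minimal polynomial as `X^r q` with `q` prime to `X`. The Bézout relation yields the
idempotent `e` that projects onto the part where `L` is invertible. As a polynomial in `L` without
constant term it has trace zero, so it vanishes in characteristic zero, and `L^r = 0` remains. -/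
theorem isNilpotent_of_trace_pow_eq_zero {V : Type*} [AddCommGroup V] [Module ℝ V]
    [FiniteDimensional ℝ V] (L : Module.End ℝ V)
    (h : ∀ m : ℕ, LinearMap.trace ℝ V (L ^ (m + 1)) = 0) : IsNilpotent L := by
  have hint : IsIntegral ℝ L := Algebra.IsIntegral.isIntegral L
  obtain ⟨q, hq, hdvd⟩ := Polynomial.exists_eq_pow_rootMultiplicity_mul_and_not_dvd
    (minpoly ℝ L) (minpoly.ne_zero hint) 0
  set r := (minpoly ℝ L).rootMultiplicity 0
  simp only [map_zero, sub_zero] at hq hdvd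
  -- The exponent `r + 1` instead of `r` makes every monomial of the idempotent have positive degree
  -- even when `r = 0`, so that the trace hypothesis applies.
  have hcop : IsCoprime ((Polynomial.X : Polynomial ℝ) ^ (r + 1)) q :=
    (Polynomial.irreducible_X.coprime_iff_not_dvd.2 hdvd).pow_left
  obtain ⟨u, w, huw⟩ := hcop
  have h0 : L ^ r * Polynomial.aeval L q = 0 := by
    have := minpoly.aeval ℝ L
    rw [hq, map_mul, map_pow, Polynomial.aeval_X] at this
    exact this
  have htr : ∀ f : Polynomial ℝ,
      LinearMap.trace ℝ V (Polynomial.aeval L (f * Polynomial.X ^ (r + 1))) = 0 := by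
    intro f
    induction f using Polynomial.induction_on' with
    | add f g hf hg => rw [add_mul, map_add, map_add, hf, hg, add_zero]
    | monomial m a =>
      rw [map_mul, Polynomial.aeval_monomial, map_pow, Polynomial.aeval_X, mul_assoc, ← pow_add,
        ← Algebra.smul_def, map_smul, ← add_assoc, h, smul_zero]
  set e : Module.End ℝ V := Polynomial.aeval L (u * Polynomial.X ^ (r + 1)) with he
  have h1 : e + Polynomial.aeval L (w * q) = 1 := by
    rw [he, ← map_add, huw, map_one]
  have h2 : e * Polynomial.aeval L (w * q) = 0 := by
    rw [he, ← map_mul]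
    have : u * Polynomial.X ^ (r + 1) * (w * q) = (u * w * Polynomial.X) * (Polynomial.X ^ r * q) := by
      ring
    rw [this, map_mul, map_mul _ (Polynomial.X ^ r) q, map_pow, Polynomial.aeval_X, h0, mul_zero]
  have hidem : IsIdempotentElem e := by
    have h3 : e * (e + Polynomial.aeval L (w * q)) = e := by rw [h1, mul_one]
    rwa [mul_add, h2, add_zero] at h3
  have he0 : e = 0 := (LinearMap.IsIdempotentElem.trace_eq_zero_iff hidem).1 (htr u)
  rw [he0, zero_add] at h1
  refine ⟨r, ?_⟩
  calc L ^ r = L ^ r * Polynomial.aeval L (w * q) := by rw [h1, mul_one]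
    _ = 0 := by rw [mul_comm w q, map_mul, ← mul_assoc, h0, zero_mul]

/-! ### Null vectors -/

section Null

variable {n : ℕ} {W : Type*} [AddCommGroup W] [Module ℝ W]
  {G : W →ₗ[ℝ] W →ₗ[ℝ] ℝ} {b : Module.Basis (Fin n) ℝ W} {t : Fin n}

theorem IsFrame.self_eq (hb : IsFrame G b t) (v : W) :
    G v v = (∑ i, b.repr v i ^ 2) - 2 * b.repr v t ^ 2 := by
  rw [hb.apply]
  have : ∀ i, frameSign t i * b.repr v i * b.repr v i
      = b.repr v i ^ 2 - if i = t then 2 * b.repr v i ^ 2 else 0 := by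
    intro i; unfold frameSign; split_ifs <;> ring
  rw [Finset.sum_congr rfl fun i _ => this i, Finset.sum_sub_distrib]
  simp

theorem IsFrame.eq_zero_of_null (hb : IsFrame G b t) {v : W} (hv : G v v = 0)
    (ht : b.repr v t = 0) : v = 0 := by
  rw [hb.self_eq, ht] at hv
  have h := (Finset.sum_eq_zero_iff_of_nonneg (s := Finset.univ)
    (f := fun i => b.repr v i ^ 2) fun i _ => sq_nonneg _).1 (by simpa using hv)
  rw [← b.sum_repr v]
  exact Finset.sum_eq_zero fun i hi => by rw [pow_eq_zero_iff two_ne_zero |>.1 (h i hi), zero_smul]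

/-- Subtract the multiple of `l` that cancels the time component of `k`. The difference is still
null, and a null vector without time component is zero. -/
theorem IsFrame.parallel_of_null (hb : IsFrame G b t) {k l : W} (hk : G k k = 0) (hl : G l l = 0)
    (hkl : G k l = 0) (hl0 : l ≠ 0) : ∃ c : ℝ, k = c • l := by
  have hlt : b.repr l t ≠ 0 := fun h => hl0 (hb.eq_zero_of_null hl h)
  refine ⟨b.repr k t / b.repr l t, ?_⟩
  rw [← sub_eq_zero]
  apply hb.eq_zero_of_null
  · simp [hk, hl, hkl, hb.symm l k]
  · simp [hlt]

/-- Scaling `k` by its time component leaves `b t` plus a unit spatial vector, which can be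
completed to a frame with the same timelike vector. -/
theorem IsFrame.exists_adapted (hb : IsFrame G b t) {k : W} (hk : G k k = 0) (hk0 : k ≠ 0) :
    ∃ (b' : Module.Basis (Fin n) ℝ W) (s : Fin n), s ≠ t ∧ IsFrame G b' t ∧
      ∃ c : ℝ, c ≠ 0 ∧ k = c • (b' t + b' s) := by
  have hkt : b.repr k t ≠ 0 := fun h => hk0 (hb.eq_zero_of_null hk h)
  have hs : ∃ s, s ≠ t := by
    by_contra! hall
    rw [hb.self_eq, Finset.sum_eq_single t (fun i _ hi => absurd (hall i) hi) (by simp)] at hk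
    exact hkt (pow_eq_zero_iff two_ne_zero |>.1 (by linarith))
  obtain ⟨s, hst⟩ := hs
  -- The completion takes place for the auxiliary Euclidean product of the frame coordinates, where
  -- orthonormal families extend to bases.
  let Φ : EuclideanSpace ℝ (Fin n) ≃ₗ[ℝ] W :=
    (WithLp.linearEquiv 2 ℝ (Fin n → ℝ)).trans b.equivFun.symm
  have hΦ : ∀ x i, b.repr (Φ x) i = x i := by
    intro x i
    change b.equivFun (b.equivFun.symm _) i = _
    rw [LinearEquiv.apply_symm_apply]; rfl
  let κ : EuclideanSpace ℝ (Fin n) := WithLp.toLp 2 fun i => if i = t then 0 else b.repr k i / b.repr k t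
  have hκt : κ t = 0 := by simp [κ]
  have hκ : inner ℝ κ κ = 1 := by
    rw [PiLp.inner_apply]
    have h1 : ∀ i, inner ℝ (κ i) (κ i)
        = (b.repr k i ^ 2 - if i = t then b.repr k i ^ 2 else 0) / b.repr k t ^ 2 := by
      intro i
      simp only [κ, RCLike.inner_apply, conj_trivial]
      split_ifs <;> field_simp <;> ring
    rw [Finset.sum_congr rfl fun i _ => h1 i, ← Finset.sum_div, Finset.sum_sub_distrib]
    rw [hb.self_eq] at hk
    rw [div_eq_one_iff_eq (pow_ne_zero 2 hkt)]
    simp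
    linarith
  let v : Fin n → EuclideanSpace ℝ (Fin n) := fun i => if i = t then EuclideanSpace.single t 1 else κ
  have hvt : v t = EuclideanSpace.single t 1 := by simp [v]
  have hvs : v s = κ := by simp [v, hst]
  have hv : Orthonormal ℝ (({t, s} : Set (Fin n)).domRestrict v) := by
    rw [orthonormal_iff_ite]
    rintro ⟨i, hi⟩ ⟨j, hj⟩
    change inner ℝ (v i) (v j) = _
    simp only [Set.mem_insert_iff, Set.mem_singleton_iff] at hi hj
    rcases hi with rfl | rfl <;> rcases hj with rfl | rfl
    · simp [hvt]
    · simp [hvt, hvs, hst.symm, EuclideanSpace.inner_single_left, hκt]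
    · simp [hvt, hvs, hst, EuclideanSpace.inner_single_right, hκt]
    · rw [hvs, hκ, if_pos rfl]
  obtain ⟨B, hB⟩ := hv.exists_orthonormalBasis_extension_of_card_eq (by simp)
  have hBt : B t = EuclideanSpace.single t 1 := by rw [hB t (by simp), hvt]
  have hBs : B s = κ := by rw [hB s (by simp), hvs]
  refine ⟨B.toBasis.map Φ, s, hst, fun i j => ?_, b.repr k t, hkt, ?_⟩
  -- The new vectors other than `B t` are Euclidean-orthogonal to it and so have no time component;
  -- on them the Lorentzian and Euclidean products agree.
  · have hBit : ∀ i, B i t = if i = t then 1 else 0 := by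
      intro i
      have := orthonormal_iff_ite.1 B.orthonormal i t
      rw [hBt, EuclideanSpace.inner_single_right] at this
      simpa using this
    have hin := orthonormal_iff_ite.1 B.orthonormal i j
    rw [PiLp.inner_apply] at hin
    simp only [RCLike.inner_apply, conj_trivial] at hin
    rw [hb.apply]
    simp only [Module.Basis.map_apply, OrthonormalBasis.coe_toBasis, hΦ]
    have h1 : ∀ m, frameSign t m * B i m * B j m
        = B j m * B i m - if m = t then 2 * B i m * B j m else 0 := by
      intro m; unfold frameSign; split_ifs <;> ring
    rw [Finset.sum_congr rfl fun m _ => h1 m, Finset.sum_sub_distrib, hin]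
    simp only [Finset.sum_ite_eq', Finset.mem_univ, if_true, hBit]
    unfold frameSign
    by_cases hij : i = j
    · subst hij
      rw [if_pos rfl, if_pos rfl]
      split_ifs <;> norm_num
    · split_ifs <;> simp_all
  · apply b.repr.injective
    ext i
    simp only [Module.Basis.map_apply, OrthonormalBasis.coe_toBasis, hBt, hBs, map_smul, map_add,
      Finsupp.smul_apply, Finsupp.add_apply, hΦ, smul_eq_mul]
    by_cases hi : i = t
    · subst hi; simp [hκt]
    · simp [κ, hi]; field_simp

/-! ### Contractions of tensors orthogonal to a null vector -/

/-- If `k = b t + b s` annihilates `α` and `β`, only the components of `α` and `β` transverse to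
`b t` and `b s` contribute to the contraction of `α` and `β`. -/
theorem sum_frameSign_mul {s t : Fin n} (hst : s ≠ t) (v : Fin n → W) : ∀ {q : ℕ}
    (α β : MultilinearMap ℝ (fun _ : Fin q => W) ℝ),
    (∀ w : Fin q → W, (∃ i, w i = v t + v s) → α w = 0) →
    (∀ w : Fin q → W, (∃ i, w i = v t + v s) → β w = 0) →
    ∑ c : Fin q → Fin n, (∏ i, frameSign t (c i)) * (α (fun i => v (c i)) * β (fun i => v (c i)))
      = ∑ c : Fin q → Fin n, (∏ i, if c i = t ∨ c i = s then (0 : ℝ) else 1) *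
        (α (fun i => v (c i)) * β (fun i => v (c i))) := by
  intro q
  induction q with
  | zero => intro α β _ _; simp
  | succ q ih =>
    intro α β hα hβ
    have hcons : ∀ (γ : MultilinearMap ℝ (fun _ : Fin (q + 1) => W) ℝ) (i : Fin n)
        (c : Fin q → Fin n), γ (fun j => v ((Fin.cons i c : Fin (q + 1) → Fin n) j))
          = γ.curryLeft (v i) (fun j => v (c j)) := by
      intro γ i c
      rw [MultilinearMap.curryLeft_apply]
      rw [cons_comp]
    have hsplit : ∀ (w : Fin n → ℝ),
        ∑ c : Fin (q + 1) → Fin n, (∏ i, w (c i)) * (α (fun i => v (c i)) * β (fun i => v (c i)))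
        = ∑ i, w i * ∑ c : Fin q → Fin n, (∏ i, w (c i)) *
          (α.curryLeft (v i) (fun j => v (c j)) * β.curryLeft (v i) (fun j => v (c j))) := by
      intro w
      rw [← (Fin.consEquiv fun _ => Fin n).sum_comp, Fintype.sum_prod_type]
      refine Finset.sum_congr rfl fun i _ => ?_
      rw [Finset.mul_sum]
      refine Finset.sum_congr rfl fun c _ => ?_
      simp only [Fin.consEquiv_apply, Fin.prod_univ_succ, Fin.cons_zero, Fin.cons_succ, hcons]
      ring
    rw [hsplit (frameSign t), hsplit (fun i => if i = t ∨ i = s then (0 : ℝ) else 1)]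
    -- Annihilation by `v t + v s` makes the `t` and `s` components opposite. Their products agree
    -- while the frame signs are opposite, so the two contributions cancel.
    have hts : ∀ (γ : MultilinearMap ℝ (fun _ : Fin (q + 1) => W) ℝ),
        (∀ w : Fin (q + 1) → W, (∃ i, w i = v t + v s) → γ w = 0) →
        γ.curryLeft (v t) = - γ.curryLeft (v s) := by
      intro γ hγ
      rw [eq_neg_iff_add_eq_zero, ← map_add]
      ext w
      exact hγ _ ⟨0, rfl⟩
    have hsub : ∀ (γ : MultilinearMap ℝ (fun _ : Fin (q + 1) => W) ℝ),
        (∀ w : Fin (q + 1) → W, (∃ i, w i = v t + v s) → γ w = 0) →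
        ∀ x (w : Fin q → W), (∃ i, w i = v t + v s) → γ.curryLeft x w = 0 := by
      rintro γ hγ x w ⟨i, hi⟩
      exact hγ _ ⟨i.succ, by simpa using hi⟩
    have hrest : ∀ i, i ∉ ({t, s} : Finset (Fin n)) → frameSign t i *
        ∑ c : Fin q → Fin n, (∏ i, frameSign t (c i)) *
          (α.curryLeft (v i) (fun j => v (c j)) * β.curryLeft (v i) (fun j => v (c j)))
        = (if i = t ∨ i = s then (0 : ℝ) else 1) *
        ∑ c : Fin q → Fin n, (∏ i, if c i = t ∨ c i = s then (0 : ℝ) else 1) *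
          (α.curryLeft (v i) (fun j => v (c j)) * β.curryLeft (v i) (fun j => v (c j))) := by
      intro i hi
      simp only [Finset.mem_insert, Finset.mem_singleton] at hi
      rw [ih _ _ (hsub α hα (v i)) (hsub β hβ (v i)), if_neg hi,
        frameSign_of_ne fun h => hi (Or.inl h)]
    rw [← Finset.sum_add_sum_compl {t, s}, ← Finset.sum_add_sum_compl {t, s}]
    congr 1
    · rw [Finset.sum_pair hst.symm, Finset.sum_pair hst.symm]
      rw [hts α hα, hts β hβ]
      simp [frameSign_of_ne hst]
    · exact Finset.sum_congr rfl fun i hi => hrest i (Finset.mem_compl.1 hi)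

end Null

/-! ### The energy form of a family of alternating forms -/

section Energy

variable {n m r : ℕ} {W : Type*} [AddCommGroup W] [Module ℝ W]
  {G : W →ₗ[ℝ] W →ₗ[ℝ] ℝ} {b : Module.Basis (Fin n) ℝ W} {t : Fin n}

/-- The bilinear form `∑ᵢ (Aᵢ)_{a c₁ … c_r} (Aᵢ)_b{}^{c₁ … c_r}`. -/
def energy (Q : Matrix (Fin n) (Fin n) ℝ) (e : Fin n → W) (A : Fin m → W [⋀^Fin (r + 1)]→ₗ[ℝ] ℝ) :
    W →ₗ[ℝ] W →ₗ[ℝ] ℝ :=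
  LinearMap.mk₂ ℝ (fun v w => ∑ i, pairing Q e ((A i).curryLeft v) ((A i).curryLeft w))
    (fun v v' w => by
      simp only [pairing, map_add, AlternatingMap.add_apply, ← Finset.sum_add_distrib]
      exact Finset.sum_congr rfl fun i _ => Finset.sum_congr rfl fun a _ =>
        Finset.sum_congr rfl fun c _ => by ring)
    (fun x v w => by
      simp only [pairing, map_smul, AlternatingMap.smul_apply, smul_eq_mul, Finset.mul_sum]
      exact Finset.sum_congr rfl fun i _ => Finset.sum_congr rfl fun a _ =>
        Finset.sum_congr rfl fun c _ => by ring)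
    (fun v w w' => by
      simp only [pairing, map_add, AlternatingMap.add_apply, ← Finset.sum_add_distrib]
      exact Finset.sum_congr rfl fun i _ => Finset.sum_congr rfl fun a _ =>
        Finset.sum_congr rfl fun c _ => by ring)
    (fun x v w => by
      simp only [pairing, map_smul, AlternatingMap.smul_apply, smul_eq_mul, Finset.mul_sum]
      exact Finset.sum_congr rfl fun i _ => Finset.sum_congr rfl fun a _ =>
        Finset.sum_congr rfl fun c _ => by ring)

theorem energy_apply (Q : Matrix (Fin n) (Fin n) ℝ) (e : Fin n → W)
    (A : Fin m → W [⋀^Fin (r + 1)]→ₗ[ℝ] ℝ) (v w : W) :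
    energy Q e A v w = ∑ i, pairing Q e ((A i).curryLeft v) ((A i).curryLeft w) := rfl

theorem IsFrame.energy_eq (hb : IsFrame G b t) (A : Fin m → W [⋀^Fin (r + 1)]→ₗ[ℝ] ℝ)
    (b' : Module.Basis (Fin n) ℝ W) (v w : W) :
    energy (gramInv G b') b' A v w = ∑ i, ∑ c : Fin r → Fin n, (∏ j, frameSign t (c j)) *
      (A i (Fin.cons v fun j => b (c j)) * A i (Fin.cons w fun j => b (c j))) := by
  rw [energy_apply]
  refine Finset.sum_congr rfl fun i _ => ?_
  exact hb.pairing_eq ((A i).curryLeft v).toMultilinearMap ((A i).curryLeft w).toMultilinearMap b'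

theorem IsFrame.energy_symm (hb : IsFrame G b t) (A : Fin m → W [⋀^Fin (r + 1)]→ₗ[ℝ] ℝ)
    (b' : Module.Basis (Fin n) ℝ W) (v w : W) :
    energy (gramInv G b') b' A v w = energy (gramInv G b') b' A w v := by
  rw [hb.energy_eq, hb.energy_eq]
  exact Finset.sum_congr rfl fun i _ => Finset.sum_congr rfl fun c _ => by ring

theorem map_cons_basis_eq_zero (A : W [⋀^Fin (r + 1)]→ₗ[ℝ] ℝ) {i : Fin n} {c : Fin r → Fin n}
    {b : Fin n → W} (h : ∃ j, c j = i) : A (Fin.cons (b i) fun j => b (c j)) = 0 := by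
  obtain ⟨j, hj⟩ := h
  exact A.map_eq_zero_of_eq _ (i := 0) (j := j.succ) (by simp [hj]) (Fin.succ_ne_zero j).symm

theorem interior_eq_zero_of_basis (b : Module.Basis (Fin n) ℝ W) (A : W [⋀^Fin (r + 1)]→ₗ[ℝ] ℝ)
    (k : W) (h : ∀ c : Fin r → Fin n, Function.Injective c → A (Fin.cons k fun j => b (c j)) = 0)
    (u : Fin r → W) : A (Fin.cons k u) = 0 := by
  have : A.curryLeft k = 0 := Module.Basis.ext_alternating b fun c hc => h c hc
  exact congrArg (fun f => f u) this

/-- The energy of `b t` is a sum of squares: multi-indices containing `t` drop out by antisymmetry,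
and the others carry sign `+1`. -/
theorem IsFrame.interior_timelike (hb : IsFrame G b t) (A : Fin m → W [⋀^Fin (r + 1)]→ₗ[ℝ] ℝ)
    (h : energy (gramInv G b) b A (b t) (b t) = 0) (i : Fin m) (u : Fin r → W) :
    A i (Fin.cons (b t) u) = 0 := by
  rw [hb.energy_eq] at h
  have hterm : ∀ i, ∀ c : Fin r → Fin n, (∏ j, frameSign t (c j)) *
      (A i (Fin.cons (b t) fun j => b (c j)) * A i (Fin.cons (b t) fun j => b (c j)))
      = A i (Fin.cons (b t) fun j => b (c j)) ^ 2 := by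
    intro i c
    by_cases hc : ∃ j, c j = t
    · rw [map_cons_basis_eq_zero _ hc]; ring
    · push Not at hc
      rw [Finset.prod_eq_one fun j _ => frameSign_of_ne (hc j)]; ring
  simp only [hterm] at h
  rw [Finset.sum_eq_zero_iff_of_nonneg
    fun i _ => Finset.sum_nonneg fun c _ => sq_nonneg _] at h
  refine interior_eq_zero_of_basis b (A i) (b t) (fun c _ => ?_) u
  have h2 := (Finset.sum_eq_zero_iff_of_nonneg fun c _ => sq_nonneg _).1 (h i (Finset.mem_univ i)) c
    (Finset.mem_univ c)
  exact pow_eq_zero_iff two_ne_zero |>.1 h2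

theorem cons_annihilated (A : W [⋀^Fin (r + 1)]→ₗ[ℝ] ℝ) {k : W} {u : Fin r → W}
    (h : ∃ i, u i = k) : A (Fin.cons k u) = 0 := by
  obtain ⟨j, hj⟩ := h
  exact A.map_eq_zero_of_eq _ (i := 0) (j := j.succ) (by simp [hj]) (Fin.succ_ne_zero j).symm

/-- For `k = b t + b s` the energy is used twice. Its value at `(k, k)` is the sum of squares of the
transverse components of `k ⌟ A`; once these vanish, its value at `(k, b t)` is the sum of squares
of the components without index `t`. -/
theorem IsFrame.interior_null (hb : IsFrame G b t) {s : Fin n} (hst : s ≠ t)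
    (A : Fin m → W [⋀^Fin (r + 1)]→ₗ[ℝ] ℝ)
    (h : ∀ v, energy (gramInv G b) b A (b t + b s) v = 0) (i : Fin m) (u : Fin r → W) :
    A i (Fin.cons (b t + b s) u) = 0 := by
  have hadd : ∀ i (c : Fin r → W), A i (Fin.cons (b t + b s) c)
      = A i (Fin.cons (b t) c) + A i (Fin.cons (b s) c) := by
    intro i c
    exact congrArg (fun f => f c) (map_add (A i).curryLeft (b t) (b s))
  -- the components transverse to `b t` and `b s`
  have htrans : ∀ i, ∀ c : Fin r → Fin n, (∀ j, ¬ (c j = t ∨ c j = s)) →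
      A i (Fin.cons (b t + b s) fun j => b (c j)) = 0 := by
    have h1 := h (b t + b s)
    rw [hb.energy_eq] at h1
    have h2 : ∀ i, ∑ c : Fin r → Fin n, (∏ j, frameSign t (c j)) *
        (A i (Fin.cons (b t + b s) fun j => b (c j)) * A i (Fin.cons (b t + b s) fun j => b (c j)))
        = ∑ c : Fin r → Fin n, (∏ j, if c j = t ∨ c j = s then (0 : ℝ) else 1) *
        (A i (Fin.cons (b t + b s) fun j => b (c j)) *
          A i (Fin.cons (b t + b s) fun j => b (c j))) := fun i =>
      sum_frameSign_mul hst b ((A i).curryLeft (b t + b s)).toMultilinearMap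
        ((A i).curryLeft (b t + b s)).toMultilinearMap
        (fun w hw => cons_annihilated _ hw) (fun w hw => cons_annihilated _ hw)
    have hnn : ∀ i, ∀ c : Fin r → Fin n, 0 ≤ (∏ j, if c j = t ∨ c j = s then (0 : ℝ) else 1) *
        (A i (Fin.cons (b t + b s) fun j => b (c j)) *
          A i (Fin.cons (b t + b s) fun j => b (c j))) := fun i c =>
      mul_nonneg (Finset.prod_nonneg fun j _ => by split_ifs <;> norm_num) (mul_self_nonneg _)
    rw [Finset.sum_congr rfl fun i _ => h2 i, Finset.sum_eq_zero_iff_of_nonneg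
      fun i _ => Finset.sum_nonneg fun c _ => hnn i c] at h1
    intro i c hc
    have h3 := (Finset.sum_eq_zero_iff_of_nonneg fun c _ => hnn i c).1
      (h1 i (Finset.mem_univ i)) c (Finset.mem_univ c)
    rw [Finset.prod_eq_one fun j _ => if_neg (hc j), one_mul, mul_self_eq_zero] at h3
    exact h3
  -- the components without index `t`
  have hspace : ∀ i, ∀ c : Fin r → Fin n, (∀ j, c j ≠ t) →
      A i (Fin.cons (b t + b s) fun j => b (c j)) = 0 := by
    have h1 := h (b t)
    rw [hb.energy_eq] at h1
    have hterm : ∀ i, ∀ c : Fin r → Fin n, (∏ j, frameSign t (c j)) *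
        (A i (Fin.cons (b t + b s) fun j => b (c j)) * A i (Fin.cons (b t) fun j => b (c j)))
        = if ∀ j, c j ≠ t then A i (Fin.cons (b t + b s) fun j => b (c j)) ^ 2 else 0 := by
      intro i c
      split_ifs with hc
      · rw [Finset.prod_eq_one fun j _ => frameSign_of_ne (hc j), one_mul]
        -- If `s` occurs in `c`, then `b s` in front contributes nothing, so `k` and `b t` give the
        -- same component. If not, the component of `k ⌟ A` is transverse and already zero.
        by_cases hs : ∃ j, c j = s
        · have : A i (Fin.cons (b t + b s) fun j => b (c j)) = A i (Fin.cons (b t) fun j => b (c j)) := by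
            rw [hadd, map_cons_basis_eq_zero _ hs, add_zero]
          rw [this]; ring
        · push Not at hs
          rw [htrans i c fun j hj => hj.elim (hc j) (hs j)]; ring
      · push Not at hc
        rw [map_cons_basis_eq_zero _ hc]; ring
    have hnn : ∀ i, ∀ c : Fin r → Fin n,
        0 ≤ if ∀ j, c j ≠ t then A i (Fin.cons (b t + b s) fun j => b (c j)) ^ 2 else 0 := by
      intro i c; split_ifs
      · positivity
      · exact le_rfl
    simp only [hterm] at h1
    rw [Finset.sum_eq_zero_iff_of_nonneg fun i _ => Finset.sum_nonneg fun c _ => hnn i c] at h1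
    intro i c hc
    have h3 := (Finset.sum_eq_zero_iff_of_nonneg fun c _ => hnn i c).1
      (h1 i (Finset.mem_univ i)) c (Finset.mem_univ c)
    rw [if_pos hc] at h3
    exact pow_eq_zero_iff two_ne_zero |>.1 h3
  refine interior_eq_zero_of_basis b (A i) _ (fun c hci => ?_) u
  -- An index `t` can be traded for `s` up to sign, since `b t + b s` in two slots gives zero.
  -- Injectivity of `c` ensures that no second `t` is left.
  by_cases hc : ∃ j, c j = t
  · obtain ⟨j, hj⟩ := hc
    have hu : (fun l => b (c l)) = Function.update (fun l => b (c l)) j (b t) := by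
      rw [← hj]; exact (Function.update_eq_self j _).symm
    have h1 := ((A i).curryLeft (b t + b s)).map_update_add (fun l => b (c l)) j (b t) (b s)
    have h2 : ((A i).curryLeft (b t + b s)) (Function.update (fun l => b (c l)) j (b t + b s)) = 0 :=
      cons_annihilated _ ⟨j, by simp⟩
    have h3 : ((A i).curryLeft (b t + b s)) (Function.update (fun l => b (c l)) j (b s)) = 0 := by
      have h4 : Function.update (fun l => b (c l)) j (b s)
          = fun l => b (Function.update c j s l) := by
        ext l
        by_cases hl : l = j
        · subst hl; simp
        · simp [hl]
      rw [h4]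
      refine hspace i _ fun l => ?_
      by_cases hl : l = j
      · subst hl; simpa using hst
      · simp only [ne_eq, hl, not_false_eq_true, Function.update_of_ne]
        intro h5
        exact hl (hci (h5.trans hj.symm))
    rw [h2, h3, ← hu, add_zero] at h1
    exact h1.symm
  · push Not at hc
    exact hspace i c hc

theorem IsFrame.energy_frame (hb : IsFrame G b t) {b' : Module.Basis (Fin n) ℝ W}
    (e : Module.Basis (Fin n) ℝ W) (A : Fin m → W [⋀^Fin (r + 1)]→ₗ[ℝ] ℝ) (v w : W) :
    energy (gramInv G b') b' A v w = energy (gramInv G e) e A v w := by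
  rw [hb.energy_eq, hb.energy_eq]

/-- If the energy operator of a family of forms is nilpotent, there is a common null vector or
timelike vector that annihilates all of the forms. -/
theorem IsFrame.exists_interior_eq_zero (hb : IsFrame G b t)
    (A : Fin m → W [⋀^Fin (r + 1)]→ₗ[ℝ] ℝ) (L : Module.End ℝ W)
    (hL : ∀ v w, G (L v) w = energy (gramInv G b) b A v w) (hnil : IsNilpotent L) :
    (∃ k, k ≠ 0 ∧ G k k = 0 ∧ ∀ i u, A i (Fin.cons k u) = 0) ∨
      (∃ k, G k k ≠ 0 ∧ ∀ i u, A i (Fin.cons k u) = 0) := by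
  by_cases hL0 : L = 0
  · right
    -- With `L = 0` the energy of every vector is zero, and that of the timelike frame vector is
    -- positive semidefinite.
    refine ⟨b t, ?_, fun i u => hb.interior_timelike A ?_ i u⟩
    · rw [hb t t]; simp
    · rw [← hL, hL0]; simp
  · left
    have : Nontrivial (Module.End ℝ W) := ⟨L, 0, hL0⟩
    have hsymm : ∀ v w, G (L v) w = G v (L w) := fun v w => by
      rw [hL, hb.energy_symm, ← hL, hb.symm]
    have hpos := (pos_nilpotencyClass_iff (x := L)).2 hnil
    set d := nilpotencyClass L with hd
    have hd1 : d ≠ 1 := fun h1 => hL0 (by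
      have := pow_nilpotencyClass hnil
      rwa [← hd, h1, pow_one] at this)
    have hne : L ^ (d - 1) ≠ 0 := pow_pred_nilpotencyClass hnil
    obtain ⟨v, hv⟩ : ∃ v, (L ^ (d - 1)) v ≠ 0 := by
      by_contra! hall
      exact hne (LinearMap.ext hall)
    have hpow : ∀ j, d ≤ j → L ^ j = 0 := fun j hj =>
      pow_eq_zero_of_le hj (pow_nilpotencyClass hnil)
    have hsp : ∀ j v w, G ((L ^ j) v) w = G v ((L ^ j) w) := by
      intro j
      induction j with
      | zero => intro v w; simp
      | succ j ih =>
        intro v w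
        rw [pow_succ, Module.End.mul_apply, ih, hsymm, ← Module.End.mul_apply,
          ← pow_succ', pow_succ]
    -- The last nonzero power of `L` puts `k` in the kernel and the image of `L`. Self-adjointness
    -- gives `G(k, k) = G(v, L^(2(d-1)) v)`, which is zero because `d ≥ 2` implies `2(d-1) ≥ d`.
    set k := (L ^ (d - 1)) v with hk
    have hLk : L k = 0 := by
      rw [hk, ← Module.End.mul_apply, ← pow_succ', hpow _ (by omega)]; rfl
    have hkk : G k k = 0 := by
      have : G k k = G v ((L ^ (d - 1)) k) := hsp _ _ _
      rw [this, hk, ← Module.End.mul_apply, ← pow_add, hpow _ (by omega)]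
      simp
    obtain ⟨b', s, hst, hb', c, hc, hkc⟩ := hb.exists_adapted hkk hv
    refine ⟨k, hv, hkk, fun i u => ?_⟩
    have h1 : ∀ w, energy (gramInv G b') b' A (b' t + b' s) w = 0 := by
      intro w
      have h2 : energy (gramInv G b') b' A k w = 0 := by
        rw [hb.energy_frame b, ← hL, hLk]; simp
      rw [hkc, map_smul, LinearMap.smul_apply, smul_eq_mul] at h2
      exact (mul_eq_zero.1 h2).resolve_left hc
    have h3 := hb'.interior_null hst A h1 i u
    rw [hkc]
    have h4 := congrArg (fun f => f u) (map_smul (A i).curryLeft c (b' t + b' s))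
    change A i (Fin.cons _ u) = c • A i (Fin.cons _ u) at h4
    rw [h4, h3, smul_zero]

theorem wedge_smul_left {p : ℕ} (c : ℝ) (α : W →ₗ[ℝ] ℝ) (T : W [⋀^Fin p]→ₗ[ℝ] ℝ) :
    wedge (c • α) T = c • wedge α T := by
  ext v
  rw [AlternatingMap.smul_apply, wedge_apply, wedge_apply, smul_eq_mul, Finset.mul_sum]
  exact Finset.sum_congr rfl fun j _ => by
    rw [LinearMap.smul_apply, smul_eq_mul]; ring

theorem mul_eq_zero_of_wedge (α : W →ₗ[ℝ] ℝ) (T : W [⋀^Fin (r + 1)]→ₗ[ℝ] ℝ)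
    (h : wedge α T = 0) (z : W) (v : Fin (r + 1) → W) (hv : ∀ i, α (v i) = 0) : α z * T v = 0 := by
  have h1 := congrArg (fun f => f (Fin.cons z v)) h
  simp only [wedge_apply, AlternatingMap.zero_apply, Fin.sum_univ_succ] at h1
  simpa [hv] using h1

/-- The energy operator of a family of forms that are aligned with a common null vector has
square zero. -/
theorem IsFrame.energy_sq_eq_zero (hb : IsFrame G b t)
    (A : Fin m → W [⋀^Fin (r + 1)]→ₗ[ℝ] ℝ) (L : Module.End ℝ W)
    (hL : ∀ v w, G (L v) w = energy (gramInv G b) b A v w) {k : W} (hk0 : k ≠ 0)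
    (hk : G k k = 0) (h1 : ∀ i u, A i (Fin.cons k u) = 0) (h2 : ∀ i, wedge (G k) (A i) = 0) :
    L * L = 0 := by
  obtain ⟨b', s, hst, hb', c, hc, hkc⟩ := hb.exists_adapted hk hk0
  have h1' : ∀ i (u : Fin (r + 1) → W) j, u j = b' t + b' s → A i u = 0 := by
    intro i u j hj
    have h3 : A i (Fin.cons (b' t + b' s) fun l => u (j.succAbove l)) = 0 := by
      have h4 := h1 i fun l => u (j.succAbove l)
      rw [hkc] at h4
      have h5 := congrArg (fun f => f fun l => u (j.succAbove l))
        (map_smul (A i).curryLeft c (b' t + b' s))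
      change A i (Fin.cons _ _) = c • A i (Fin.cons _ _) at h5
      rw [h5, smul_eq_mul] at h4
      exact (mul_eq_zero.1 h4).resolve_left hc
    have h6 := AlternatingMap.map_insertNth (A i) j (u j) (fun l => u (j.succAbove l))
    rw [show j.insertNth (u j) (fun l => u (j.succAbove l)) = u from Fin.insertNth_self_removeNth j u]
      at h6
    rw [h6, hj]
    have h7 : A i (Matrix.vecCons (b' t + b' s) fun l => u (j.succAbove l)) = 0 := h3
    rw [h7, smul_zero]
  have h2' : ∀ i, wedge (G (b' t + b' s)) (A i) = 0 := by
    intro i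
    have := h2 i
    rw [hkc, map_smul, wedge_smul_left] at this
    exact (smul_eq_zero.1 this).resolve_left hc
  -- If `v ⊥ k`, only transverse multi-indices contribute, and for these all arguments of `A i` lie
  -- in the orthogonal complement of `k`, where `k ∧ A i = 0` makes the form vanish.
  have hzero : ∀ v w, G (b' t + b' s) v = 0 → energy (gramInv G b') b' A v w = 0 := by
    intro v w hv
    rw [hb'.energy_eq]
    refine Finset.sum_eq_zero fun i _ => ?_
    have h3 := sum_frameSign_mul hst b' ((A i).curryLeft v).toMultilinearMap
      ((A i).curryLeft w).toMultilinearMap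
      (fun u ⟨j, hj⟩ => h1' i _ j.succ (by simpa using hj))
      (fun u ⟨j, hj⟩ => h1' i _ j.succ (by simpa using hj))
    refine Eq.trans h3 (Finset.sum_eq_zero fun d _ => ?_)
    by_cases hd : ∃ j, d j = t ∨ d j = s
    · obtain ⟨j, hj⟩ := hd
      have h0 : (∏ j, if d j = t ∨ d j = s then (0 : ℝ) else 1) = 0 :=
        Finset.prod_eq_zero (Finset.mem_univ j) (if_pos hj)
      rw [h0, zero_mul]
    · push Not at hd
      have h4 : A i (Fin.cons v fun j => b' (d j)) = 0 := by
        have h5 := mul_eq_zero_of_wedge _ _ (h2' i) (b' t) (Fin.cons v fun j => b' (d j))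
          (fun j => by
            refine Fin.cases ?_ (fun j => ?_) j
            · simpa using hv
            · simp [hb' _ _, (hd j).1.symm, (hd j).2.symm])
        have h6 : G (b' t + b' s) (b' t) = -1 := by
          simp [hb' _ _, hst]
        rw [h6] at h5
        linarith
      have h7 : ((A i).curryLeft v).toMultilinearMap (fun j => b' (d j)) = 0 := h4
      rw [h7]; ring
  ext v
  rw [LinearMap.zero_apply, Module.End.mul_apply]
  refine hb.nondegenerate fun w => ?_
  rw [hL, hb.energy_frame b']
  apply hzero
  -- This shows that the image of `L` is orthogonal to `k`, because the energy of `k` against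
  -- anything vanishes (`k` is orthogonal to itself). A second application of `L` therefore gives
  -- zero.
  have h8 : G (b' t + b' s) (L v) = energy (gramInv G b) b A v (b' t + b' s) := by
    rw [hb.symm, hL]
  rw [h8, hb.energy_frame b', hb'.energy_symm]
  apply hzero
  simp [hb' _ _, hst, hst.symm, frameSign_of_ne hst]

end Energy

/-! ### Operators represented by bilinear forms, and traces of their powers -/

section Operator

variable {n m r : ℕ} {W : Type*} [AddCommGroup W] [Module ℝ W]
  {G : W →ₗ[ℝ] W →ₗ[ℝ] ℝ} {b : Module.Basis (Fin n) ℝ W} {t : Fin n}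

/-- The antiderivation rule `l ⌟ (α ∧ T) = α(l) T - α ∧ (l ⌟ T)`, with both `α ∧ T` and `l ⌟ T`
zero. -/
theorem mul_eq_zero_of_wedge_of_interior (α : W →ₗ[ℝ] ℝ) (T : W [⋀^Fin (r + 1)]→ₗ[ℝ] ℝ) {l : W}
    (h : wedge α T = 0) (hl : ∀ u, T (Fin.cons l u) = 0) (v : Fin (r + 1) → W) :
    α l * T v = 0 := by
  have h1 := congrArg (fun f => f (Fin.cons l v)) h
  simp only [wedge_apply, AlternatingMap.zero_apply] at h1
  rw [Fin.sum_univ_succ, Finset.sum_eq_zero, add_zero] at h1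
  · simpa using h1
  · intro j _
    refine mul_eq_zero_of_right _ ?_
    have : (fun i => (Fin.cons l v : Fin (r + 2) → W) (j.succ.succAbove i))
        = Fin.cons l (fun i => v (j.succAbove i)) := by
      ext i; refine Fin.cases ?_ (fun i => ?_) i <;> simp
    rw [this, hl]

/-- In a Lorentzian space every bilinear form is represented by an operator. -/
theorem IsFrame.exists_operator (hb : IsFrame G b t) (S : W →ₗ[ℝ] W →ₗ[ℝ] ℝ) :
    ∃ L : Module.End ℝ W, ∀ v w, G (L v) w = S v w := by
  refine ⟨∑ i, (frameSign t i • S.flip (b i)).smulRight (b i), fun v w => ?_⟩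
  rw [hb.map_eq_sum (S v) w]
  simp only [LinearMap.sum_apply, LinearMap.smulRight_apply, map_sum, map_smul,
    LinearMap.smul_apply, LinearMap.flip_apply, smul_eq_mul]
  refine Finset.sum_congr rfl fun i _ => ?_
  rw [hb.symm (b i) w]; ring

/-- The powers of the operator represented by the bilinear form `S`, as bilinear forms. -/
def iterForm (Q : Matrix (Fin n) (Fin n) ℝ) (e : Fin n → W) (S : W → W → ℝ) : ℕ → W → W → ℝ
  | 0 => S
  | k + 1 => fun v w => ∑ a, ∑ c, Q a c * (iterForm Q e S k v (e a) * S (e c) w)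

/-- Contracting adjacent indices with the inverse metric composes the operators. Level `0` is the
form itself, that is the first power, whence the shift by one. -/
theorem IsFrame.iterForm_eq (hb : IsFrame G b t) (e : Module.Basis (Fin n) ℝ W)
    {S : W →ₗ[ℝ] W →ₗ[ℝ] ℝ} {L : Module.End ℝ W} (hL : ∀ v w, G (L v) w = S v w) (k : ℕ) :
    ∀ v w, iterForm (gramInv G e) e (fun v w => S v w) k v w = G ((L ^ (k + 1)) v) w := by
  induction k with
  | zero => intro v w; simp [iterForm, hL]
  | succ k ih =>
    intro v w
    simp only [iterForm, ih]
    have h1 := hb.contraction_eq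
      (LinearMap.mk₂ ℝ (fun x y => G ((L ^ (k + 1)) v) x * S y w)
        (fun x x' y => by simp [add_mul]) (fun c x y => by simp [mul_assoc])
        (fun x y y' => by simp [mul_add]) (fun c x y => by simp; ring)) e
    simp only [LinearMap.mk₂_apply] at h1
    rw [h1, pow_succ' L (k + 1), Module.End.mul_apply, hL]
    conv_rhs => rw [hb.sum_eq ((L ^ (k + 1)) v)]
    simp only [map_sum, map_smul, LinearMap.sum_apply, LinearMap.smul_apply, smul_eq_mul]
    exact Finset.sum_congr rfl fun i _ => by ring

theorem IsFrame.trace_eq (hb : IsFrame G b t) (e : Module.Basis (Fin n) ℝ W) (L : Module.End ℝ W) :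
    LinearMap.trace ℝ W L = ∑ a, ∑ c, gramInv G e a c * G (L (e a)) (e c) := by
  have h1 := hb.contraction_eq (G.comp L) e
  simp only [LinearMap.comp_apply] at h1
  rw [h1, LinearMap.trace_eq_matrix_trace ℝ b, Matrix.trace]
  refine Finset.sum_congr rfl fun i _ => ?_
  rw [Matrix.diag_apply, LinearMap.toMatrix_apply, hb.repr_eq]

theorem trace_pow_eq_zero_of_sq_eq_zero {L : Module.End ℝ W} (h : L * L = 0) (k : ℕ) :
    LinearMap.trace ℝ W (L ^ (k + 1)) = 0 := by
  have hn : IsNilpotent (L ^ (k + 1)) := ⟨2, by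
    rw [← pow_mul]; exact pow_eq_zero_of_le (by omega) (by rw [pow_two, h] : L ^ 2 = 0)⟩
  exact (LinearMap.isNilpotent_trace_of_isNilpotent hn).eq_zero

theorem IsFrame.det_gram_ne_zero (hb : IsFrame G b t) (e : Module.Basis (Fin n) ℝ W) :
    (Matrix.of fun i j => G (e i) (e j)).det ≠ 0 := by
  intro h
  obtain ⟨v, hv, hv0⟩ := Matrix.exists_mulVec_eq_zero_iff.2 h
  have hw : ∑ j, v j • e j = 0 := by
    refine hb.nondegenerate fun w => ?_
    rw [hb.symm, ← e.sum_repr w, map_sum G, LinearMap.sum_apply]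
    refine Finset.sum_eq_zero fun i _ => ?_
    have h1 : ∑ j, G (e i) (e j) * v j = 0 := congrFun hv0 i
    rw [map_smul, LinearMap.smul_apply, map_sum]
    simp only [map_smul, smul_eq_mul]
    rw [← h1, Finset.sum_congr rfl fun j _ => mul_comm (v j) _, h1, mul_zero]
  exact hv (funext fun j => (Fintype.linearIndependent_iff.1 e.linearIndependent v hw j))

end Operator

section Charts

variable {n : ℕ} {M : Type*} [TopologicalSpace M] [ChartedSpace (EuclideanSpace ℝ (Fin n)) M]

/-! ### Bases of the tangent spaces -/

instance (x : M) : FiniteDimensional ℝ (TangentSpace (𝓡 n) x) :=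
  inferInstanceAs (FiniteDimensional ℝ (EuclideanSpace ℝ (Fin n)))

/-- The basis `stdVec`. -/
def stdBasis (x : M) : Module.Basis (Fin n) ℝ (TangentSpace (𝓡 n) x) :=
  (EuclideanSpace.basisFun (Fin n) ℝ).toBasis

theorem stdBasis_apply (x : M) (i : Fin n) : stdBasis x i = stdVec x i :=
  (congrFun (OrthonormalBasis.coe_toBasis (EuclideanSpace.basisFun (Fin n) ℝ)) i).trans
    (EuclideanSpace.basisFun_apply (Fin n) ℝ i)

theorem coe_stdBasis (x : M) : (stdBasis x : Fin n → TangentSpace (𝓡 n) x) = stdVec x :=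
  funext (stdBasis_apply x)

theorem IsChart.mdifferentiable [IsManifold (𝓡 n) ∞ M]
    {e : OpenPartialHomeomorph M (EuclideanSpace ℝ (Fin n))}
    (he : IsChart e) : e.MDifferentiable (𝓡 n) (𝓡 n) :=
  ⟨(contMDiffOn_of_mem_maximalAtlas he).mdifferentiableOn (by simp),
    (contMDiffOn_symm_of_mem_maximalAtlas he).mdifferentiableOn (by simp)⟩

variable [IsManifold (𝓡 n) ∞ M] {e : OpenPartialHomeomorph M (EuclideanSpace ℝ (Fin n))}
  {y : EuclideanSpace ℝ (Fin n)}

theorem exists_coordBasis (he : IsChart e) (hy : y ∈ e.target) :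
    ∃ b : Module.Basis (Fin n) ℝ (TangentSpace (𝓡 n) (e.symm y)),
      (b : Fin n → TangentSpace (𝓡 n) (e.symm y)) = coordVec e y := by
  have h1 := he.mdifferentiable.comp_symm_deriv hy
  let f : EuclideanSpace ℝ (Fin n) →ₗ[ℝ] EuclideanSpace ℝ (Fin n) :=
    (mfderiv (𝓡 n) (𝓡 n) e.symm y).toLinearMap
  have hf : Function.Injective f := by
    intro v w hvw
    have h2 := congrArg (mfderiv (𝓡 n) (𝓡 n) e (e.symm y)) hvw
    have h3 : ∀ v, mfderiv (𝓡 n) (𝓡 n) e (e.symm y) (f v) = v := fun v =>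
      congrArg (fun F => F v) h1
    exact (h3 v).symm.trans (h2.trans (h3 w))
  let b := (EuclideanSpace.basisFun (Fin n) ℝ).toBasis.map (LinearEquiv.ofInjectiveEndo f hf)
  refine ⟨b, funext fun i => ?_⟩
  change b i = _
  simp only [b, Module.Basis.map_apply, OrthonormalBasis.coe_toBasis, EuclideanSpace.basisFun_apply,
    LinearEquiv.ofInjectiveEndo]
  rfl

/-- The coordinate vectors as a basis. -/
def coordBasis (he : IsChart e) (hy : y ∈ e.target) :
    Module.Basis (Fin n) ℝ (TangentSpace (𝓡 n) (e.symm y)) := (exists_coordBasis he hy).choose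

theorem coe_coordBasis (he : IsChart e) (hy : y ∈ e.target) :
    (coordBasis he hy : Fin n → TangentSpace (𝓡 n) (e.symm y)) = coordVec e y :=
  (exists_coordBasis he hy).choose_spec

theorem exists_chart_point (x : M) : ∃ e : OpenPartialHomeomorph M (EuclideanSpace ℝ (Fin n)),
    IsChart e ∧ ∃ y ∈ e.target, e.symm y = x :=
  ⟨chartAt _ x, IsManifold.chart_mem_maximalAtlas x, chartAt _ x x, mem_chart_target _ x,
    (chartAt _ x).left_inv (mem_chart_source _ x)⟩

end Charts

/-! ### Contractions and Hodge duals in arbitrary bases and charts -/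

section Contractions

/-- A multilinear map as a bilinear form in its first two arguments. -/
def biForm {W : Type*} [AddCommGroup W] [Module ℝ W] {k : ℕ}
    (T : MultilinearMap ℝ (fun _ : Fin (k + 2) => W) ℝ) (u : Fin k → W) : W →ₗ[ℝ] W →ₗ[ℝ] ℝ :=
  LinearMap.mk₂ ℝ (fun v w => (T.curryLeft v).curryLeft w u)
    (fun v v' w => by simp only [map_add]; rfl)
    (fun c v w => by simp only [map_smul]; rfl)
    (fun v w w' => by simp only [map_add, add_apply])
    (fun c v w => by simp only [map_smul]; rfl)

variable {n : ℕ} {M : Type*} [TopologicalSpace M] [ChartedSpace (EuclideanSpace ℝ (Fin n)) M]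

/-- The metric at `x` as a bilinear form. -/
def gform (g : TensorField n M 2) (x : M) :
    TangentSpace (𝓡 n) x →ₗ[ℝ] TangentSpace (𝓡 n) x →ₗ[ℝ] ℝ := biForm (k := 0) (g x) ![]

theorem gform_apply (g : TensorField n M 2) (x : M) (v w : TangentSpace (𝓡 n) x) :
    gform g x v w = inn g x v w := rfl

theorem ginv_eq (g : TensorField n M 2) (x : M) :
    ginv g x = gramInv (gform g x) (stdBasis x) := by
  rw [coe_stdBasis]; rfl

theorem IsLorentzianMetric.exists_frame {g : TensorField n M 2} (hg : IsLorentzianMetric g) (x : M) :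
    ∃ (b : Module.Basis (Fin n) ℝ (TangentSpace (𝓡 n) x)) (t : Fin n),
      IsFrame (gform g x) b t ∧ IsOrthonormalFrame g x b := by
  obtain ⟨b, t, h⟩ := hg.lorentz x
  exact ⟨b, t, h, t, h⟩

theorem contract_apply (g : TensorField n M 2) {k : ℕ} (T : TensorField n M (k + 2)) (x : M)
    (u : Fin k → TangentSpace (𝓡 n) x) (b : Module.Basis (Fin n) ℝ (TangentSpace (𝓡 n) x)) :
    contract g T x u = ∑ i, ∑ j, gramInv (gform g x) b i j * biForm (T x) u (b i) (b j) := by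
  rw [← contraction_change (gform g x) (biForm (T x) u) b (stdBasis x), ← ginv_eq, coe_stdBasis]
  unfold contract
  simp only [sum_apply, smul_apply, smul_eq_mul]
  rfl

/-- The tensor `ε`, with the last indices contracted with `u`. -/
def frontMap {W : Type*} [AddCommGroup W] [Module ℝ W] {p q : ℕ}
    (E : MultilinearMap ℝ (fun _ : Fin (p + q) => W) ℝ) (u : Fin q → W) :
    MultilinearMap ℝ (fun _ : Fin p => W) ℝ :=
  (LinearMap.mk ⟨fun f => f u, fun _ _ => rfl⟩ fun _ _ => rfl :
    MultilinearMap ℝ (fun _ : Fin q => W) ℝ →ₗ[ℝ] ℝ).compMultilinearMap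
      (E.domDomCongr finSumFinEquiv.symm).currySum

theorem frontMap_apply {W : Type*} [AddCommGroup W] [Module ℝ W] {p q : ℕ}
    (E : MultilinearMap ℝ (fun _ : Fin (p + q) => W) ℝ) (u : Fin q → W) (a : Fin p → W) :
    frontMap E u a = E (fun i => Sum.elim a u (finSumFinEquiv.symm i)) := rfl

theorem hodge_apply {p q : ℕ} (g : TensorField n M 2) (ε : TensorField n M (p + q))
    (T : TensorField n M p) (x : M) (u : Fin q → TangentSpace (𝓡 n) x)
    (b : Module.Basis (Fin n) ℝ (TangentSpace (𝓡 n) x)) :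
    hodge g ε T x u = (1 / (p.factorial : ℝ)) *
      pairing (gramInv (gform g x) b) b (T x) (frontMap (ε x) u) := by
  rw [← pairing_change (gform g x) (T x) (frontMap (ε x) u) b (stdBasis x), ← ginv_eq, coe_stdBasis]
  unfold hodge pairing
  simp only [sum_apply, smul_apply, smul_eq_mul]
  congr 1
  exact Finset.sum_congr rfl fun a _ => Finset.sum_congr rfl fun c _ => by rw [mul_assoc]; rfl

theorem tensorProd_apply {k l : ℕ} (S : TensorField n M k) (T : TensorField n M l) (x : M)
    (v : Fin (k + l) → TangentSpace (𝓡 n) x) :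
    tensorProd S T x v = S x (fun i => v (Fin.castAdd l i)) * T x (fun i => v (Fin.natAdd k i)) := by
  unfold tensorProd
  simp [MultilinearMap.domCoprod_apply]

theorem isSmooth_tensorProd {k l : ℕ} {S : TensorField n M k} {T : TensorField n M l}
    (hS : IsSmooth S) (hT : IsSmooth T) : IsSmooth (tensorProd S T) := by
  intro e he a
  simp only [comp, tensorProd_apply]
  exact (hS e he _).mul (hT e he _)

/-! ### Components in charts -/

variable {e : OpenPartialHomeomorph M (EuclideanSpace ℝ (Fin n))} {y : EuclideanSpace ℝ (Fin n)}

theorem comp_two (g : TensorField n M 2) (i j : Fin n) :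
    comp g e y ![i, j] = gform g (e.symm y) (coordVec e y i) (coordVec e y j) := by
  unfold comp
  rw [gform_apply, inn]
  congr 1
  ext l; fin_cases l <;> rfl

theorem ginvChart_eq (g : TensorField n M 2) :
    ginvChart g e y = gramInv (gform g (e.symm y)) (coordVec e y) := by
  unfold ginvChart gramInv
  simp only [comp_two]

theorem comp_contract [IsManifold (𝓡 n) ∞ M] (he : IsChart e) (hy : y ∈ e.target)
    (g : TensorField n M 2) {k : ℕ} (T : TensorField n M (k + 2)) (a : Fin k → Fin n) :
    comp (contract g T) e y a = ∑ i, ∑ j, ginvChart g e y i j *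
      comp T e y (Fin.cons i (Fin.cons j a : Fin (k + 1) → Fin n)) := by
  unfold comp
  rw [contract_apply g T _ _ (coordBasis he hy), coe_coordBasis, ginvChart_eq]
  refine Finset.sum_congr rfl fun i _ => Finset.sum_congr rfl fun j _ => ?_
  rw [← cons_comp, ← cons_comp]
  rfl

theorem comp_hodge [IsManifold (𝓡 n) ∞ M] (he : IsChart e) (hy : y ∈ e.target) {p q : ℕ}
    (g : TensorField n M 2) (ε : TensorField n M (p + q)) (T : TensorField n M p)
    (u : Fin q → Fin n) :
    comp (hodge g ε T) e y u = (1 / (p.factorial : ℝ)) *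
      ∑ a : Fin p → Fin n, ∑ c : Fin p → Fin n, (∏ i, ginvChart g e y (a i) (c i)) *
        (comp T e y c * comp ε e y (fun i => Sum.elim a u (finSumFinEquiv.symm i))) := by
  unfold comp
  rw [hodge_apply g ε T _ _ (coordBasis he hy), coe_coordBasis, ginvChart_eq, pairing]
  congr 1
  refine Finset.sum_congr rfl fun a _ => Finset.sum_congr rfl fun c _ => ?_
  rw [frontMap_apply]
  congr 3
  ext i
  rw [elim_comp]

theorem eq_zero_of_comp [IsManifold (𝓡 n) ∞ M] (he : IsChart e) (hy : y ∈ e.target) {k : ℕ}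
    (T : TensorField n M k) (h : ∀ a, comp T e y a = 0) : T (e.symm y) = 0 := by
  refine Module.Basis.ext_multilinear (fun _ => coordBasis he hy) fun a => ?_
  simp only [coe_coordBasis]
  exact h a

/-! ### Smoothness -/

theorem contDiffOn_det {E : Type*} [NormedAddCommGroup E] [NormedSpace ℝ E] {s : Set E}
    {A : E → Matrix (Fin n) (Fin n) ℝ} (h : ∀ i j, ContDiffOn ℝ ∞ (fun z => A z i j) s) :
    ContDiffOn ℝ ∞ (fun z => (A z).det) s := by
  simp only [Matrix.det_apply]
  exact ContDiffOn.sum fun σ _ => (contDiffOn_prod fun i _ => h _ _).const_smul _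

/-- Cramer's rule expresses the entries of the inverse as quotients of determinants. -/
theorem contDiffOn_inv {E : Type*} [NormedAddCommGroup E] [NormedSpace ℝ E] {s : Set E}
    {A : E → Matrix (Fin n) (Fin n) ℝ} (h : ∀ i j, ContDiffOn ℝ ∞ (fun z => A z i j) s)
    (hdet : ∀ z ∈ s, (A z).det ≠ 0) (i j : Fin n) : ContDiffOn ℝ ∞ (fun z => (A z)⁻¹ i j) s := by
  have h1 : ∀ z, (A z)⁻¹ i j = ((A z).det)⁻¹ * ((A z).updateRow j (Pi.single i 1)).det := by
    intro z
    rw [Matrix.inv_def, Matrix.smul_apply, Matrix.adjugate_apply, Ring.inverse_eq_inv', smul_eq_mul]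
  simp only [h1]
  refine ((contDiffOn_det h).inv hdet).mul (contDiffOn_det fun a c => ?_)
  by_cases ha : a = j
  · subst ha
    simp only [Matrix.updateRow_self]
    exact contDiffOn_const
  · simp only [Matrix.updateRow_ne ha]
    exact h a c

variable [IsManifold (𝓡 n) ∞ M] {g : TensorField n M 2}

theorem det_comp_ne_zero (hg : IsLorentzianMetric g) (he : IsChart e) (hy : y ∈ e.target) :
    (Matrix.of fun a b => comp g e y ![a, b]).det ≠ 0 := by
  obtain ⟨b, t, hb, _⟩ := hg.exists_frame (e.symm y)
  have := hb.det_gram_ne_zero (coordBasis he hy)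
  simp only [coe_coordBasis] at this
  simpa only [comp_two] using this

theorem contDiffOn_ginvChart (hg : IsLorentzianMetric g) (he : IsChart e) (i j : Fin n) :
    ContDiffOn ℝ ∞ (fun z => ginvChart g e z i j) e.target :=
  contDiffOn_inv (fun a b => hg.smooth e he ![a, b]) (fun _ hz => det_comp_ne_zero hg he hz) i j

theorem contDiffOn_pderiv {f : EuclideanSpace ℝ (Fin n) → ℝ} {s : Set (EuclideanSpace ℝ (Fin n))}
    (hs : IsOpen s) (hf : ContDiffOn ℝ ∞ f s) (i : Fin n) :
    ContDiffOn ℝ ∞ (fun z => pderiv f z i) s :=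
  (hf.fderiv_of_isOpen hs (by simp)).clm_apply contDiffOn_const

theorem contDiffOn_christoffel (hg : IsLorentzianMetric g) (he : IsChart e) (c a b : Fin n) :
    ContDiffOn ℝ ∞ (fun z => christoffel g e z c a b) e.target := by
  unfold christoffel
  refine contDiffOn_const.mul (ContDiffOn.sum fun d _ => (contDiffOn_ginvChart hg he c d).mul ?_)
  exact ((contDiffOn_pderiv e.open_target (hg.smooth e he _) _).add
    (contDiffOn_pderiv e.open_target (hg.smooth e he _) _)).sub
    (contDiffOn_pderiv e.open_target (hg.smooth e he _) _)

theorem IsCovDeriv.isSmooth (hg : IsLorentzianMetric g) {k : ℕ} {T : TensorField n M k}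
    {T' : TensorField n M (k + 1)} (h : IsCovDeriv g T T') (hT : IsSmooth T) : IsSmooth T' := by
  intro e he a
  have h1 : ContDiffOn ℝ ∞ (fun z => covDerivComp g T e z (a 0) (Fin.tail a)) e.target := by
    unfold covDerivComp
    refine (contDiffOn_pderiv e.open_target (hT e he _) _).sub ?_
    exact ContDiffOn.sum fun j _ => ContDiffOn.sum fun c _ =>
      (contDiffOn_christoffel hg he _ _ _).mul (hT e he _)
  refine h1.congr fun z hz => ?_
  rw [← h e he z hz, Fin.cons_self_tail]

theorem IsIterCovDeriv.isSmooth (hg : IsLorentzianMetric g) {p : ℕ} {F : TensorField n M p}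
    (hF : IsSmooth F) {j : ℕ} {T : TensorField n M (p + j)} (h : IsIterCovDeriv g F j T) :
    IsSmooth T := by
  induction h with
  | zero => exact hF
  | succ _ h2 ih => exact h2.isSmooth hg ih

theorem isSmooth_contract (hg : IsLorentzianMetric g) {k : ℕ} {T : TensorField n M (k + 2)}
    (hT : IsSmooth T) : IsSmooth (contract g T) := by
  intro e he a
  refine ContDiffOn.congr ?_ fun z hz => comp_contract he hz g T a
  exact ContDiffOn.sum fun i _ => ContDiffOn.sum fun j _ =>
    (contDiffOn_ginvChart hg he i j).mul (hT e he _)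

theorem isSmooth_hodge (hg : IsLorentzianMetric g) {p q : ℕ} {ε : TensorField n M (p + q)}
    (hε : IsSmooth ε) {T : TensorField n M p} (hT : IsSmooth T) : IsSmooth (hodge g ε T) := by
  intro e he a
  refine ContDiffOn.congr ?_ fun z hz => comp_hodge he hz g ε T a
  exact contDiffOn_const.mul (ContDiffOn.sum fun i _ => ContDiffOn.sum fun j _ =>
    (contDiffOn_prod fun l _ => contDiffOn_ginvChart hg he _ _).mul ((hT e he _).mul (hε e he _)))

end Contractions

/-! ### Alternating fields, gradients and the Hodge dual in a frame -/

section Forms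

variable {n : ℕ} {M : Type*} [TopologicalSpace M] [ChartedSpace (EuclideanSpace ℝ (Fin n)) M]

/-- The value at `x` of a totally antisymmetric tensor field. -/
def IsAlternating.alt {k : ℕ} {T : TensorField n M k} (h : IsAlternating T) (x : M) :
    TangentSpace (𝓡 n) x [⋀^Fin k]→ₗ[ℝ] ℝ :=
  { T x with map_eq_zero_of_eq' := fun v i j hv hne => h x v i j hne hv }

theorem IsAlternating.alt_apply {k : ℕ} {T : TensorField n M k} (h : IsAlternating T) (x : M)
    (v : Fin k → TangentSpace (𝓡 n) x) : h.alt x v = T x v := rfl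

theorem isAlternating_hodge {p q : ℕ} (g : TensorField n M 2) {ε : TensorField n M (p + q)}
    (hε : IsAlternating ε) (T : TensorField n M p) : IsAlternating (hodge g ε T) := by
  intro x v i j hne hv
  rw [hodge_apply g ε T x v (stdBasis x), pairing]
  refine mul_eq_zero_of_right _ (Finset.sum_eq_zero fun a _ => Finset.sum_eq_zero fun c _ => ?_)
  rw [frontMap_apply, hε x _ (finSumFinEquiv (Sum.inr i)) (finSumFinEquiv (Sum.inr j))]
  · ring
  · simpa using hne
  · simpa using hv

theorem gform_sharp {g : TensorField n M 2} (hg : IsLorentzianMetric g) (x : M)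
    (α : TangentSpace (𝓡 n) x →L[ℝ] ℝ) (w : TangentSpace (𝓡 n) x) :
    gform g x (sharp g x α) w = α w := by
  obtain ⟨b, t, hb, _⟩ := hg.exists_frame x
  have h1 := hb.contraction_eq ((α.toLinearMap).smulRight ((gform g x).flip w)) (stdBasis x)
  have h2 := hb.map_eq_sum α.toLinearMap w
  unfold sharp
  simp only [map_sum, map_smul, LinearMap.sum_apply, LinearMap.smul_apply, smul_eq_mul]
  rw [← ginv_eq, coe_stdBasis] at h1
  refine Eq.trans (Finset.sum_congr rfl fun a _ => Finset.sum_congr rfl fun c _ => ?_)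
    (h1.trans (Eq.trans (Finset.sum_congr rfl fun i _ => ?_) h2.symm))
  · simp only [LinearMap.smulRight_apply, LinearMap.smul_apply, LinearMap.flip_apply, smul_eq_mul]
    exact mul_assoc _ _ _
  · simp only [LinearMap.smulRight_apply, LinearMap.smul_apply, LinearMap.flip_apply, smul_eq_mul]
    rw [hb.symm (b i) w]; ring

theorem isNullAligned_of {r : ℕ} {g : TensorField n M 2} {x : M} {k : TangentSpace (𝓡 n) x}
    {T : TensorField n M (r + 1)} (hT : IsAlternating T) (hk : IsNullVector g x k)
    (h1 : ∀ u, T x (Fin.cons k u) = 0) (h2 : wedge (gform g x k) (hT.alt x) = 0) :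
    IsNullAligned g x k T := by
  refine ⟨hk, ?_, fun v => ?_⟩
  · rintro v ⟨j, hj⟩
    have h6 := AlternatingMap.map_insertNth (hT.alt x) j (v j) (fun l => v (j.succAbove l))
    rw [show j.insertNth (v j) (fun l => v (j.succAbove l)) = v from Fin.insertNth_self_removeNth j v]
      at h6
    have h7 : hT.alt x (Matrix.vecCons k fun l => v (j.succAbove l)) = 0 := h1 _
    rw [hj, h7, smul_zero] at h6
    exact h6
  · have := congrArg (fun f => f v) h2
    simp only [wedge_apply, AlternatingMap.zero_apply] at this
    exact this

theorem isNullAligned_of_eq {k : ℕ} {g : TensorField n M 2} {x : M} {l : TangentSpace (𝓡 n) x}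
    {S T : TensorField n M k} (h : IsNullAligned g x l S) (hST : T x = S x) :
    IsNullAligned g x l T := by
  unfold IsNullAligned
  rw [hST]
  exact h

/-- The differential of a function in a chart. -/
theorem diff_coordVec [IsManifold (𝓡 n) ∞ M]
    {e : OpenPartialHomeomorph M (EuclideanSpace ℝ (Fin n))}
    {y : EuclideanSpace ℝ (Fin n)} (he : IsChart e) (hy : y ∈ e.target) {I : M → ℝ}
    (hI : DifferentiableAt ℝ (fun z => I (e.symm z)) y) (i : Fin n) :
    diff (n := n) I (e.symm y) (coordVec e y i) = pderiv (fun z => I (e.symm z)) y i := by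
  have hx : e.symm y ∈ e.source := e.map_target hy
  have hI' : MDifferentiableAt (𝓡 n) 𝓘(ℝ, ℝ) I (e.symm y) := by
    have h1 : MDifferentiableAt (𝓡 n) 𝓘(ℝ, ℝ) ((fun z => I (e.symm z)) ∘ e) (e.symm y) := by
      refine MDifferentiableAt.comp (I' := 𝓡 n) (e.symm y) ?_ (he.mdifferentiable.mdifferentiableAt hx)
      rw [e.right_inv hy]
      exact hI.mdifferentiableAt
    refine h1.congr_of_eventuallyEq ?_
    filter_upwards [e.open_source.mem_nhds hx] with z hz
    simp [e.left_inv hz]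
  have h2 := mfderiv_comp y hI' (he.mdifferentiable.mdifferentiableAt_symm hy)
  unfold diff coordVec pderiv
  rw [← mfderiv_eq_fderiv]
  exact (congrArg (fun f => f (EuclideanSpace.single i (1 : ℝ))) h2).symm

/-- Permuting the vectors of an orthonormal frame only changes the sign of the volume form. -/
theorem IsVolumeForm.apply_ne_zero {p q : ℕ} {M : Type*} [TopologicalSpace M]
    [ChartedSpace (EuclideanSpace ℝ (Fin (p + q))) M] {g : TensorField (p + q) M 2}
    {ε : TensorField (p + q) M (p + q)} (hε : IsVolumeForm g ε) {x : M}
    {b : Module.Basis (Fin (p + q)) ℝ (TangentSpace (𝓡 (p + q)) x)}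
    (hb : IsOrthonormalFrame g x b) {f : Fin p ⊕ Fin q → Fin (p + q)} (hf : Function.Bijective f) :
    ((hε.alternating.alt x).domDomCongr finSumFinEquiv.symm) (fun s => b (f s)) ≠ 0 := by
  have h1 := (hε.alternating.alt x).map_perm b
    (finSumFinEquiv.symm.trans (Equiv.ofBijective f hf))
  have h2 : hε.alternating.alt x b ≠ 0 := by
    intro h
    have := hε.unit x b hb
    rw [← hε.alternating.alt_apply, h] at this
    simp at this
  intro h3
  apply h2
  have h4 : hε.alternating.alt x (⇑b ∘ ⇑(finSumFinEquiv.symm.trans (Equiv.ofBijective f hf))) = 0 := h3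
  rw [h4] at h1
  exact (smul_eq_zero_iff_eq _).1 h1.symm

theorem hodge_frame {p q : ℕ} {M : Type*} [TopologicalSpace M]
    [ChartedSpace (EuclideanSpace ℝ (Fin (p + q))) M] {g : TensorField (p + q) M 2}
    {ε : TensorField (p + q) M (p + q)} (hε : IsAlternating ε) {T : TensorField (p + q) M p}
    (hT : IsAlternating T) {x : M} {b : Module.Basis (Fin (p + q)) ℝ (TangentSpace (𝓡 (p + q)) x)}
    {t : Fin (p + q)} (hb : IsFrame (gform g x) b t) (u : Fin q → TangentSpace (𝓡 (p + q)) x) :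
    hodge g ε T x u = (1 / (p.factorial : ℝ)) *
      weightedStar (frameSign t) b ((hε.alt x).domDomCongr finSumFinEquiv.symm) (hT.alt x) u := by
  rw [hodge_apply g ε T x u b, hb.pairing_self]
  rfl

end Forms

/-! ### Locality and closure properties of the forms built from `F`, and the first consequence of
universality -/

section Universal

variable {p q : ℕ} {M : Type*} [TopologicalSpace M]
  [ChartedSpace (EuclideanSpace ℝ (Fin (p + q))) M] {g : TensorField (p + q) M 2}
  {ε : TensorField (p + q) M (p + q)} {F : TensorField (p + q) M p} {K : ℕ∞}

theorem IsPolynomialIn.isSmooth [IsManifold (𝓡 (p + q)) ∞ M] (hg : IsLorentzianMetric g)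
    (hε : IsVolumeForm g ε) (hF : IsSmooth F) {k : ℕ} {T : TensorField (p + q) M k}
    (h : IsPolynomialIn g ε F K T) : IsSmooth T := by
  induction h with
  | base _ h => exact h.isSmooth hg hF
  | add _ _ h1 h2 => exact fun e he a => (h1 e he a).add (h2 e he a)
  | smul c _ h => exact fun e he a => contDiffOn_const.mul (h e he a)
  | prod _ _ h1 h2 => exact isSmooth_tensorProd h1 h2
  | prodMetric _ h => exact isSmooth_tensorProd hg.smooth h
  | prodVolume _ h => exact isSmooth_tensorProd hε.smooth h
  | reindex σ _ h => exact fun e he a => h e he fun i => a (σ i)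
  | contract _ h => exact isSmooth_contract hg h
  | dual _ h => exact isSmooth_hodge hg hε.smooth h

theorem IsCovDeriv.eq_zero_of_isOpen {n : ℕ} {M : Type*} [TopologicalSpace M]
    [ChartedSpace (EuclideanSpace ℝ (Fin n)) M] [IsManifold (𝓡 n) ∞ M] {g : TensorField n M 2}
    {k : ℕ} {T : TensorField n M k} {T' : TensorField n M (k + 1)} (h : IsCovDeriv g T T')
    {U : Set M} (hU : IsOpen U) (hT : ∀ x ∈ U, T x = 0) : ∀ x ∈ U, T' x = 0 := by
  intro x hx
  obtain ⟨e, he, y, hy, rfl⟩ := exists_chart_point (n := n) x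
  refine eq_zero_of_comp he hy T' fun a => ?_
  rw [← Fin.cons_self_tail a, h e he y hy]
  have hev : ∀ a, (fun z => comp T e z a) =ᶠ[nhds y] fun _ => 0 := by
    intro a
    have h1 := (e.continuousAt_symm hy).preimage_mem_nhds (hU.mem_nhds hx)
    filter_upwards [h1] with z hz
    unfold comp
    rw [hT _ hz]; rfl
  unfold covDerivComp pderiv
  rw [(hev _).fderiv_eq]
  have h2 : ∀ a, comp T e y a = 0 := fun a => (hev a).eq_of_nhds
  simp [h2]

/-- Every monomial contains a derivative of `F`, since there is no rule that produces constants.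
Openness is needed for the derivatives to vanish along with `F`. -/
theorem IsPolynomialIn.eq_zero_of_isOpen [IsManifold (𝓡 (p + q)) ∞ M] {k : ℕ}
    {T : TensorField (p + q) M k} (h : IsPolynomialIn g ε F K T) {U : Set M} (hU : IsOpen U)
    (hF : ∀ x ∈ U, F x = 0) : ∀ x ∈ U, T x = 0 := by
  induction h with
  | base _ h =>
    clear * - h hU hF
    induction h with
    | zero => exact hF
    | succ _ h2 ih => exact h2.eq_zero_of_isOpen hU ih
  | add _ _ h1 h2 => intro x hx; rw [Pi.add_apply, h1 x hx, h2 x hx, add_zero]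
  | smul c _ h => intro x hx; rw [Pi.smul_apply, h x hx, smul_zero]
  | prod _ _ h1 h2 => intro x hx; ext v; rw [tensorProd_apply, h1 x hx]; simp
  | prodMetric _ h => intro x hx; ext v; rw [tensorProd_apply, h x hx]; simp
  | prodVolume _ h => intro x hx; ext v; rw [tensorProd_apply, h x hx]; simp
  | reindex σ _ h => intro x hx; unfold UnivForm.reindex; rw [h x hx]; rfl
  | contract _ h =>
    intro x hx; ext v
    rw [contract_apply _ _ _ _ (stdBasis x), h x hx]
    exact Finset.sum_eq_zero fun i _ => Finset.sum_eq_zero fun j _ => mul_eq_zero_of_right _ rfl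
  | dual _ h =>
    intro x hx; ext v
    rw [hodge_apply _ _ _ _ _ (stdBasis x), h x hx]
    simp [pairing]

theorem IsScalarInvariant.contDiffOn [IsManifold (𝓡 (p + q)) ∞ M] (hg : IsLorentzianMetric g)
    (hε : IsVolumeForm g ε) (hF : IsSmooth F) {I : M → ℝ} (h : IsScalarInvariant g ε F K I)
    {e : OpenPartialHomeomorph M (EuclideanSpace ℝ (Fin (p + q)))} (he : IsChart e) :
    ContDiffOn ℝ ∞ (fun z => I (e.symm z)) e.target := by
  obtain ⟨T, hT, hI⟩ := h
  refine (hT.isSmooth hg hε hF e he (fun i => i.elim0)).congr fun z _ => ?_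
  rw [hI, comp]
  congr 1
  ext i; exact i.elim0

theorem isCoefficient_const (c : ℝ) : IsCoefficient g ε F K (fun _ => c) :=
  ⟨0, fun i => i.elim0, Set.univ, fun _ => c, fun i => i.elim0, isOpen_univ, contDiffOn_const,
    fun _ => ⟨Set.mem_univ _, rfl⟩⟩

theorem IsScalarInvariant.mul_isCoefficient {I c : M → ℝ} (hI : IsScalarInvariant g ε F K I)
    (hc : IsCoefficient g ε F K c) : IsCoefficient g ε F K (fun x => I x * c x) := by
  obtain ⟨r, J, O, φ, hJ, hO, hφ, h⟩ := hc
  have htail : ContDiff ℝ ∞ (fun v : Fin (r + 1) → ℝ => fun i : Fin r => v i.succ) :=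
    contDiff_pi.2 fun i => contDiff_apply ℝ ℝ i.succ
  -- The invariant `I` becomes a new first variable, and the new coefficient function is `v₀ φ(v₁,
  -- …, v_r)`.
  refine ⟨r + 1, Fin.cons I J, (fun v i => v (Fin.succ i)) ⁻¹' O, fun v => v 0 * φ fun i => v i.succ,
    fun i => ?_, hO.preimage htail.continuous, ?_, fun x => ?_⟩
  · refine Fin.cases ?_ (fun i => ?_) i
    · exact hI
    · exact hJ i
  · exact (contDiff_apply ℝ ℝ (0 : Fin (r + 1))).contDiffOn.mul
      (hφ.comp htail.contDiffOn fun v hv => hv)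
  · refine ⟨(h x).1, ?_⟩
    simp [(h x).2]

theorem IsCoefficient.contDiffOn [IsManifold (𝓡 (p + q)) ∞ M] (hg : IsLorentzianMetric g)
    (hε : IsVolumeForm g ε) (hF : IsSmooth F) {c : M → ℝ} (h : IsCoefficient g ε F K c)
    {e : OpenPartialHomeomorph M (EuclideanSpace ℝ (Fin (p + q)))} (he : IsChart e) :
    ContDiffOn ℝ ∞ (fun z => c (e.symm z)) e.target := by
  obtain ⟨r, J, O, φ, hJ, hO, hφ, h⟩ := h
  refine (hφ.comp (contDiffOn_pi.2 fun i => (hJ i).contDiffOn hg hε hF he)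
    fun z _ => (h (e.symm z)).1).congr fun z _ => ?_
  exact (h (e.symm z)).2

theorem IsBuiltForm.isSmooth [IsManifold (𝓡 (p + q)) ∞ M] (hg : IsLorentzianMetric g)
    (hε : IsVolumeForm g ε) (hF : IsSmooth F) {T : TensorField (p + q) M p}
    (h : IsBuiltForm g ε F K T) : IsSmooth T := by
  obtain ⟨_, m, c, P, hc, hP, hT⟩ := h
  intro e he a
  refine ContDiffOn.congr (f := fun z => ∑ i, c i (e.symm z) * comp (P i) e z a) ?_ fun z _ => ?_
  · exact ContDiffOn.sum fun i _ => ((hc i).contDiffOn hg hε hF he).mul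
      ((hP i).isSmooth hg hε hF e he a)
  · simp [comp, hT]

theorem IsPolynomialIn.isBuiltForm {T : TensorField (p + q) M p} (h : IsPolynomialIn g ε F K T)
    (hT : IsAlternating T) : IsBuiltForm g ε F K T :=
  ⟨hT, 1, fun _ _ => 1, fun _ => T, fun _ => isCoefficient_const 1, fun _ => h, fun x => by simp⟩

theorem isBuiltForm_self (hFalt : IsAlternating F) : IsBuiltForm g ε F K F :=
  (IsPolynomialIn.base (j := 0) (by simp) IsIterCovDeriv.zero : IsPolynomialIn g ε F K F).isBuiltForm
    hFalt

/-- Smooth functions of invariants are allowed as coefficients, so built forms are stable under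
multiplication by invariants. Comparing `T` with `I T` is what extracts information on `dI` from
universality. -/
theorem IsBuiltForm.smul {T : TensorField (p + q) M p} (h : IsBuiltForm g ε F K T) {I : M → ℝ}
    (hI : IsScalarInvariant g ε F K I) : IsBuiltForm g ε F K (fun x => I x • T x) := by
  obtain ⟨h0, m, c, P, hc, hP, hT⟩ := h
  refine ⟨fun x v i j hne hv => ?_, m, fun i x => I x * c i x, P,
    fun i => hI.mul_isCoefficient (hc i), hP, fun x => ?_⟩
  · rw [smul_apply, h0 x v i j hne hv, smul_zero]
  · change I x • T x = ∑ i, (I x * c i x) • P i x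
    rw [hT, Finset.smul_sum]
    exact Finset.sum_congr rfl fun i _ => by rw [mul_smul]

theorem hodge_smul (c : M → ℝ) (T : TensorField (p + q) M p) (x : M) :
    hodge g ε (fun x => c x • T x) x = c x • hodge g ε T x := by
  ext v
  rw [smul_apply, hodge_apply _ _ _ _ _ (stdBasis x),
    hodge_apply _ _ _ _ _ (stdBasis x)]
  simp only [pairing, smul_apply, smul_eq_mul, Finset.mul_sum]
  exact Finset.sum_congr rfl fun _ _ => Finset.sum_congr rfl fun _ _ => by ring

theorem hodge_sum {m : ℕ} (c : Fin m → ℝ) (P : Fin m → TensorField (p + q) M p)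
    (T : TensorField (p + q) M p) (x : M) (h : T x = ∑ i, c i • P i x) :
    hodge g ε T x = ∑ i, c i • hodge g ε (P i) x := by
  ext v
  rw [hodge_apply _ _ _ _ _ (stdBasis x), h]
  simp only [sum_apply, smul_apply, smul_eq_mul,
    hodge_apply _ _ _ _ _ (stdBasis x), pairing, Finset.mul_sum, Finset.sum_mul]
  rw [Finset.sum_congr rfl fun a _ => Finset.sum_comm, Finset.sum_comm]
  exact Finset.sum_congr rfl fun _ _ => Finset.sum_congr rfl fun _ _ =>
    Finset.sum_congr rfl fun _ _ => by ring

/-- In dimension `2p` the dual of a `p`-form is a `p`-form, and the dual passes through the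
coefficients to the polynomial tensors. -/
theorem IsBuiltForm.hodge {M : Type*} [TopologicalSpace M]
    [ChartedSpace (EuclideanSpace ℝ (Fin (p + p))) M] {g : TensorField (p + p) M 2}
    {ε : TensorField (p + p) M (p + p)} {F : TensorField (p + p) M p} (hε : IsAlternating ε)
    {T : TensorField (p + p) M p} (h : IsBuiltForm g ε F K T) :
    IsBuiltForm g ε F K (hodge g ε T) := by
  obtain ⟨_, m, c, P, hc, hP, hT⟩ := h
  exact ⟨isAlternating_hodge g hε T, m, c, fun i => UnivForm.hodge g ε (P i), hc,
    fun i => (hP i).dual, fun x => hodge_sum (fun i => c i x) P T x (hT x)⟩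

theorem pderiv_mul {n : ℕ} {f h : EuclideanSpace ℝ (Fin n) → ℝ} {y : EuclideanSpace ℝ (Fin n)}
    (hf : DifferentiableAt ℝ f y) (hh : DifferentiableAt ℝ h y) (i : Fin n) :
    pderiv (fun z => f z * h z) y i = pderiv f y i * h y + f y * pderiv h y i := by
  unfold pderiv
  rw [fderiv_fun_mul hf hh]
  simp
  ring

/-- `dI ∧ *T = 0` for all invariants `I` and all built forms `T`. -/
theorem IsUniversal.wedge_diff_hodge [IsManifold (𝓡 (p + q)) ∞ M] (hg : IsLorentzianMetric g)
    (hε : IsVolumeForm g ε) (hFs : IsSmooth F) (hF : IsUniversal g ε F K) {I : M → ℝ}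
    (hI : IsScalarInvariant g ε F K I) {T : TensorField (p + q) M p} (hT : IsBuiltForm g ε F K T)
    (x : M) : wedge (diff (n := p + q) I x).toLinearMap
      ((isAlternating_hodge g hε.alternating T).alt x) = 0 := by
  obtain ⟨e, he, y, hy, rfl⟩ := exists_chart_point (n := p + q) x
  refine Module.Basis.ext_alternating (coordBasis he hy) fun a _ => ?_
  rw [wedge_apply, coe_coordBasis, AlternatingMap.zero_apply]
  have hIy : DifferentiableAt ℝ (fun z => I (e.symm z)) y :=
    ((hI.contDiffOn hg hε hFs he).contDiffAt (e.open_target.mem_nhds hy)).differentiableAt (by simp)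
  have hTy : ∀ c, DifferentiableAt ℝ (fun z => comp (hodge g ε T) e z c) y := fun c =>
    ((isSmooth_hodge hg hε.smooth (hT.isSmooth hg hε hFs) e he c).contDiffAt
      (e.open_target.mem_nhds hy)).differentiableAt (by simp)
  have h1 := hF.2 _ hT e he y hy a
  have h2 := hF.2 _ (hT.smul hI) e he y hy a
  have h3 : ∀ z c, comp (hodge g ε fun x => I x • T x) e z c
      = I (e.symm z) * comp (hodge g ε T) e z c := by
    intro z c
    unfold comp
    rw [hodge_smul]; rfl
  simp only [h3, pderiv_mul hIy (hTy _)] at h2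
  -- The Leibniz rule: subtracting `I d*T = 0` from `d(I *T) = 0` leaves `dI ∧ *T`.
  have h4 : ∑ j : Fin (q + 1), (-1 : ℝ) ^ (j : ℕ) * pderiv (fun z => I (e.symm z)) y (a j) *
      comp (hodge g ε T) e y (fun i => a (j.succAbove i)) = 0 := by
    have h5 := congrArg (fun s => I (e.symm y) * s) h1
    simp only [mul_zero, Finset.mul_sum] at h5
    rw [← h2, ← sub_eq_zero, ← neg_eq_zero, ← h5, neg_sub, ← Finset.sum_sub_distrib]
    exact Finset.sum_congr rfl fun j _ => by ring
  rw [← h4]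
  refine Finset.sum_congr rfl fun j _ => ?_
  rw [← diff_coordVec he hy hIy (a j)]
  rfl

end Universal

/-! ### Differentials of functions and their scalar products in charts -/

section Chart

variable {n : ℕ} {M : Type*} [TopologicalSpace M] [ChartedSpace (EuclideanSpace ℝ (Fin n)) M]
  {g : TensorField n M 2}

theorem diff_eq_zero_of_isOpen {I : M → ℝ} {U : Set M} (hU : IsOpen U) (hI : ∀ x ∈ U, I x = 0)
    {x : M} (hx : x ∈ U) : diff (n := n) I x = 0 := by
  have h1 : I =ᶠ[nhds x] fun _ => (0 : ℝ) := by
    filter_upwards [hU.mem_nhds hx] with z hz using hI z hz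
  unfold diff
  rw [h1.mfderiv_eq]
  exact mfderiv_const

/-- The pointwise product `g(dI, dJ)` becomes an explicit function of the coordinates, which can be
shown continuous and can be differentiated. -/
theorem diff_sharp_chart [IsManifold (𝓡 n) ∞ M] (hg : IsLorentzianMetric g)
    {e : OpenPartialHomeomorph M (EuclideanSpace ℝ (Fin n))}
    {y : EuclideanSpace ℝ (Fin n)} (he : IsChart e) (hy : y ∈ e.target) {I J : M → ℝ}
    (hI : DifferentiableAt ℝ (fun z => I (e.symm z)) y)
    (hJ : DifferentiableAt ℝ (fun z => J (e.symm z)) y) :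
    diff (n := n) I (e.symm y) (sharp g (e.symm y) (diff J (e.symm y)))
      = ∑ a, pderiv (fun z => I (e.symm z)) y a *
        ∑ b, ginvChart g e y a b * pderiv (fun z => J (e.symm z)) y b := by
  set x := e.symm y with hx
  obtain ⟨b, t, hb, _⟩ := hg.exists_frame x
  have h2 := hb.contraction_eq
    ((diff (n := n) I x).toLinearMap.smulRight (diff (n := n) J x).toLinearMap) (coordBasis he hy)
  have h3 := hb.map_eq_sum (diff (n := n) I x).toLinearMap (sharp g x (diff J x))
  have h4 : diff (n := n) I x (sharp g x (diff J x))
      = ∑ i, frameSign t i * (diff (n := n) I x (b i) * diff (n := n) J x (b i)) := by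
    refine h3.trans (Finset.sum_congr rfl fun i _ => ?_)
    rw [gform_sharp hg]
    change _ * diff (n := n) I x (b i) = _
    ring
  rw [h4]
  refine h2.symm.trans ?_
  rw [coe_coordBasis, ← ginvChart_eq]
  refine Finset.sum_congr rfl fun a _ => ?_
  rw [Finset.mul_sum]
  refine Finset.sum_congr rfl fun c _ => ?_
  rw [← diff_coordVec he hy hI, ← diff_coordVec he hy hJ]
  change _ * (diff (n := n) I x (coordVec e y a) * diff (n := n) J x (coordVec e y c)) = _
  ring

end Chart

/-! ### Gradients of invariants are null, parallel and aligned -/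

section Null

variable {r : ℕ} {M : Type*} [TopologicalSpace M]
  [ChartedSpace (EuclideanSpace ℝ (Fin ((r + 1) + (r + 1)))) M]
  [IsManifold (𝓡 ((r + 1) + (r + 1))) ∞ M]
  {g : TensorField ((r + 1) + (r + 1)) M 2} {ε : TensorField ((r + 1) + (r + 1)) M ((r + 1) + (r + 1))}
  {F : TensorField ((r + 1) + (r + 1)) M (r + 1)} {K : ℕ∞}

/-- This is `dI ∧ *T = 0` read through Hodge duality. -/
theorem IsUniversal.interior_sharp (hg : IsLorentzianMetric g)
    (hε : IsVolumeForm g ε) (hFs : IsSmooth F) (hF : IsUniversal g ε F K) {I : M → ℝ}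
    (hI : IsScalarInvariant g ε F K I) {T : TensorField ((r + 1) + (r + 1)) M (r + 1)}
    (hT : IsBuiltForm g ε F K T) (x : M) (u : Fin r → TangentSpace (𝓡 ((r + 1) + (r + 1))) x) :
    T x (Fin.cons (sharp g x (diff I x)) u) = 0 := by
  obtain ⟨b, t, hb, hb'⟩ := hg.exists_frame x
  refine hb.interior_eq_zero rfl ((hε.alternating.alt x).domDomCongr finSumFinEquiv.symm)
    (fun f hf => hε.apply_ne_zero hb' hf) (hT.1.alt x) (sharp g x (diff I x)) (fun v => ?_) u
  have h1 := congrArg (fun f => f v) (hF.wedge_diff_hodge hg hε hFs hI hT x)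
  simp only [wedge_apply, AlternatingMap.zero_apply, IsAlternating.alt_apply,
    hodge_frame hε.alternating hT.1 hb] at h1
  have hfac : (1 / ((r + 1).factorial : ℝ)) ≠ 0 := by positivity
  refine (mul_eq_zero.1 (Eq.trans ?_ h1)).resolve_left hfac
  rw [Finset.mul_sum]
  refine Finset.sum_congr rfl fun j _ => ?_
  rw [gform_sharp hg]
  change _ = _ * diff I x (v j) * _
  ring

/-- The interior product with `*T` vanishes, since `*T` is again a built form; duality converts this
into the exterior product with `T`. -/
theorem IsUniversal.wedge_sharp (hg : IsLorentzianMetric g)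
    (hε : IsVolumeForm g ε) (hFs : IsSmooth F) (hF : IsUniversal g ε F K) {I : M → ℝ}
    (hI : IsScalarInvariant g ε F K I) {T : TensorField ((r + 1) + (r + 1)) M (r + 1)}
    (hT : IsBuiltForm g ε F K T) (x : M) :
    wedge (gform g x (sharp g x (diff I x))) (hT.1.alt x) = 0 := by
  obtain ⟨b, t, hb, hb'⟩ := hg.exists_frame x
  refine hb.wedge_eq_zero rfl ((hε.alternating.alt x).domDomCongr finSumFinEquiv.symm)
    (fun f hf => hε.apply_ne_zero hb' hf) (hT.1.alt x) (sharp g x (diff I x)) fun v => ?_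
  have h1 := hF.interior_sharp hg hε hFs hI (hT.hodge hε.alternating) x v
  rw [hodge_frame hε.alternating hT.1 hb] at h1
  have hfac : (1 / ((r + 1).factorial : ℝ)) ≠ 0 := by positivity
  exact (mul_eq_zero.1 h1).resolve_left hfac

/-- The gradients of all the invariants are null and orthogonal to each other. -/
theorem IsUniversal.diff_sharp_eq_zero (hg : IsLorentzianMetric g)
    (hε : IsVolumeForm g ε) (hFs : IsSmooth F) (hFalt : IsAlternating F)
    (hF : IsUniversal g ε F K) {I J : M → ℝ}
    (hI : IsScalarInvariant g ε F K I) (hJ : IsScalarInvariant g ε F K J) (x : M) :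
    diff I x (sharp g x (diff J x)) = 0 := by
  have hprod : ∀ x, diff I x (sharp g x (diff J x)) ≠ 0 → F x = 0 := by
    intro x hx
    ext v
    have h1 := mul_eq_zero_of_wedge_of_interior (gform g x (sharp g x (diff I x)))
      (hFalt.alt x) (hF.wedge_sharp hg hε hFs hI (isBuiltForm_self hFalt) x)
      (hF.interior_sharp hg hε hFs hJ (isBuiltForm_self hFalt) x) v
    rw [gform_sharp hg] at h1
    exact (mul_eq_zero.1 h1).resolve_left hx
  by_contra hne
  obtain ⟨e, he, y, hy, rfl⟩ := exists_chart_point (n := (r + 1) + (r + 1)) x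
  have hdiff : ∀ {I : M → ℝ}, IsScalarInvariant g ε F K I → ∀ z ∈ e.target,
      DifferentiableAt ℝ (fun z => I (e.symm z)) z := fun hI z hz =>
    ((hI.contDiffOn hg hε hFs he).contDiffAt (e.open_target.mem_nhds hz)).differentiableAt (by simp)
  let h := fun z => ∑ a, pderiv (fun z => I (e.symm z)) z a *
        ∑ b, ginvChart g e z a b * pderiv (fun z => J (e.symm z)) z b
  have hh : ∀ z ∈ e.target, diff I (e.symm z) (sharp g (e.symm z) (diff J (e.symm z))) = h z :=
    fun z hz => diff_sharp_chart hg he hz (hdiff hI z hz) (hdiff hJ z hz)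
  have hcont : ContinuousOn h e.target := by
    refine ContDiffOn.continuousOn (𝕜 := ℝ) (n := ∞) ?_
    exact ContDiffOn.sum fun a _ =>
      (contDiffOn_pderiv e.open_target (hI.contDiffOn hg hε hFs he) a).mul (ContDiffOn.sum fun b _ =>
        (contDiffOn_ginvChart hg he a b).mul
          (contDiffOn_pderiv e.open_target (hJ.contDiffOn hg hε hFs he) b))
  -- Nonvanishing of `g(dI, dJ)` persists on a neighbourhood. There `F` vanishes identically, hence
  -- so does `I`, and its differential at the given point is zero.
  have hV : IsOpen (e.target ∩ h ⁻¹' {0}ᶜ) :=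
    hcont.isOpen_inter_preimage e.open_target isOpen_compl_singleton
  have hU := e.isOpen_inter_preimage hV
  have hFU : ∀ x ∈ e.source ∩ e ⁻¹' (e.target ∩ h ⁻¹' {0}ᶜ), F x = 0 := by
    rintro x ⟨hx, hxt, hxh⟩
    apply hprod
    have h2 := hh (e x) hxt
    rw [e.left_inv hx] at h2
    rw [h2]
    exact hxh
  have hmem : e.symm y ∈ e.source ∩ e ⁻¹' (e.target ∩ h ⁻¹' {0}ᶜ) := by
    refine ⟨e.map_target hy, ?_⟩
    rw [Set.mem_preimage, e.right_inv hy]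
    refine ⟨hy, ?_⟩
    rw [hh y hy] at hne
    exact hne
  obtain ⟨T, hT, hIT⟩ := hI
  apply hne
  rw [diff_eq_zero_of_isOpen hU (I := I) (fun x hx => by
    rw [hIT, hT.eq_zero_of_isOpen hU hFU x hx]; rfl) hmem]
  rfl

theorem sharp_ne_zero {n : ℕ} {M : Type*} [TopologicalSpace M]
    [ChartedSpace (EuclideanSpace ℝ (Fin n)) M] {g : TensorField n M 2} (hg : IsLorentzianMetric g)
    {x : M} {α : TangentSpace (𝓡 n) x →L[ℝ] ℝ} (hα : α ≠ 0) : sharp g x α ≠ 0 := by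
  intro h
  apply hα
  ext v
  rw [← gform_sharp hg x α v, h]
  simp

theorem IsUniversal.isNullVector_sharp (hg : IsLorentzianMetric g)
    (hε : IsVolumeForm g ε) (hFs : IsSmooth F) (hFalt : IsAlternating F)
    (hF : IsUniversal g ε F K) {I : M → ℝ} (hI : IsScalarInvariant g ε F K I) {x : M}
    (hx : diff (n := (r + 1) + (r + 1)) I x ≠ 0) : IsNullVector g x (sharp g x (diff I x)) := by
  refine ⟨sharp_ne_zero hg hx, ?_⟩
  rw [← gform_apply, gform_sharp hg]
  exact hF.diff_sharp_eq_zero hg hε hFs hFalt hI hI x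

theorem IsUniversal.isNullAligned_sharp (hg : IsLorentzianMetric g)
    (hε : IsVolumeForm g ε) (hFs : IsSmooth F) (hFalt : IsAlternating F)
    (hF : IsUniversal g ε F K) {I : M → ℝ} (hI : IsScalarInvariant g ε F K I) {x : M}
    (hx : diff (n := (r + 1) + (r + 1)) I x ≠ 0) {T : TensorField ((r + 1) + (r + 1)) M (r + 1)}
    (hT : IsBuiltForm g ε F K T) : IsNullAligned g x (sharp g x (diff I x)) T :=
  isNullAligned_of hT.1 (hF.isNullVector_sharp hg hε hFs hFalt hI hx)
    (hF.interior_sharp hg hε hFs hI hT x) (hF.wedge_sharp hg hε hFs hI hT x)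

/-- Two null vectors orthogonal to each other are proportional in Lorentzian signature. -/
theorem IsUniversal.diff_eq_smul (hg : IsLorentzianMetric g)
    (hε : IsVolumeForm g ε) (hFs : IsSmooth F) (hFalt : IsAlternating F)
    (hF : IsUniversal g ε F K) {I J : M → ℝ} (hI : IsScalarInvariant g ε F K I)
    (hJ : IsScalarInvariant g ε F K J) {x : M} (hx : diff (n := (r + 1) + (r + 1)) I x ≠ 0) :
    ∃ c : ℝ, diff (n := (r + 1) + (r + 1)) J x = c • diff I x := by
  obtain ⟨b, t, hb, _⟩ := hg.exists_frame x
  obtain ⟨c, hc⟩ := hb.parallel_of_null (k := sharp g x (diff J x)) (l := sharp g x (diff I x))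
    (by rw [gform_sharp hg]; exact hF.diff_sharp_eq_zero hg hε hFs hFalt hJ hJ x)
    (by rw [gform_sharp hg]; exact hF.diff_sharp_eq_zero hg hε hFs hFalt hI hI x)
    (by rw [gform_sharp hg]; exact hF.diff_sharp_eq_zero hg hε hFs hFalt hJ hI x)
    (sharp_ne_zero hg hx)
  refine ⟨c, ?_⟩
  ext v
  rw [← gform_sharp hg x (diff J x) v, hc, map_smul, LinearMap.smul_apply, gform_sharp hg]
  rfl

end Null

/-! ### Gradients are twist-free, and null gradients are geodesic -/

section Geodesic

variable {n : ℕ} {M : Type*} [TopologicalSpace M] [ChartedSpace (EuclideanSpace ℝ (Fin n)) M]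
  {g : TensorField n M 2} {e : OpenPartialHomeomorph M (EuclideanSpace ℝ (Fin n))}
  {y : EuclideanSpace ℝ (Fin n)} {I : M → ℝ}

theorem christoffel_symm (hg : IsLorentzianMetric g) (c a b : Fin n) :
    christoffel g e y c a b = christoffel g e y c b a := by
  have h : ∀ z, comp g e z ![a, b] = comp g e z ![b, a] := fun z => by
    rw [comp_two, comp_two, gform_apply, gform_apply, hg.symm]
  unfold christoffel
  simp only [h]
  congr 1
  exact Finset.sum_congr rfl fun d _ => by ring

theorem pderiv_comm {f : EuclideanSpace ℝ (Fin n) → ℝ} {s : Set (EuclideanSpace ℝ (Fin n))}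
    (hs : IsOpen s) (hf : ContDiffOn ℝ ∞ f s) (hy : y ∈ s) (a b : Fin n) :
    pderiv (fun z => pderiv f z a) y b = pderiv (fun z => pderiv f z b) y a := by
  have hsymm : IsSymmSndFDerivAt ℝ f y :=
    (hf.contDiffAt (hs.mem_nhds hy)).isSymmSndFDerivAt (by
      simpa using (WithTop.coe_le_coe.2 (le_top : ((2 : ℕ) : ℕ∞) ≤ ⊤) : (2 : WithTop ℕ∞) ≤ ∞))
  have hd : DifferentiableAt ℝ (fderiv ℝ f) y :=
    ((hf.fderiv_of_isOpen hs (m := ∞) (by simp)).contDiffAt (hs.mem_nhds hy)).differentiableAt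
      (by simp)
  have h1 : ∀ a b : Fin n, pderiv (fun z => pderiv f z a) y b
      = fderiv ℝ (fderiv ℝ f) y (EuclideanSpace.single b 1) (EuclideanSpace.single a 1) := by
    intro a b
    unfold pderiv
    rw [fderiv_clm_apply hd (differentiableAt_const _)]
    simp
  rw [h1, h1]
  exact hsymm _ _

theorem comp_diffField [IsManifold (𝓡 n) ∞ M] (he : IsChart e) (hy : y ∈ e.target)
    (hI : ContDiffOn ℝ ∞ (fun z => I (e.symm z)) e.target) (c : Fin 1 → Fin n) :
    comp (diffField (n := n) I) e y c = pderiv (fun z => I (e.symm z)) y (c 0) := by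
  rw [← diff_coordVec he hy
    ((hI.contDiffAt (e.open_target.mem_nhds hy)).differentiableAt (by simp))]
  rfl

theorem covDerivComp_diffField [IsManifold (𝓡 n) ∞ M] (he : IsChart e) (hy : y ∈ e.target)
    (hI : ContDiffOn ℝ ∞ (fun z => I (e.symm z)) e.target) (a b : Fin n) :
    covDerivComp g (diffField I) e y b ![a]
      = pderiv (fun z => pderiv (fun z => I (e.symm z)) z a) y b
        - ∑ c, christoffel g e y c b a * pderiv (fun z => I (e.symm z)) y c := by
  unfold covDerivComp
  have hev : (fun z => comp (diffField (n := n) I) e z ![a])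
      =ᶠ[nhds y] fun z => pderiv (fun z => I (e.symm z)) z a := by
    filter_upwards [e.open_target.mem_nhds hy] with z hz
    exact comp_diffField he hz hI _
  congr 1
  · unfold pderiv at hev ⊢
    rw [hev.fderiv_eq]
  · rw [Fin.sum_univ_one]
    refine Finset.sum_congr rfl fun c _ => ?_
    rw [comp_diffField he hy hI]
    simp

/-- Gradients are twist-free. -/
theorem isTwistFreeAt_diffField [IsManifold (𝓡 n) ∞ M] (hg : IsLorentzianMetric g)
    (hI : ∀ e : OpenPartialHomeomorph M (EuclideanSpace ℝ (Fin n)), IsChart e →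
      ContDiffOn ℝ ∞ (fun z => I (e.symm z)) e.target) (x : M) :
    IsTwistFreeAt g (diffField I) x := by
  intro e he hx v w _ _
  refine Finset.sum_congr rfl fun a _ => Finset.sum_congr rfl fun b _ => ?_
  rw [covDerivComp_diffField he (e.map_source hx) (hI e he),
    covDerivComp_diffField he (e.map_source hx) (hI e he),
    pderiv_comm e.open_target (hI e he) (e.map_source hx) a b]
  simp only [christoffel_symm hg _ a b]

theorem pderiv_sum {ι : Type*} (s : Finset ι) {f : ι → EuclideanSpace ℝ (Fin n) → ℝ}
    (hf : ∀ i ∈ s, DifferentiableAt ℝ (f i) y) (a : Fin n) :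
    pderiv (fun z => ∑ i ∈ s, f i z) y a = ∑ i ∈ s, pderiv (f i) y a := by
  unfold pderiv
  rw [fderiv_fun_sum hf]
  simp

/-- The differential of a function with null gradient is geodesic. -/
theorem isGeodesicAt_diffField [IsManifold (𝓡 n) ∞ M] (hg : IsLorentzianMetric g)
    (hI : ∀ e : OpenPartialHomeomorph M (EuclideanSpace ℝ (Fin n)), IsChart e →
      ContDiffOn ℝ ∞ (fun z => I (e.symm z)) e.target)
    (hnull : ∀ x, diff I x (sharp g x (diff I x)) = 0) (x : M) :
    IsGeodesicAt g (diffField I) x := by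
  intro e he hx
  -- The factor is zero: `ℓ^b ∇_b ℓ_a = ℓ^b ∇_a ℓ_b = ½ ∂_a (ℓ_b ℓ^b) = 0`. The rest is this
  -- identity in coordinates, with `u` the raised gradient.
  refine ⟨0, fun a => ?_⟩
  set y := e x with hyx
  have hy : y ∈ e.target := e.map_source hx
  set f := fun z => I (e.symm z) with hf
  have hfs := hI e he
  -- the gradient with raised index
  let u : Fin n → EuclideanSpace ℝ (Fin n) → ℝ := fun b z => ∑ c, ginvChart g e z b c * pderiv f z c
  have hus : ∀ b, ContDiffOn ℝ ∞ (u b) e.target := fun b => ContDiffOn.sum fun c _ =>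
    (contDiffOn_ginvChart hg he b c).mul (contDiffOn_pderiv e.open_target hfs c)
  have hdiff : ∀ {h : EuclideanSpace ℝ (Fin n) → ℝ}, ContDiffOn ℝ ∞ h e.target →
      DifferentiableAt ℝ h y := fun hh =>
    (hh.contDiffAt (e.open_target.mem_nhds hy)).differentiableAt (by simp)
  have hud := fun b => hdiff (hus b)
  have hld := fun b => hdiff (contDiffOn_pderiv e.open_target hfs b)
  have hgd := fun b c => hdiff (hg.smooth e he ![b, c])
  have hGsymm : ∀ z b c, comp g e z ![b, c] = comp g e z ![c, b] := fun z b c => by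
    rw [comp_two, comp_two, gform_apply, gform_apply, hg.symm]
  have hQsymm : ∀ z b c, ginvChart g e z b c = ginvChart g e z c b := by
    intro z b c
    have h1 : (Matrix.of fun a b => comp g e z ![a, b]).transpose
        = Matrix.of fun a b => comp g e z ![a, b] := by
      ext i j; exact hGsymm z j i
    have h2 := Matrix.transpose_nonsing_inv (Matrix.of fun a b => comp g e z ![a, b])
    rw [h1] at h2
    exact (congrFun (congrFun h2 b) c).symm
  -- lowering the index again
  have hlow : ∀ z ∈ e.target, ∀ b, pderiv f z b = ∑ c, comp g e z ![b, c] * u c z := by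
    intro z hz b
    have h1 := Matrix.mul_nonsing_inv (Matrix.of fun a b => comp g e z ![a, b])
      (Ne.isUnit (det_comp_ne_zero hg he hz))
    have h2 : (Matrix.of fun a b => comp g e z ![a, b]).mulVec
        ((ginvChart g e z).mulVec fun c => pderiv f z c) = fun c => pderiv f z c := by
      rw [Matrix.mulVec_mulVec]
      unfold ginvChart
      rw [h1, Matrix.one_mulVec]
    exact (congrFun h2 b).symm
  have hdl : ∀ b, pderiv (fun z => pderiv f z b) y a
      = ∑ c, (pderiv (fun z => comp g e z ![b, c]) y a * u c y
        + comp g e y ![b, c] * pderiv (u c) y a) := by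
    intro b
    have hev : (fun z => pderiv f z b) =ᶠ[nhds y] fun z => ∑ c, comp g e z ![b, c] * u c z := by
      filter_upwards [e.open_target.mem_nhds hy] with z hz using hlow z hz b
    have h1 : pderiv (fun z => pderiv f z b) y a
        = pderiv (fun z => ∑ c, comp g e z ![b, c] * u c z) y a := by
      unfold pderiv at hev ⊢
      rw [hev.fderiv_eq]
    rw [h1, pderiv_sum _ fun c _ => (hgd b c).fun_mul (hud c)]
    exact Finset.sum_congr rfl fun c _ => pderiv_mul (hgd b c) (hud c) a
  have hzero : ∑ b, (pderiv (fun z => pderiv f z b) y a * u b y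
      + pderiv f y b * pderiv (u b) y a) = 0 := by
    have hev : (fun z => ∑ b, pderiv f z b * u b z) =ᶠ[nhds y] fun _ => 0 := by
      filter_upwards [e.open_target.mem_nhds hy] with z hz
      have hfz := (hfs.contDiffAt (e.open_target.mem_nhds hz)).differentiableAt
        (by simp : (∞ : WithTop ℕ∞) ≠ 0)
      rw [← hnull (e.symm z)]
      exact (diff_sharp_chart hg he hz hfz hfz).symm
    have h1 : pderiv (fun z => ∑ b, pderiv f z b * u b z) y a = 0 := by
      unfold pderiv at hev ⊢
      rw [hev.fderiv_eq]
      simp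
    rw [pderiv_sum _ fun b _ => (hld b).fun_mul (hud b)] at h1
    rw [← h1]
    exact Finset.sum_congr rfl fun b _ => (pderiv_mul (hld b) (hud b) a).symm
  -- Eliminates the derivatives of `u`; inserted in the derivative of `ℓ_b u^b = 0`, this gives `2
  -- u^b ∂_a ℓ_b = u^b u^c ∂_a g_{bc}`.
  have hlu : ∑ b, pderiv f y b * pderiv (u b) y a
      = ∑ b, pderiv (fun z => pderiv f z b) y a * u b y
        - ∑ b, ∑ c, pderiv (fun z => comp g e z ![b, c]) y a * u b y * u c y := by
    have h1 : ∑ b, pderiv f y b * pderiv (u b) y a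
        = ∑ b, ∑ c, comp g e y ![b, c] * u b y * pderiv (u c) y a := by
      rw [Finset.sum_comm]
      refine Finset.sum_congr rfl fun b _ => ?_
      rw [hlow y hy b, Finset.sum_mul]
      exact Finset.sum_congr rfl fun c _ => by rw [hGsymm y b c]
    rw [h1, ← Finset.sum_sub_distrib]
    refine Finset.sum_congr rfl fun b _ => ?_
    rw [hdl b, Finset.sum_mul, ← Finset.sum_sub_distrib]
    exact Finset.sum_congr rfl fun c _ => by ring
  rw [Finset.sum_add_distrib, hlu] at hzero
  -- the Christoffel terms
  have hchr : ∀ b, ∑ d, christoffel g e y d b a * pderiv f y d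
      = (1 / 2) * ∑ c, u c y * (pderiv (fun z => comp g e z ![c, a]) y b
        + pderiv (fun z => comp g e z ![c, b]) y a - pderiv (fun z => comp g e z ![b, a]) y c) := by
    intro b
    unfold christoffel
    simp only [u, Finset.mul_sum, Finset.sum_mul]
    rw [Finset.sum_comm]
    refine Finset.sum_congr rfl fun c _ => Finset.sum_congr rfl fun d _ => ?_
    rw [hQsymm y d c]; ring
  -- Contracted with the symmetric `u^b u^c`, two of the three terms of the Christoffel symbol
  -- cancel, and only `½ u^b u^c ∂_a g_{bc}` remains.
  have hcancel : ∑ b, ∑ c, u b y * (u c y * pderiv (fun z => comp g e z ![c, a]) y b)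
      = ∑ b, ∑ c, u b y * (u c y * pderiv (fun z => comp g e z ![b, a]) y c) := by
    rw [Finset.sum_comm]
    exact Finset.sum_congr rfl fun b _ => Finset.sum_congr rfl fun c _ => by ring
  have hmain : ∑ b, u b y * covDerivComp g (diffField I) e y b ![a] = 0 := by
    have h1 : ∀ b, u b y * covDerivComp g (diffField I) e y b ![a]
        = pderiv (fun z => pderiv f z b) y a * u b y
          - (1 / 2) * ((∑ c, u b y * (u c y * pderiv (fun z => comp g e z ![c, a]) y b)
            - ∑ c, u b y * (u c y * pderiv (fun z => comp g e z ![b, a]) y c))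
            + ∑ c, pderiv (fun z => comp g e z ![b, c]) y a * u b y * u c y) := by
      intro b
      rw [covDerivComp_diffField he hy hfs, hchr, pderiv_comm e.open_target hfs hy a b,
        ← Finset.sum_sub_distrib, ← Finset.sum_add_distrib, mul_sub, mul_comm (u b y)]
      congr 1
      rw [mul_left_comm, Finset.mul_sum]
      congr 1
      refine Finset.sum_congr rfl fun c _ => ?_
      simp only [hGsymm _ b c]
      ring
    rw [Finset.sum_congr rfl fun b _ => h1 b, Finset.sum_sub_distrib, ← Finset.mul_sum,
      Finset.sum_add_distrib, Finset.sum_sub_distrib, hcancel]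
    linarith
  rw [zero_mul, ← hmain]
  refine Finset.sum_congr rfl fun b _ => ?_
  rw [Finset.sum_mul]
  refine Finset.sum_congr rfl fun c _ => ?_
  rw [comp_diffField he hy hfs]
  rfl

end Geodesic

/-! ### Functions with vanishing differential -/

section Constant

variable {n : ℕ} {M : Type*} [TopologicalSpace M] [ChartedSpace (EuclideanSpace ℝ (Fin n)) M]

/-- In a coordinate ball the derivative vanishes, so the function is locally constant, and
connectedness does the rest. -/
theorem exists_eq_const_of_diff_eq_zero [IsManifold (𝓡 n) ∞ M] [ConnectedSpace M] {I : M → ℝ}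
    (hI : ∀ e : OpenPartialHomeomorph M (EuclideanSpace ℝ (Fin n)), IsChart e →
      ContDiffOn ℝ ∞ (fun z => I (e.symm z)) e.target)
    (h : ∀ x, diff (n := n) I x = 0) (x₀ x : M) : I x = I x₀ := by
  have hloc : IsLocallyConstant I := by
    rw [IsLocallyConstant.iff_exists_open]
    intro x
    obtain ⟨e, he, y, hy, rfl⟩ := exists_chart_point (n := n) x
    obtain ⟨ρ, hρ, hball⟩ := Metric.isOpen_iff.1 e.open_target y hy
    have hd : ∀ z ∈ e.target, DifferentiableAt ℝ (fun z => I (e.symm z)) z := fun z hz =>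
      ((hI e he).contDiffAt (e.open_target.mem_nhds hz)).differentiableAt (by simp)
    have hzero : ∀ z ∈ e.target, fderiv ℝ (fun z => I (e.symm z)) z = 0 := by
      intro z hz
      apply ContinuousLinearMap.coe_injective
      refine (EuclideanSpace.basisFun (Fin n) ℝ).toBasis.ext fun i => ?_
      have h1 := diff_coordVec he hz (hd z hz) i
      rw [h] at h1
      rw [OrthonormalBasis.coe_toBasis, EuclideanSpace.basisFun_apply]
      exact h1.symm
    refine ⟨e.source ∩ e ⁻¹' Metric.ball y ρ, e.isOpen_inter_preimage Metric.isOpen_ball,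
      ⟨e.map_target hy, ?_⟩, ?_⟩
    · rw [Set.mem_preimage, e.right_inv hy]; exact Metric.mem_ball_self hρ
    · rintro x' ⟨hx', hxb⟩
      have h2 := Metric.isOpen_ball.is_const_of_fderiv_eq_zero (𝕜 := ℝ)
        (convex_ball y ρ).isPreconnected (fun z hz => (hd z (hball hz)).differentiableWithinAt)
        (fun z hz => hzero z (hball hz)) hxb (Metric.mem_ball_self hρ)
      rw [← e.left_inv hx']
      exact h2
  exact hloc.apply_eq_of_preconnectedSpace x x₀

/-- The hypothesis says `I dI = 0`, so `I²` has zero differential and is constant, with value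
`I(x₀)² = 0`. -/
theorem eq_zero_of_mul_diff_eq_zero [IsManifold (𝓡 n) ∞ M] [ConnectedSpace M] {I : M → ℝ}
    (hI : ∀ e : OpenPartialHomeomorph M (EuclideanSpace ℝ (Fin n)), IsChart e →
      ContDiffOn ℝ ∞ (fun z => I (e.symm z)) e.target)
    (h : ∀ x, diff (n := n) I x ≠ 0 → I x = 0) {x₀ : M} (hx₀ : I x₀ = 0) (x : M) : I x = 0 := by
  have hsq : ∀ e : OpenPartialHomeomorph M (EuclideanSpace ℝ (Fin n)), IsChart e →
      ContDiffOn ℝ ∞ (fun z => I (e.symm z) * I (e.symm z)) e.target := fun e he =>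
    (hI e he).mul (hI e he)
  have h1 := exists_eq_const_of_diff_eq_zero (n := n) (I := fun x => I x * I x) hsq (fun x => ?_) x₀ x
  · simpa [hx₀] using h1
  · obtain ⟨e, he, y, hy, rfl⟩ := exists_chart_point (n := n) x
    have hd := ((hI e he).contDiffAt (e.open_target.mem_nhds hy)).differentiableAt
      (by simp : (∞ : WithTop ℕ∞) ≠ 0)
    apply ContinuousLinearMap.coe_injective
    refine (coordBasis he hy).ext fun i => ?_
    rw [coe_coordBasis]
    change diff (n := n) (fun x => I x * I x) (e.symm y) (coordVec e y i) = 0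
    rw [diff_coordVec he hy (hd.fun_mul hd), pderiv_mul hd hd, ← diff_coordVec he hy hd]
    by_cases h0 : diff (n := n) I (e.symm y) = 0
    · rw [h0]; simp
    · rw [h _ h0]; simp

end Constant

/-! ### Polynomial tensors with arbitrary index sets -/

section IndexSets

variable {p q : ℕ} {M : Type*} [TopologicalSpace M]
  [ChartedSpace (EuclideanSpace ℝ (Fin (p + q))) M]

/-- `f` is a tensor field with indices in `ι` that is constructed polynomially from `F`. -/
def IsPolyFun (g : TensorField (p + q) M 2) (ε : TensorField (p + q) M (p + q))
    (F : TensorField (p + q) M p) (K : ℕ∞) {ι : Type}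
    (f : ∀ x : M, (ι → TangentSpace (𝓡 (p + q)) x) → ℝ) : Prop :=
  ∃ (k : ℕ) (σ : Fin k ≃ ι) (T : TensorField (p + q) M k), IsPolynomialIn g ε F K T ∧
    ∀ x v, f x v = T x (fun i => v (σ i))

variable {g : TensorField (p + q) M 2} {ε : TensorField (p + q) M (p + q)}
  {F : TensorField (p + q) M p} {K : ℕ∞} {ι κ : Type}
  {f h : ∀ x : M, (ι → TangentSpace (𝓡 (p + q)) x) → ℝ}

theorem IsPolynomialIn.isPolyFun {k : ℕ} {T : TensorField (p + q) M k}
    (hT : IsPolynomialIn g ε F K T) : IsPolyFun g ε F K (ι := Fin k) (fun x v => T x v) :=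
  ⟨k, Equiv.refl _, T, hT, fun _ _ => rfl⟩

theorem IsPolyFun.reindex (hf : IsPolyFun g ε F K f) (τ : ι ≃ κ) :
    IsPolyFun g ε F K (ι := κ) (fun x v => f x (fun i => v (τ i))) := by
  obtain ⟨k, σ, T, hT, h⟩ := hf
  exact ⟨k, σ.trans τ, T, hT, fun x v => h x _⟩

theorem IsPolyFun.congr {f' : ∀ x : M, (ι → TangentSpace (𝓡 (p + q)) x) → ℝ}
    (hf : IsPolyFun g ε F K f) (h : ∀ x v, f' x v = f x v) : IsPolyFun g ε F K f' := by
  have : f' = f := funext fun x => funext fun v => h x v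
  rwa [this]

theorem IsPolyFun.prod {f' : ∀ x : M, (κ → TangentSpace (𝓡 (p + q)) x) → ℝ}
    (hf : IsPolyFun g ε F K f) (hf' : IsPolyFun g ε F K f') :
    IsPolyFun g ε F K (ι := ι ⊕ κ)
      (fun x v => f x (fun i => v (Sum.inl i)) * f' x (fun i => v (Sum.inr i))) := by
  obtain ⟨k, σ, T, hT, h⟩ := hf
  obtain ⟨k', σ', T', hT', h'⟩ := hf'
  refine ⟨k + k', finSumFinEquiv.symm.trans (Equiv.sumCongr σ σ'), _, hT.prod hT', fun x v => ?_⟩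
  beta_reduce
  rw [h, h', tensorProd_apply]
  simp

theorem IsPolyFun.add (hf : IsPolyFun g ε F K f) (hh : IsPolyFun g ε F K h) :
    IsPolyFun g ε F K (fun x v => f x v + h x v) := by
  obtain ⟨k, σ, T, hT, h1⟩ := hf
  obtain ⟨k', σ', T', hT', h2⟩ := hh
  refine ⟨k, σ, T + UnivForm.reindex (σ'.trans σ.symm) T', hT.add (hT'.reindex _), fun x v => ?_⟩
  beta_reduce
  rw [h1, h2, Pi.add_apply, add_apply]
  congr 1
  change _ = T' x (fun i => v (σ ((σ'.trans σ.symm) i)))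
  simp

/-- The family is nonempty because an empty sum would require the zero field with arbitrary index
set to be polynomial in `F`. -/
theorem IsPolyFun.sum : ∀ {m : ℕ} {f : Fin (m + 1) → ∀ x : M, (ι → TangentSpace (𝓡 (p + q)) x) → ℝ},
    (∀ i, IsPolyFun g ε F K (f i)) → IsPolyFun g ε F K (fun x v => ∑ i, f i x v)
  | 0, f, hf => by simpa using hf 0
  | m + 1, f, hf => by
    have := (hf 0).add (IsPolyFun.sum fun i : Fin (m + 1) => hf i.succ)
    exact this.congr fun x v => Fin.sum_univ_succ _

theorem IsPolyFun.contract [Fintype ι] {f : ∀ x : M, (Fin 2 ⊕ ι → TangentSpace (𝓡 (p + q)) x) → ℝ}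
    (hf : IsPolyFun g ε F K f) :
    IsPolyFun g ε F K (ι := ι) (fun x v => ∑ a, ∑ b, ginv g x a b *
      f x (Sum.elim ![stdVec x a, stdVec x b] v)) := by
  obtain ⟨k, σ, T, hT, h⟩ := hf
  let τ := (Fintype.equivFin ι).symm
  let l := Fintype.card ι
  let ρ : Fin k ≃ Fin (l + 2) :=
    ((σ.trans (Equiv.sumCongr (Equiv.refl _) τ.symm)).trans finSumFinEquiv).trans
      (finCongr (Nat.add_comm 2 l))
  refine ⟨l, τ, _, (hT.reindex ρ).contract, fun x v => ?_⟩
  unfold UnivForm.contract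
  simp only [sum_apply, smul_apply, smul_eq_mul]
  refine Finset.sum_congr rfl fun a _ => Finset.sum_congr rfl fun b _ => ?_
  rw [h]
  congr 1
  change _ = T x (fun i => (Fin.cons (stdVec x a) (Fin.cons (stdVec x b) fun i => v (τ i) :
    Fin (l + 1) → TangentSpace (𝓡 (p + q)) x) : Fin (l + 2) → TangentSpace (𝓡 (p + q)) x) (ρ i))
  congr 1
  ext1 i
  simp only [ρ, Equiv.trans_apply]
  rcases σ i with s | s
  · fin_cases s <;> rfl
  · have h1 : (finCongr (Nat.add_comm 2 l)) (finSumFinEquiv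
        ((Equiv.sumCongr (Equiv.refl (Fin 2)) τ.symm) (Sum.inr s))) = (τ.symm s).succ.succ := by
      ext
      simp
    rw [h1]
    simp

/-- The bijection of index sets used in the recursive definition of contractions. -/
def pairEquiv (q : ℕ) (ι : Type) :
    (Fin (q + 1) ⊕ Fin (q + 1)) ⊕ ι ≃ (Fin q ⊕ Fin q) ⊕ (Fin 2 ⊕ ι) where
  toFun := Sum.elim (Sum.elim (Fin.cons (Sum.inr (Sum.inl 0)) fun i => Sum.inl (Sum.inl i))
    (Fin.cons (Sum.inr (Sum.inl 1)) fun i => Sum.inl (Sum.inr i))) (fun s => Sum.inr (Sum.inr s))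
  invFun := Sum.elim (Sum.elim (fun i => Sum.inl (Sum.inl i.succ)) (fun i => Sum.inl (Sum.inr i.succ)))
    (Sum.elim ![Sum.inl (Sum.inl 0), Sum.inl (Sum.inr 0)] Sum.inr)
  left_inv s := by
    rcases s with (i | i) | s
    · refine Fin.cases ?_ (fun i => ?_) i <;> simp
    · refine Fin.cases ?_ (fun i => ?_) i <;> simp
    · simp
  right_inv s := by
    rcases s with (i | i) | (i | s)
    · simp
    · simp
    · fin_cases i <;> simp
    · simp

/-- Induction on the number of pairs: the first pair is set aside among the free indices, the others
are contracted, and then one further contraction is made. -/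
theorem IsPolyFun.contractAll : ∀ {m : ℕ} {ι : Type} [Fintype ι]
    {f : ∀ x : M, ((Fin m ⊕ Fin m) ⊕ ι → TangentSpace (𝓡 (p + q)) x) → ℝ},
    IsPolyFun g ε F K f →
    IsPolyFun g ε F K (ι := ι) (fun x v => ∑ a : Fin m → Fin (p + q), ∑ c : Fin m → Fin (p + q),
      (∏ i, ginv g x (a i) (c i)) *
        f x (Sum.elim (Sum.elim (fun i => stdVec x (a i)) fun i => stdVec x (c i)) v))
  | 0, ι, _, f, hf => by
    refine (hf.reindex (Equiv.emptySum (Fin 0 ⊕ Fin 0) ι)).congr fun x v => ?_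
    simp only [Finset.univ_unique, Finset.sum_singleton, Finset.univ_eq_empty, Finset.prod_empty,
      one_mul]
    congr 1
    ext1 s
    rcases s with (s | s) | s
    · exact s.elim0
    · exact s.elim0
    · rfl
  | m + 1, ι, _, f, hf => by
    have h1 := (hf.reindex (pairEquiv m ι)).contractAll.contract
    refine h1.congr fun x v => ?_
    have hsplit : ∀ (Φ : (Fin (m + 1) → Fin (p + q)) → (Fin (m + 1) → Fin (p + q)) → ℝ),
        ∑ a, ∑ c, Φ a c = ∑ i, ∑ j, ∑ a : Fin m → Fin (p + q), ∑ c : Fin m → Fin (p + q),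
          Φ (Fin.cons i a) (Fin.cons j c) := by
      intro Φ
      rw [← (Fin.consEquiv fun _ => Fin (p + q)).sum_comp, Fintype.sum_prod_type]
      refine Finset.sum_congr rfl fun i _ => ?_
      rw [Finset.sum_comm]
      rw [← (Fin.consEquiv fun _ => Fin (p + q)).sum_comp, Fintype.sum_prod_type]
      refine Finset.sum_congr rfl fun j _ => ?_
      rw [Finset.sum_comm]
      rfl
    rw [hsplit]
    refine Finset.sum_congr rfl fun i _ => Finset.sum_congr rfl fun j _ => ?_
    rw [Finset.mul_sum]
    refine Finset.sum_congr rfl fun a _ => ?_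
    rw [Finset.mul_sum]
    refine Finset.sum_congr rfl fun c _ => ?_
    rw [Fin.prod_univ_succ]
    simp only [Fin.cons_zero, Fin.cons_succ]
    rw [mul_assoc]
    congr 3
    ext1 s
    rcases s with (s | s) | s
    · refine Fin.cases ?_ (fun s => ?_) s <;> simp [pairEquiv]
    · refine Fin.cases ?_ (fun s => ?_) s <;> simp [pairEquiv]
    · simp [pairEquiv]

end IndexSets

/-! ### Traces of the energy operator as invariants, and generators of the polynomial forms at a
point -/

section TraceInvariants

variable {r q : ℕ} {M : Type*} [TopologicalSpace M]
  [ChartedSpace (EuclideanSpace ℝ (Fin ((r + 1) + q))) M]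
  {g : TensorField ((r + 1) + q) M 2} {ε : TensorField ((r + 1) + q) M ((r + 1) + q)}
  {F : TensorField ((r + 1) + q) M (r + 1)} {K : ℕ∞}

/-- The bijection of index sets that puts the first indices of two tensors last. -/
def energyEquiv (r : ℕ) : Fin (r + 1) ⊕ Fin (r + 1) ≃ (Fin r ⊕ Fin r) ⊕ Fin 2 where
  toFun := Sum.elim (Fin.cons (Sum.inr 0) fun i => Sum.inl (Sum.inr i))
    (Fin.cons (Sum.inr 1) fun i => Sum.inl (Sum.inl i))
  invFun := Sum.elim (Sum.elim (fun i => Sum.inr i.succ) (fun i => Sum.inl i.succ))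
    ![Sum.inl 0, Sum.inr 0]
  left_inv s := by
    rcases s with i | i
    · refine Fin.cases ?_ (fun i => ?_) i <;> simp
    · refine Fin.cases ?_ (fun i => ?_) i <;> simp
  right_inv s := by
    rcases s with (i | i) | i
    · simp
    · simp
    · fin_cases i <;> simp

/-- The bijection of index sets used in the composition of bilinear forms. -/
def compEquiv : Fin 2 ⊕ Fin 2 ≃ Fin 2 ⊕ Fin 2 where
  toFun := Sum.elim ![Sum.inr 0, Sum.inl 0] ![Sum.inl 1, Sum.inr 1]
  invFun := Sum.elim ![Sum.inl 1, Sum.inr 0] ![Sum.inl 0, Sum.inr 1]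
  left_inv s := by
    rcases s with i | i <;> fin_cases i <;> rfl
  right_inv s := by
    rcases s with i | i <;> fin_cases i <;> rfl

theorem isPolyFun_energy {m : ℕ} {A : Fin (m + 1) → TensorField ((r + 1) + q) M (r + 1)}
    (hA : ∀ i, IsPolynomialIn g ε F K (A i)) (hAalt : ∀ i, IsAlternating (A i)) :
    IsPolyFun g ε F K (ι := Fin 2) (fun x v =>
      energy (ginv g x) (stdVec x) (fun i => (hAalt i).alt x) (v 0) (v 1)) := by
  refine (IsPolyFun.sum fun i => ((((hA i).isPolyFun).prod ((hA i).isPolyFun)).reindex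
    (energyEquiv r)).contractAll).congr fun x v => ?_
  rw [energy_apply]
  refine Finset.sum_congr rfl fun i _ => ?_
  unfold pairing
  refine Finset.sum_congr rfl fun a _ => Finset.sum_congr rfl fun c _ => ?_
  congr 1
  change A i x (Fin.cons (v 0) fun j => stdVec x (c j)) *
    A i x (Fin.cons (v 1) fun j => stdVec x (a j)) = _
  congr 2
  · ext1 s
    refine Fin.cases ?_ (fun s => ?_) s <;> simp [energyEquiv]
  · ext1 s
    refine Fin.cases ?_ (fun s => ?_) s <;> simp [energyEquiv]

theorem IsPolyFun.iterForm {S : ∀ x : M, TangentSpace (𝓡 ((r + 1) + q)) x →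
      TangentSpace (𝓡 ((r + 1) + q)) x → ℝ}
    (hS : IsPolyFun g ε F K (ι := Fin 2) (fun x v => S x (v 0) (v 1))) (k : ℕ) :
    IsPolyFun g ε F K (ι := Fin 2) (fun x v =>
      UnivForm.iterForm (ginv g x) (stdVec x) (S x) k (v 0) (v 1)) := by
  induction k with
  | zero => exact hS
  | succ k ih =>
    refine ((ih.prod hS).reindex compEquiv).contract.congr fun x v => ?_
    refine Finset.sum_congr rfl fun a _ => Finset.sum_congr rfl fun c _ => ?_
    rfl

theorem IsPolyFun.isScalarInvariant {f : ∀ x : M, (Fin 0 → TangentSpace (𝓡 ((r + 1) + q)) x) → ℝ}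
    (hf : IsPolyFun g ε F K f) : IsScalarInvariant g ε F K (fun x => f x (fun i => i.elim0)) := by
  obtain ⟨k, σ, T, hT, h⟩ := hf
  obtain rfl : k = 0 := by simpa using Fintype.card_congr σ
  refine ⟨T, hT, fun x => ?_⟩
  beta_reduce
  rw [h]
  congr 1

/-- These complete contractions are the traces of the positive powers of the energy operator. They
are functions on all of `M`, although the forms `A` will be chosen with a single point in view. -/
theorem isScalarInvariant_trace {m : ℕ} {A : Fin (m + 1) → TensorField ((r + 1) + q) M (r + 1)}
    (hA : ∀ i, IsPolynomialIn g ε F K (A i)) (hAalt : ∀ i, IsAlternating (A i)) (k : ℕ) :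
    IsScalarInvariant g ε F K (fun x => ∑ a, ∑ c, ginv g x a c *
      iterForm (ginv g x) (stdVec x)
        (fun v w => energy (ginv g x) (stdVec x) (fun i => (hAalt i).alt x) v w) k
        (stdVec x a) (stdVec x c)) :=
  ((((isPolyFun_energy hA hAalt).iterForm (S := fun x v w =>
    energy (ginv g x) (stdVec x) (fun i => (hAalt i).alt x) v w) k).reindex
      (Equiv.sumEmpty (Fin 2) (Fin 0)).symm).contract).isScalarInvariant

theorem trace_eq_sum_iterForm (hg : IsLorentzianMetric g) {m : ℕ} (x : M)
    (A : Fin m → TangentSpace (𝓡 ((r + 1) + q)) x [⋀^Fin (r + 1)]→ₗ[ℝ] ℝ)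
    {L : Module.End ℝ (TangentSpace (𝓡 ((r + 1) + q)) x)}
    (hL : ∀ v w, gform g x (L v) w = energy (ginv g x) (stdVec x) A v w) (k : ℕ) :
    LinearMap.trace ℝ _ (L ^ (k + 1)) = ∑ a, ∑ c, ginv g x a c *
      iterForm (ginv g x) (stdVec x) (fun v w => energy (ginv g x) (stdVec x) A v w) k
        (stdVec x a) (stdVec x c) := by
  obtain ⟨b, t, hb, _⟩ := hg.exists_frame x
  rw [hb.trace_eq (stdBasis x)]
  have h1 := hb.iterForm_eq (stdBasis x) hL k
  rw [← ginv_eq, coe_stdBasis] at *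
  refine Finset.sum_congr rfl fun a _ => Finset.sum_congr rfl fun c _ => ?_
  rw [h1]

/-! ### Antisymmetrisation -/

theorem isPolynomialIn_zero : IsPolynomialIn g ε F K (0 : TensorField ((r + 1) + q) M (r + 1)) := by
  have h : IsPolynomialIn g ε F K F := IsPolynomialIn.base (j := 0) (by simp) IsIterCovDeriv.zero
  have := h.smul 0
  rwa [zero_smul] at this

theorem IsPolynomialIn.sum {ι : Type*} (s : Finset ι) {P : ι → TensorField ((r + 1) + q) M (r + 1)}
    (hP : ∀ i, IsPolynomialIn g ε F K (P i)) : IsPolynomialIn g ε F K (∑ i ∈ s, P i) :=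
  Finset.sum_induction P (IsPolynomialIn g ε F K) (fun _ _ => IsPolynomialIn.add) isPolynomialIn_zero
    fun i _ => hP i

/-- Freezing the coefficients at their values at `x` gives a polynomial tensor with constant
coefficients. Antisymmetrising makes it alternating everywhere and does not change the value at `x`,
which is alternating already. Since alignment at `x` depends on that value alone, polynomial forms
suffice. -/
theorem IsBuiltForm.exists_isPolynomialIn {T : TensorField ((r + 1) + q) M (r + 1)}
    (hT : IsBuiltForm g ε F K T) (x : M) : ∃ P : TensorField ((r + 1) + q) M (r + 1),
      IsPolynomialIn g ε F K P ∧ IsAlternating P ∧ P x = T x := by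
  obtain ⟨hTalt, m, c, P, hc, hP, hT⟩ := hT
  let R : TensorField ((r + 1) + q) M (r + 1) := ∑ i, c i x • P i
  have hR : IsPolynomialIn g ε F K R := IsPolynomialIn.sum _ fun i => (hP i).smul _
  have hRx : R x = T x := by
    rw [hT]
    simp [R]
  let Q : TensorField ((r + 1) + q) M (r + 1) :=
    ((r + 1).factorial : ℝ)⁻¹ • ∑ σ : Equiv.Perm (Fin (r + 1)),
      ((Equiv.Perm.sign σ : ℤ) : ℝ) • UnivForm.reindex σ R
  have hQ : ∀ y, Q y = ((r + 1).factorial : ℝ)⁻¹ •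
      (MultilinearMap.alternatization (R y)).toMultilinearMap := by
    intro y
    ext v
    have h1 : MultilinearMap.alternatization (R y) v
        = ∑ σ : Equiv.Perm (Fin (r + 1)), Equiv.Perm.sign σ • R y (fun i => v (σ i)) :=
      MultilinearMap.alternatization_apply (R y) v
    change _ = ((r + 1).factorial : ℝ)⁻¹ • MultilinearMap.alternatization (R y) v
    rw [h1]
    simp only [Q, Pi.smul_apply, Finset.sum_apply, smul_apply, sum_apply]
    congr 1
    refine Finset.sum_congr rfl fun σ _ => ?_
    rw [Units.smul_def, zsmul_eq_mul]
    rfl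
  refine ⟨Q, (IsPolynomialIn.sum _ fun σ => (hR.reindex σ).smul _).smul _, ?_, ?_⟩
  · intro y v i j hne hv
    rw [hQ]
    change ((r + 1).factorial : ℝ)⁻¹ • MultilinearMap.alternatization (R y) v = 0
    rw [AlternatingMap.map_eq_zero_of_eq _ v hv hne, smul_zero]
  · rw [hQ, hRx]
    have h2 : MultilinearMap.alternatization (T x)
        = (Fintype.card (Fin (r + 1))).factorial • hTalt.alt x :=
      AlternatingMap.coe_alternatization (hTalt.alt x)
    rw [h2, Fintype.card_fin]
    ext v
    change ((r + 1).factorial : ℝ)⁻¹ • ((r + 1).factorial • T x v) = T x v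
    rw [nsmul_eq_mul, smul_eq_mul, ← mul_assoc, inv_mul_cancel₀ (by positivity), one_mul]

/-- The values at `x` of the antisymmetric tensors constructed polynomially from `F`. -/
def polySpace (g : TensorField ((r + 1) + q) M 2) (ε : TensorField ((r + 1) + q) M ((r + 1) + q))
    (F : TensorField ((r + 1) + q) M (r + 1)) (K : ℕ∞) (x : M) :
    Submodule ℝ (MultilinearMap ℝ (fun _ : Fin (r + 1) => TangentSpace (𝓡 ((r + 1) + q)) x) ℝ) where
  carrier := {S | ∃ P : TensorField ((r + 1) + q) M (r + 1),
    IsPolynomialIn g ε F K P ∧ IsAlternating P ∧ P x = S}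
  add_mem' := by
    rintro _ _ ⟨P, hP, hPa, rfl⟩ ⟨Q, hQ, hQa, rfl⟩
    refine ⟨P + Q, hP.add hQ, fun y v i j hne hv => ?_, rfl⟩
    rw [Pi.add_apply, add_apply, hPa y v i j hne hv, hQa y v i j hne hv, add_zero]
  zero_mem' := ⟨0, isPolynomialIn_zero, fun _ _ _ _ _ _ => rfl, rfl⟩
  smul_mem' := by
    rintro c _ ⟨P, hP, hPa, rfl⟩
    refine ⟨c • P, hP.smul c, fun y v i j hne hv => ?_, rfl⟩
    rw [Pi.smul_apply, smul_apply, hPa y v i j hne hv, smul_zero]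

theorem exists_generators (x : M) : ∃ (m : ℕ) (A : Fin (m + 1) → TensorField ((r + 1) + q) M (r + 1)),
    (∀ i, IsPolynomialIn g ε F K (A i)) ∧ (∀ i, IsAlternating (A i)) ∧
    ∀ P, IsPolynomialIn g ε F K P → IsAlternating P →
      P x ∈ Submodule.span ℝ (Set.range fun i => A i x) := by
  obtain ⟨m, s, hs⟩ := Submodule.fg_iff_exists_fin_generating_family.1
    (IsNoetherian.noetherian (polySpace g ε F K x))
  have hmem : ∀ i, s i ∈ polySpace g ε F K x := fun i =>
    hs ▸ Submodule.subset_span (Set.mem_range_self i)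
  choose A hA hAalt hAx using hmem
  -- The zero form is put in front so that the family is nonempty, as the sum defining the energy
  -- requires.
  refine ⟨m, Fin.cons 0 A, fun i => ?_, fun i => ?_, fun P hP hPalt => ?_⟩
  · refine Fin.cases isPolynomialIn_zero (fun i => ?_) i
    exact hA i
  · refine Fin.cases (fun _ _ _ _ _ _ => rfl) (fun i => ?_) i
    exact hAalt i
  · have h1 : P x ∈ Submodule.span ℝ (Set.range s) := by
      rw [hs]; exact ⟨P, hP, hPalt, rfl⟩
    refine Submodule.span_mono ?_ h1
    rintro _ ⟨i, rfl⟩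
    exact ⟨i.succ, hAx i⟩

end TraceInvariants

/-! ### Nilpotency of the energy operator and the common null direction -/

section Main

variable {r : ℕ} {M : Type*} [TopologicalSpace M]
  [ChartedSpace (EuclideanSpace ℝ (Fin ((r + 1) + (r + 1)))) M]
  {g : TensorField ((r + 1) + (r + 1)) M 2} {ε : TensorField ((r + 1) + (r + 1)) M ((r + 1) + (r + 1))}
  {F : TensorField ((r + 1) + (r + 1)) M (r + 1)} {K : ℕ∞}

/-- If some invariant is not constant, the energy operators of the polynomial forms are nilpotent. -/
theorem IsUniversal.isNilpotent_energy [IsManifold (𝓡 ((r + 1) + (r + 1))) ∞ M] [ConnectedSpace M]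
    (hg : IsLorentzianMetric g) (hε : IsVolumeForm g ε) (hFs : IsSmooth F) (hFalt : IsAlternating F)
    (hF : IsUniversal g ε F K) {I₀ : M → ℝ} (hI₀ : IsScalarInvariant g ε F K I₀) {x₀ : M}
    (hx₀ : diff (n := (r + 1) + (r + 1)) I₀ x₀ ≠ 0) {m : ℕ}
    {A : Fin (m + 1) → TensorField ((r + 1) + (r + 1)) M (r + 1)}
    (hA : ∀ i, IsPolynomialIn g ε F K (A i)) (hAalt : ∀ i, IsAlternating (A i)) (x : M)
    {L : Module.End ℝ (TangentSpace (𝓡 ((r + 1) + (r + 1))) x)}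
    (hL : ∀ v w, gform g x (L v) w = energy (ginv g x) (stdVec x) (fun i => (hAalt i).alt x) v w) :
    IsNilpotent L := by
  refine isNilpotent_of_trace_pow_eq_zero L fun k => ?_
  rw [trace_eq_sum_iterForm hg x _ hL]
  have hinv := isScalarInvariant_trace hA hAalt k
  -- Stated for an arbitrary invariant `J` because it serves twice: for the trace itself at points
  -- where its own differential is nonzero, and for `I₀` at `x₀`.
  have hvanish : ∀ {J : M → ℝ} {y : M}, IsScalarInvariant g ε F K J →
      diff (n := (r + 1) + (r + 1)) J y ≠ 0 → ∑ a, ∑ c, ginv g y a c *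
      iterForm (ginv g y) (stdVec y)
        (fun v w => energy (ginv g y) (stdVec y) (fun i => (hAalt i).alt y) v w) k
        (stdVec y a) (stdVec y c) = 0 := by
    intro J y hJ hy
    obtain ⟨b, t, hb, _⟩ := hg.exists_frame y
    obtain ⟨L', hL'⟩ := hb.exists_operator
      (energy (ginv g y) (stdVec y) (fun i => (hAalt i).alt y))
    rw [← trace_eq_sum_iterForm hg y _ hL']
    refine trace_pow_eq_zero_of_sq_eq_zero ?_ k
    refine hb.energy_sq_eq_zero (fun i => (hAalt i).alt y) L' (fun v w => ?_)
      (sharp_ne_zero hg hy) ?_ (fun i u => ?_) (fun i => ?_)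
    · rw [hL', ginv_eq, ← coe_stdBasis, hb.energy_frame b]
    · exact (hF.isNullVector_sharp hg hε hFs hFalt hJ hy).2
    · exact hF.interior_sharp hg hε hFs hJ ((hA i).isBuiltForm (hAalt i)) y u
    · exact hF.wedge_sharp hg hε hFs hJ ((hA i).isBuiltForm (hAalt i)) y
  exact eq_zero_of_mul_diff_eq_zero (fun e he => hinv.contDiffOn hg hε hFs he)
    (fun y hy => hvanish hinv hy) (hvanish hI₀ hx₀) x

theorem exists_null (hg : IsLorentzianMetric g) (x : M) :
    ∃ k : TangentSpace (𝓡 ((r + 1) + (r + 1))) x, IsNullVector g x k := by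
  obtain ⟨b, t, hb, _⟩ := hg.exists_frame x
  have : Nontrivial (Fin ((r + 1) + (r + 1))) := Fin.nontrivial_iff_two_le.2 (by omega)
  obtain ⟨s, hst⟩ := exists_ne t
  refine ⟨b t + b s, fun h => ?_, ?_⟩
  · have h1 := congrArg (fun v => b.repr v t) h
    simp [hst] at h1
  · rw [← gform_apply]
    simp [hb _ _, hst, hst.symm, frameSign_of_ne hst]

/-- If some invariant is not constant, all built forms have a common aligned null direction at
every point. -/
theorem IsUniversal.exists_isNullAligned [IsManifold (𝓡 ((r + 1) + (r + 1))) ∞ M] [ConnectedSpace M]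
    (hg : IsLorentzianMetric g) (hε : IsVolumeForm g ε) (hFs : IsSmooth F) (hFalt : IsAlternating F)
    (hF : IsUniversal g ε F K) {I₀ : M → ℝ} (hI₀ : IsScalarInvariant g ε F K I₀) {x₀ : M}
    (hx₀ : diff (n := (r + 1) + (r + 1)) I₀ x₀ ≠ 0) (x : M) :
    ∃ k : TangentSpace (𝓡 ((r + 1) + (r + 1))) x,
      ∀ T, IsBuiltForm g ε F K T → IsNullAligned g x k T := by
  obtain ⟨m, A, hA, hAalt, hspan⟩ := exists_generators (g := g) (ε := ε) (F := F) (K := K) x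
  obtain ⟨b, t, hb, hb'⟩ := hg.exists_frame x
  obtain ⟨L, hL⟩ := hb.exists_operator (energy (ginv g x) (stdVec x) (fun i => (hAalt i).alt x))
  have hnil := hF.isNilpotent_energy hg hε hFs hFalt hI₀ hx₀ hA hAalt x hL
  have hint : ∀ k : TangentSpace (𝓡 ((r + 1) + (r + 1))) x,
      (∀ i (u : Fin r → TangentSpace (𝓡 ((r + 1) + (r + 1))) x), A i x (Fin.cons k u) = 0) →
      ∀ P : TensorField ((r + 1) + (r + 1)) M (r + 1), IsPolynomialIn g ε F K P → IsAlternating P →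
      ∀ u : Fin r → TangentSpace (𝓡 ((r + 1) + (r + 1))) x, P x (Fin.cons k u) = 0 := by
    intro k hk P hP hPalt u
    refine Submodule.span_induction (p := fun S _ => S (Fin.cons k u) = 0) ?_ rfl ?_ ?_
      (hspan P hP hPalt)
    · rintro _ ⟨i, rfl⟩; exact hk i u
    · intro S S' _ _ hS hS'; rw [add_apply, hS, hS', add_zero]
    · intro c S _ hS; rw [smul_apply, hS, smul_zero]
  -- The dual of `P` is polynomial as well, so its value at `x` lies in the same span and is
  -- annihilated by `k`; duality gives `k ∧ P = 0`.
  have hwedge : ∀ k : TangentSpace (𝓡 ((r + 1) + (r + 1))) x,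
      (∀ i (u : Fin r → TangentSpace (𝓡 ((r + 1) + (r + 1))) x), A i x (Fin.cons k u) = 0) →
      ∀ P : TensorField ((r + 1) + (r + 1)) M (r + 1), IsPolynomialIn g ε F K P →
      ∀ hPalt : IsAlternating P, wedge (gform g x k) (hPalt.alt x) = 0 := by
    intro k hk P hP hPalt
    refine hb.wedge_eq_zero rfl ((hε.alternating.alt x).domDomCongr finSumFinEquiv.symm)
      (fun f hf => hε.apply_ne_zero hb' hf) (hPalt.alt x) k fun v => ?_
    have h1 := hint k hk _ hP.dual (isAlternating_hodge g hε.alternating P) v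
    rw [hodge_frame hε.alternating hPalt hb] at h1
    exact (mul_eq_zero.1 h1).resolve_left (by positivity)
  suffices h : ∃ k, IsNullVector g x k ∧
      ∀ P : TensorField ((r + 1) + (r + 1)) M (r + 1), IsPolynomialIn g ε F K P → IsAlternating P → IsNullAligned g x k P by
    obtain ⟨k, _, hk⟩ := h
    refine ⟨k, fun T hT => ?_⟩
    obtain ⟨P, hP, hPalt, hPT⟩ := hT.exists_isPolynomialIn x
    exact isNullAligned_of_eq (hk P hP hPalt) hPT.symm
  rcases hb.exists_interior_eq_zero (fun i => (hAalt i).alt x) L (fun v w => by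
    rw [hL, ginv_eq, ← coe_stdBasis, hb.energy_frame b]) hnil with ⟨k, hk0, hkk, hk⟩ | ⟨k, hkk, hk⟩
  · exact ⟨k, ⟨hk0, hkk⟩, fun P hP hPalt => isNullAligned_of hPalt ⟨hk0, hkk⟩
      (hint k hk P hP hPalt) (hwedge k hk P hP hPalt)⟩
  -- For a non-null `k`, the conditions `k ⌟ P = 0` and `k ∧ P = 0` give `g(k, k) P = 0`. All forms
  -- vanish at `x`, and any null vector is aligned with them.
  · have hzero : ∀ P : TensorField ((r + 1) + (r + 1)) M (r + 1), IsPolynomialIn g ε F K P →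
        IsAlternating P → ∀ v, P x v = 0 := by
      intro P hP hPalt v
      exact (mul_eq_zero.1 (mul_eq_zero_of_wedge_of_interior (gform g x k) (hPalt.alt x)
        (hwedge k hk P hP hPalt) (hint k hk P hP hPalt) v)).resolve_left hkk
    obtain ⟨l, hl⟩ := exists_null hg x
    exact ⟨l, hl, fun P hP hPalt => ⟨hl, fun v _ => hzero P hP hPalt v,
      fun v => Finset.sum_eq_zero fun j _ => by rw [hzero P hP hPalt, mul_zero]⟩⟩

end Main

end UnivForm

end

/-- Here `n = 2p` is written `p + p`, and `K : ℕ∞`: `K = ⊤` is the case of universal and CSI,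
finite `K` that of `K`-universal and CSI_K. -/
theorem proposition3p1 {p : ℕ} {M : Type*} [TopologicalSpace M]
    [ChartedSpace (EuclideanSpace ℝ (Fin (p + p))) M] [IsManifold (𝓡 (p + p)) ∞ M]
    [ConnectedSpace M]
    (g : TensorField (p + p) M 2) (hg : IsLorentzianMetric g)
    (ε : TensorField (p + p) M (p + p)) (hε : IsVolumeForm g ε)
    (F : TensorField (p + p) M p) (hFsmooth : IsSmooth F) (hFalt : IsAlternating F)
    (K : ℕ∞) (hF : IsUniversal g ε F K) :
    IsCSI g ε F K ∨
    -- at every point, `F` and all `F̃` are null with a common aligned null direction, along which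
    -- all invariants are constant
    ((∀ x : M, ∃ k : TangentSpace (𝓡 (p + p)) x,
        IsNullAligned g x k F ∧
        (∀ T : TensorField (p + p) M p, IsBuiltForm g ε F K T → IsNullAligned g x k T) ∧
        ∀ J : M → ℝ, IsScalarInvariant g ε F K J → diff J x k = 0) ∧
    -- some invariant has a gradient that is not identically zero
      (∃ I : M → ℝ, IsScalarInvariant g ε F K I ∧ ∃ x : M, diff (n := p + p) I x ≠ 0) ∧
    -- wherever the gradient of an invariant does not vanish, it spans this direction, and this
    -- direction is geodesic and twist-free
      (∀ I : M → ℝ, IsScalarInvariant g ε F K I → ∀ x : M, diff (n := p + p) I x ≠ 0 →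
        IsNullAligned g x (sharp g x (diff I x)) F ∧
        (∀ T : TensorField (p + p) M p, IsBuiltForm g ε F K T →
          IsNullAligned g x (sharp g x (diff I x)) T) ∧
        IsGeodesicAt g (diffField I) x ∧ IsTwistFreeAt g (diffField I) x ∧
        ∀ J : M → ℝ, IsScalarInvariant g ε F K J →
          diff J x (sharp g x (diff I x)) = 0 ∧
          ∃ c : ℝ, diff (n := p + p) J x = c • diff I x)) := by
  -- For `p = 0` the manifold would have dimension zero, which leaves no room for a timelike frame
  -- vector.
  have hp : p ≠ 0 := by
    rintro rfl
    obtain ⟨x⟩ := (inferInstance : Nonempty M)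
    obtain ⟨_, t, _⟩ := hg.lorentz x
    exact t.elim0
  obtain ⟨r, rfl⟩ := Nat.exists_eq_succ_of_ne_zero hp
  by_cases hall : ∀ I : M → ℝ, IsScalarInvariant g ε F K I →
      ∀ x, diff (n := (r + 1) + (r + 1)) I x = 0
  · left
    intro I hI
    obtain ⟨x₀⟩ := (inferInstance : Nonempty M)
    exact ⟨I x₀, fun x => exists_eq_const_of_diff_eq_zero
      (fun e he => hI.contDiffOn hg hε hFsmooth he) (hall I hI) x₀ x⟩
  · right
    push Not at hall
    obtain ⟨I₀, hI₀, x₀, hx₀⟩ := hall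
    refine ⟨fun x => ?_, ⟨I₀, hI₀, x₀, hx₀⟩, fun I hI x hx => ?_⟩
    -- A nonzero gradient at `x` supplies the direction itself. If all gradients vanish at `x`, the
    -- nilpotency argument supplies it, and constancy of the invariants along it is trivial.
    · by_cases hx : ∀ I : M → ℝ, IsScalarInvariant g ε F K I →
          diff (n := (r + 1) + (r + 1)) I x = 0
      · obtain ⟨k, hk⟩ := hF.exists_isNullAligned hg hε hFsmooth hFalt hI₀ hx₀ x
        exact ⟨k, hk F (isBuiltForm_self hFalt), hk, fun J hJ => by rw [hx J hJ]; rfl⟩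
      · push Not at hx
        obtain ⟨I, hI, hIx⟩ := hx
        exact ⟨sharp g x (diff I x),
          hF.isNullAligned_sharp hg hε hFsmooth hFalt hI hIx (isBuiltForm_self hFalt),
          fun T hT => hF.isNullAligned_sharp hg hε hFsmooth hFalt hI hIx hT,
          fun J hJ => hF.diff_sharp_eq_zero hg hε hFsmooth hFalt hJ hI x⟩
    · exact ⟨hF.isNullAligned_sharp hg hε hFsmooth hFalt hI hx (isBuiltForm_self hFalt),
        fun T hT => hF.isNullAligned_sharp hg hε hFsmooth hFalt hI hx hT,
        isGeodesicAt_diffField hg (fun e he => hI.contDiffOn hg hε hFsmooth he)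
          (fun y => hF.diff_sharp_eq_zero hg hε hFsmooth hFalt hI hI y) x,
        isTwistFreeAt_diffField hg (fun e he => hI.contDiffOn hg hε hFsmooth he) x,
        fun J hJ => ⟨hF.diff_sharp_eq_zero hg hε hFsmooth hFalt hJ hI x,
          hF.diff_eq_smul hg hε hFsmooth hFalt hI hJ hx⟩⟩
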